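/- Let $(M,g)$ be a connected, oriented, smooth four-dimensional space-time with metric $g$ of signature $(-,+,+,+)$ and metric volume element $\eta$. Let $*$ be the Hodge dual, $(*F)_{\alpha\beta}=\frac12\eta_{\alpha\beta\gamma\delta}F^{\gamma\delta}$, let $W$ be the Weyl tensor, and put $$\mathcal W=\tfrac12(W-\mathrm i\,{*W}),\qquad \mathcal G=\tfrac12(G-\mathrm i\,\eta),\qquad G_{\alpha\beta\gamma\delta}=g_{\alpha\gamma}g_{\beta\delta}-g_{\alpha\delta}g_{\beta\gamma}.$$ Assume that $\mathrm{Ric}(g)=0$ and that $g$ is of Petrov type D at every point, i.e. at every point $$\mathcal W=3w\,\mathcal U\otimes\mathcal U+w\,\mathcal G,\qquad w\neq0,\qquad \mathcal U=\tfrac1{\sqrt2}(U-\mathrm i\,{*U}),\qquad \tfrac12\,\mathcal U_{\alpha\beta}\,\mathcal U^{\alpha\beta}=-1,$$ for a complex number $w$ and a real 2-form $U$. Here $U$ is unique up to sign and can be chosen smoothly near every point. Let $v=U^2$, that is $v_{\alpha\beta}=U_{\alpha\mu}U^{\mu}{}_{\beta}$, and $h=g-v$ be the projectors on the time-like and the space-like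 principal planes. With $(\delta F)_\beta=-\nabla^\alpha F_{\alpha\beta}$ and $(i(X)F)_\beta=X^\alpha F_{\alpha\beta}$, define the 1-forms (independent of the sign of $U$) $$\Phi=i(\delta U)U-i(\delta{*U}){*U},\qquad \Psi=-i(\delta U){*U}-i(\delta{*U})U .$$ Then, where "$=0$" means vanishing identically on $M$: (i) if $v(\Phi)=0$, then $v(\Psi)=0$; (ii) if $h(\Phi)=0$, then $h(\Psi)=0$; (iii) if $v(\Psi)=0$, then $v(\Phi)=0$ or $h(\Psi)=0$; (iv) if $h(\Psi)=0$, then $h(\Phi)=0$ or $v(\Psi)=0$. -/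

import Mathlib

open scoped Manifold ContDiff

noncomputable section

namespace TypeDVacuum

/-- The model space of a four-dimensional manifold. -/
abbrev E4 : Type := EuclideanSpace ℝ (Fin 4)

/-- Arrays of components of a covariant 2-tensor. -/
abbrev Tensor2 (R : Type) : Type := Matrix (Fin 4) (Fin 4) R

/-- Arrays of components of a covariant 4-tensor. -/
abbrev Tensor4 (R : Type) : Type := Fin 4 → Fin 4 → Fin 4 → Fin 4 → R

/-! ### Algebra at a point

`g` is the array of components of the metric, `g⁻¹` that of the inverse metric, and `η` that of the
metric volume element. All tensors are written with lower indices. -/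

/-- Raising the index of a covector: `X^a = g^{ab} X_b`. -/
def raise (g : Tensor2 ℝ) (X : Fin 4 → ℝ) (a : Fin 4) : ℝ := ∑ b, g⁻¹ a b * X b

/-- The interior product of a covector (with its index raised) and a 2-form:
`(i(X)F)_b = X^a F_{ab}`. -/
def interior (g : Tensor2 ℝ) (X : Fin 4 → ℝ) (F : Tensor2 ℝ) (b : Fin 4) : ℝ :=
  ∑ a, raise g X a * F a b

/-- The product of 2-tensors, `(A · B)_{ab} = A_{ac} g^{cd} B_{db}`. -/
def tprod (g A B : Tensor2 ℝ) : Tensor2 ℝ := A * g⁻¹ * B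

/-- The action of a 2-tensor on a covector, `(A(X))_a = A_{ab} g^{bc} X_c`. -/
def act (g A : Tensor2 ℝ) (X : Fin 4 → ℝ) (a : Fin 4) : ℝ := ∑ b, A a b * raise g X b

/-- The Hodge dual of a 2-form, `(*F)_{ab} = ½ η_{abcd} F^{cd}`. -/
def hodge (g : Tensor2 ℝ) (η : Tensor4 ℝ) (F : Tensor2 ℝ) : Tensor2 ℝ :=
  fun a b => (1 / 2) * ∑ c, ∑ d, ∑ e, ∑ f, η a b c d * g⁻¹ c e * g⁻¹ d f * F e f

/-- The Hodge dual of a double 2-form, `(*W)_{abcd} = ½ η_{abpq} W^{pq}_{cd}`. -/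
def hodge4 (g : Tensor2 ℝ) (η W : Tensor4 ℝ) : Tensor4 ℝ :=
  fun a b c d => hodge g η (fun e f => W e f c d) a b

/-- The metric on the space of 2-forms, `G_{abcd} = g_{ac} g_{bd} - g_{ad} g_{bc}`. -/
def bigG (g : Tensor2 ℝ) : Tensor4 ℝ :=
  fun a b c d => g a c * g b d - g a d * g b c

/-- The metric `½ (G - i η)` on the space of self-dual 2-forms. -/
def calG (g : Tensor2 ℝ) (η : Tensor4 ℝ) : Tensor4 ℂ :=
  fun a b c d => (1 / 2) * ((bigG g a b c d : ℂ) - Complex.I * (η a b c d : ℂ))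

/-- The self-dual 2-form `(1/√2) (U - i *U)` associated with a real 2-form `U`. -/
def calU (g : Tensor2 ℝ) (η : Tensor4 ℝ) (U : Tensor2 ℝ) : Tensor2 ℂ :=
  fun a b => ((1 / Real.sqrt 2 : ℝ) : ℂ) * ((U a b : ℂ) - Complex.I * (hodge g η U a b : ℂ))

/-- The self-dual part `½ (W - i *W)` of a real double 2-form `W`. -/
def calW (g : Tensor2 ℝ) (η W : Tensor4 ℝ) : Tensor4 ℂ :=
  fun a b c d => (1 / 2) * ((W a b c d : ℂ) - Complex.I * (hodge4 g η W a b c d : ℂ))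

/-- The scalar product `(A, B) = ½ A_{ab} B^{ab}` of complex 2-forms. -/
def inner2 (g : Tensor2 ℝ) (A B : Tensor2 ℂ) : ℂ :=
  (1 / 2) * ∑ a, ∑ b, ∑ c, ∑ d, A a b * ((g⁻¹ a c : ℝ) : ℂ) * ((g⁻¹ b d : ℝ) : ℂ) * B c d

/-- `𝒲 = 3 w 𝒰 ⊗ 𝒰 + w 𝒢` with `w ≠ 0` and `𝒰 = (1/√2) (U - i *U)`, `(𝒰, 𝒰) = -1`:
the Weyl tensor `W` is of Petrov type D, with eigenvalue `w` and canonical bivector `𝒰`. -/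
structure IsCanonicalForm (g : Tensor2 ℝ) (η W : Tensor4 ℝ) (w : ℂ) (U : Tensor2 ℝ) : Prop where
  ne_zero : w ≠ 0
  antisymm : ∀ a b, U a b = -U b a
  normalized : inner2 g (calU g η U) (calU g η U) = -1
  weyl_eq : ∀ a b c d, calW g η W a b c d =
    3 * w * (calU g η U a b * calU g η U c d) + w * calG g η a b c d

/-- The projector `v = U²` on the time-like principal plane. -/
def vProj (g U : Tensor2 ℝ) : Tensor2 ℝ := tprod g U U

/-- The projector `h = g - v` on the space-like principal plane. -/
def hProj (g U : Tensor2 ℝ) : Tensor2 ℝ := g - vProj g U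

/-! ### Tensor calculus in coordinates -/

/-- The partial derivative `∂_i f`. -/
def pd (i : Fin 4) (f : E4 → ℝ) (y : E4) : ℝ := fderiv ℝ f y (EuclideanSpace.single i 1)

/-- The Christoffel symbols `Γ^k_{ij}` of the Levi-Civita connection. -/
def christoffel (g : E4 → Tensor2 ℝ) (k i j : Fin 4) (y : E4) : ℝ :=
  (1 / 2) * ∑ l, (g y)⁻¹ k l *
    (pd i (fun z => g z j l) y + pd j (fun z => g z i l) y - pd l (fun z => g z i j) y)

/-- The curvature tensor `R^a_{bcd}`. -/
def riemannUp (g : E4 → Tensor2 ℝ) (a b c d : Fin 4) (y : E4) : ℝ :=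
  pd c (christoffel g a b d) y - pd d (christoffel g a b c) y
    + ∑ e, (christoffel g a c e y * christoffel g e b d y
      - christoffel g a d e y * christoffel g e b c y)

/-- The Riemann tensor `R_{abcd}`. -/
def riemann (g : E4 → Tensor2 ℝ) (y : E4) : Tensor4 ℝ :=
  fun a b c d => ∑ e, g y a e * riemannUp g e b c d y

/-- The Ricci tensor `R_{bd} = R^a_{bad}`. -/
def ricci (g : E4 → Tensor2 ℝ) (y : E4) : Tensor2 ℝ :=
  fun b d => ∑ a, riemannUp g a b a d y

/-- The scalar curvature. -/
def scalarCurv (g : E4 → Tensor2 ℝ) (y : E4) : ℝ := ∑ a, ∑ b, (g y)⁻¹ a b * ricci g y a b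

/-- The Weyl tensor `W_{abcd}` in dimension four. -/
def weyl (g : E4 → Tensor2 ℝ) (y : E4) : Tensor4 ℝ := fun a b c d =>
  riemann g y a b c d
    - (1 / 2) * (g y a c * ricci g y b d - g y a d * ricci g y b c
        + g y b d * ricci g y a c - g y b c * ricci g y a d)
    + (scalarCurv g y / 6) * bigG (g y) a b c d

/-- The covariant derivative `∇_c F_{ab}`. -/
def covDeriv (g F : E4 → Tensor2 ℝ) (c a b : Fin 4) (y : E4) : ℝ :=
  pd c (fun z => F z a b) y
    - ∑ d, (christoffel g d c a y * F y d b + christoffel g d c b y * F y a d)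

/-- The codifferential `(δF)_b = -∇^a F_{ab}`. -/
def codiff (g F : E4 → Tensor2 ℝ) (y : E4) (b : Fin 4) : ℝ :=
  -∑ c, ∑ a, (g y)⁻¹ c a * covDeriv g F c a b y

/-- The field `*U`. -/
def hodgeField (g : E4 → Tensor2 ℝ) (η : E4 → Tensor4 ℝ) (U : E4 → Tensor2 ℝ) : E4 → Tensor2 ℝ :=
  fun z => hodge (g z) (η z) (U z)

/-- `Φ = i(δU)U - i(δ*U)*U`. -/
def Phi (g : E4 → Tensor2 ℝ) (η : E4 → Tensor4 ℝ) (U : E4 → Tensor2 ℝ) (y : E4) (b : Fin 4) : ℝ :=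
  interior (g y) (codiff g U y) (U y) b
    - interior (g y) (codiff g (hodgeField g η U) y) (hodgeField g η U y) b

/-- `Ψ = -i(δU)*U - i(δ*U)U`. -/
def Psi (g : E4 → Tensor2 ℝ) (η : E4 → Tensor4 ℝ) (U : E4 → Tensor2 ℝ) (y : E4) (b : Fin 4) : ℝ :=
  -interior (g y) (codiff g U y) (hodgeField g η U y) b
    - interior (g y) (codiff g (hodgeField g η U) y) (U y) b

/-- `v(Φ)`. -/
def vPhi (g : E4 → Tensor2 ℝ) (η : E4 → Tensor4 ℝ) (U : E4 → Tensor2 ℝ) (y : E4) : Fin 4 → ℝ :=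
  act (g y) (vProj (g y) (U y)) (Phi g η U y)

/-- `h(Φ)`. -/
def hPhi (g : E4 → Tensor2 ℝ) (η : E4 → Tensor4 ℝ) (U : E4 → Tensor2 ℝ) (y : E4) : Fin 4 → ℝ :=
  act (g y) (hProj (g y) (U y)) (Phi g η U y)

/-- `v(Ψ)`. -/
def vPsi (g : E4 → Tensor2 ℝ) (η : E4 → Tensor4 ℝ) (U : E4 → Tensor2 ℝ) (y : E4) : Fin 4 → ℝ :=
  act (g y) (vProj (g y) (U y)) (Psi g η U y)

/-- `h(Ψ)`. -/
def hPsi (g : E4 → Tensor2 ℝ) (η : E4 → Tensor4 ℝ) (U : E4 → Tensor2 ℝ) (y : E4) : Fin 4 → ℝ :=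
  act (g y) (hProj (g y) (U y)) (Psi g η U y)

/-! ### Oriented space-times -/

section Manifold

variable {M : Type*} [TopologicalSpace M] [ChartedSpace E4 M]

/-- The coordinate vector `∂_i` of the chart `e` at the point with coordinates `y`. -/
def coordVec (e : OpenPartialHomeomorph M E4) (y : E4) (i : Fin 4) :
    TangentSpace (𝓡 4) (e.symm y) :=
  mfderiv (𝓡 4) (𝓡 4) e.symm y (EuclideanSpace.single i (1 : ℝ) : E4)

variable (M) in
/-- A smooth Lorentzian metric of signature `(-,+,+,+)` on `M` together with an orientation, given
by its metric volume element. -/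
structure OrientedSpacetime where
  metric : ∀ x : M, TangentSpace (𝓡 4) x →ₗ[ℝ] TangentSpace (𝓡 4) x →ₗ[ℝ] ℝ
  metric_symm : ∀ x u v, metric x u v = metric x v u
  lorentzian : ∀ x, ∃ b : Module.Basis (Fin 4) ℝ (TangentSpace (𝓡 4) x), ∀ i j,
    metric x (b i) (b j) = if i = j then (if i = 0 then -1 else 1) else 0
  vol : ∀ x : M, TangentSpace (𝓡 4) x [⋀^Fin 4]→ₗ[ℝ] ℝ
  vol_sq : ∀ x (u : Fin 4 → TangentSpace (𝓡 4) x),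
    vol x u ^ 2 = -(Matrix.of fun i j => metric x (u i) (u j)).det
  metric_smooth : ∀ e ∈ atlas E4 M, ∀ i j, ContDiffOn ℝ ∞
    (fun y => metric (e.symm y) (coordVec e y i) (coordVec e y j)) e.target
  vol_smooth : ∀ e ∈ atlas E4 M, ContDiffOn ℝ ∞
    (fun y => vol (e.symm y) (coordVec e y)) e.target

namespace OrientedSpacetime

variable (S : OrientedSpacetime M)

/-- The components `g_{ij}` of the metric in the chart `e`. -/
def gIn (e : OpenPartialHomeomorph M E4) (y : E4) : Tensor2 ℝ :=
  fun i j => S.metric (e.symm y) (coordVec e y i) (coordVec e y j)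

/-- The components `η_{ijkl}` of the metric volume element in the chart `e`. -/
def volIn (e : OpenPartialHomeomorph M E4) (y : E4) : Tensor4 ℝ :=
  fun i j k l => S.vol (e.symm y) ![coordVec e y i, coordVec e y j, coordVec e y k, coordVec e y l]

/-- The vacuum equations `Ric = 0`. -/
def IsVacuum : Prop :=
  ∀ e ∈ atlas E4 M, ∀ y ∈ e.target, ricci (S.gIn e) y = 0

/-- The Weyl tensor is of Petrov type D at every point. -/
def IsTypeD : Prop :=
  ∀ e ∈ atlas E4 M, ∀ y ∈ e.target, ∃ (w : ℂ) (U : Tensor2 ℝ),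
    IsCanonicalForm (S.gIn e y) (S.volIn e y) (weyl (S.gIn e) y) w U

/-- `U` gives, on the open subset `V` of the range of the chart `e`, the components of a smooth real
2-form such that `𝒰 = (1/√2) (U - i *U)` is the canonical bivector of the Weyl tensor. -/
structure IsCanonicalBivectorOn (e : OpenPartialHomeomorph M E4) (V : Set E4)
    (U : E4 → Tensor2 ℝ) : Prop where
  isOpen : IsOpen V
  subset : V ⊆ e.target
  smooth : ∀ a b, ContDiffOn ℝ ∞ (fun y => U y a b) V
  canonical : ∀ y ∈ V, ∃ w : ℂ,
    IsCanonicalForm (S.gIn e y) (S.volIn e y) (weyl (S.gIn e) y) w (U y)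

/-- The first order concomitant `T` of the metric, the orientation and the canonical bivector
vanishes on the whole space-time. The canonical bivector is determined up to its sign, hence is
chosen smoothly near every point; the concomitants to which this is applied are `v(Φ)`, `h(Φ)`,
`v(Ψ)` and `h(Ψ)`, which do not depend on the sign. -/
def Vanishes (T : (E4 → Tensor2 ℝ) → (E4 → Tensor4 ℝ) → (E4 → Tensor2 ℝ) → E4 → Fin 4 → ℝ) :
    Prop :=
  ∀ e ∈ atlas E4 M, ∀ y ∈ e.target, ∃ (V : Set E4) (U : E4 → Tensor2 ℝ),
    y ∈ V ∧ S.IsCanonicalBivectorOn e V U ∧ ∀ z ∈ V, T (S.gIn e) (S.volIn e) U z = 0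

end OrientedSpacetime

end Manifold

end TypeDVacuum

end

/-! The canonical bivector determines, locally and up to boosts and rotations, a null frame
$(L,N,M,\bar M)$ adapted to the two principal planes. In such a frame the self-dual part of the
Levi-Civita connection consists of three complex 1-forms $a,b,c$, a connection with values in
$\mathfrak{sl}(2,\mathbb C)$. For a vacuum metric of type D its curvature $da-b\wedge c$,
$db-2a\wedge b$, $dc+2a\wedge c$ has constant components up to a single function $\psi=-2w$.

Since $\psi$ is invertible, the Bianchi identity forces $b(M)=b(N)=c(\bar M)=c(L)=0$ (`b_M`, `b_N`,
`c_Mb`, `c_L`; this is the Goldberg-Sachs theorem). It also identifies the four remaining values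
$r=c(M)$, $r'=b(\bar M)$, $t=c(N)$, $t'=b(L)$ with the derivatives of $\frac13\log\psi$ along $L$,
$N$, $\bar M$, $M$ (`L_psi`, `N_psi`, `Mb_psi`, `M_psi`). The concomitants are expressed by these
four functions: $v(\Phi)=0$ means that $r,r'$ are imaginary, $v(\Psi)=0$ that they are real,
$h(\Phi)=0$ that $\bar t'=-t$, and $h(\Psi)=0$ that $\bar t'=t$ (`vPhi_iff`, `vPsi_iff`, `hPhi_iff`,
`hPsi_iff`).

Claims (i) and (ii) follow from Riccati equations such as $L r=r^2-(a+\bar a)(L)\,r$: if $\bar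
r=-r$, adding the conjugate equation leaves $2r^2=0$. So $r=r'=0$, respectively $t=t'=0$
(`cM_sq_eq_zero`, `bMb_sq_eq_zero`, `cN_sq_eq_zero`).

For (iii) let $r,r'$ be real. The commutator $[M,\bar M]$ applied to $r$ and $r'$ gives
$r(\psi-\bar\psi)=r'(\psi-\bar\psi)=0$ (`cM_mul_eq_zero`, `bMb_mul_eq_zero`), so $w$ is real near
every point where $v(\Phi)\neq0$. The functions $\psi-\bar\psi$, $t-\bar t'$ and the conjugate of
the latter satisfy a closed linear system of first order (`closed_system_of_twistFree`). At a point
near which $\psi$ is real they all vanish, hence they vanish on every convex framed neighbourhood of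
it (`eq_zero_of_closed_system`). The set of points near which $w$ is real is therefore open and
closed (`realSet_eq_univ`); if it is not empty, it is $M$, and $t=\bar t'$ everywhere, that is
$h(\Psi)=0$. Claim (iv) is the same argument with the planes exchanged: the commutator is $[L,N]$,
applied to $t$, and the unknowns are $\psi-\bar\psi$ and the imaginary parts of $r$ and $r'$.

The differential identities are proved in an arbitrary commutative star ring with derivations
(`NullFrame`). They are then applied to the smooth complex functions on an open set of coordinates
(`smoothAlg`) with a smooth orthonormal frame built from $U$ (`adaptedFrame`). The open-closed
argument needs the reality of $w$ to be independent of the chart, which rests on the naturality of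
the curvature tensor (`riemann_eq`). -/

noncomputable section

namespace TypeDVacuum

/-! ### Self-dual connections in a null frame -/

section NullFrame

variable {R : Type*} [CommRing R] [Algebra ℂ R]

/-- The exterior derivative of a 1-form on the derivations of `R`. -/
def dForm (P : Derivation ℂ R R →ₗ[R] R) (X Y : Derivation ℂ R R) : R :=
  X (P Y) - Y (P X) - P ⁅X, Y⁆

/-- The 2-form `dP + k (Q ∧ S)`. -/
def curvForm (k : ℤ) (P Q S : Derivation ℂ R R →ₗ[R] R) (X Y : Derivation ℂ R R) : R :=
  dForm P X Y + k * (Q X * S Y - Q Y * S X)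

variable (k : ℤ) (P Q S : Derivation ℂ R R →ₗ[R] R) (X Y Z : Derivation ℂ R R) (f : R)

lemma curvForm_swap : curvForm k P Q S X Y = -curvForm k P Q S Y X := by
  have h : P ⁅X, Y⁆ = -P ⁅Y, X⁆ := by rw [← lie_skew, map_neg]
  simp only [curvForm, dForm, h]; ring

lemma curvForm_self : curvForm k P Q S X X = 0 := by
  simp [curvForm, dForm]

lemma curvForm_add_left : curvForm k P Q S (X + Y) Z =
    curvForm k P Q S X Z + curvForm k P Q S Y Z := by
  simp only [curvForm, dForm, add_lie, map_add, Derivation.add_apply]; ring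

lemma curvForm_neg_left : curvForm k P Q S (-X) Z = -curvForm k P Q S X Z := by
  simp only [curvForm, dForm, neg_lie, map_neg, Derivation.neg_apply]; ring

lemma curvForm_sub_left : curvForm k P Q S (X - Y) Z =
    curvForm k P Q S X Z - curvForm k P Q S Y Z := by
  rw [sub_eq_add_neg, curvForm_add_left, curvForm_neg_left, sub_eq_add_neg]

lemma smul_lie_derivation : ⁅f • X, Y⁆ = f • ⁅X, Y⁆ - Y f • X := by
  ext g
  simp only [Derivation.commutator_apply, Derivation.smul_apply, Derivation.sub_apply,
    Derivation.leibniz, smul_eq_mul]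
  ring

lemma curvForm_smul_left : curvForm k P Q S (f • X) Z = f * curvForm k P Q S X Z := by
  simp only [curvForm, dForm, smul_lie_derivation, map_sub, map_smul, smul_eq_mul,
    Derivation.smul_apply, Derivation.leibniz]
  ring

/-- This is $d^2P=0$: the iterated derivatives cancel in pairs, and the values of `P` on double
brackets cancel by the Jacobi identity. -/
lemma dForm_closed :
    X (dForm P Y Z) + Y (dForm P Z X) + Z (dForm P X Y)
      - dForm P ⁅X, Y⁆ Z - dForm P ⁅Y, Z⁆ X - dForm P ⁅Z, X⁆ Y = 0 := by
  have h : P ⁅⁅X, Y⁆, Z⁆ + P ⁅⁅Y, Z⁆, X⁆ + P ⁅⁅Z, X⁆, Y⁆ = 0 := by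
    have := congrArg P (lie_jacobi X Y Z)
    rw [← lie_skew ⁅X, Y⁆ Z, ← lie_skew ⁅Y, Z⁆ X, ← lie_skew ⁅Z, X⁆ Y]
    simp only [map_add, map_neg, map_zero] at this ⊢
    linear_combination -this
  simp only [dForm, map_sub, Derivation.commutator_apply]
  linear_combination h

end NullFrame

/-- The components, with respect to a null frame `(L, N, M, Mb)`, of the self-dual part `(a, b, c)`
of a Levi-Civita connection whose self-dual curvature is that of a type D vacuum metric. -/
structure NullFrame (R : Type*) [CommRing R] [Algebra ℂ R] [StarRing R] where
  (L N M Mb : Derivation ℂ R R)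
  (a b c : Derivation ℂ R R →ₗ[R] R)
  (psi : R)
  isUnit_psi : IsUnit psi
  star_L : ∀ f, star (L f) = L (star f)
  star_N : ∀ f, star (N f) = N (star f)
  star_M : ∀ f, star (M f) = Mb (star f)
  star_Mb : ∀ f, star (Mb f) = M (star f)
  -- The brackets are $\nabla_XY-\nabla_YX$ for the connection $\nabla L=-(a+\bar a)L-cM-\bar c\bar
  -- M$, $\nabla N=(a+\bar a)N-b\bar M-\bar bM$, $\nabla M=(a-\bar a)M-bL-\bar cN$. Conjugation
  -- exchanges `M` and `Mb`, so that $\bar a(M)$ is `star (a Mb)`.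
  lie_LN : ⁅L, N⁆ = (a L + star (a L)) • N - b L • Mb - star (b L) • M
    + (a N + star (a N)) • L + c N • M + star (c N) • Mb
  lie_LM : ⁅L, M⁆ = (a L - star (a L)) • M - b L • L - star (c L) • N
    + (a M + star (a Mb)) • L + c M • M + star (c Mb) • Mb
  lie_LMb : ⁅L, Mb⁆ = (star (a L) - a L) • Mb - star (b L) • L - c L • N
    + (star (a M) + a Mb) • L + star (c M) • Mb + c Mb • M
  lie_NM : ⁅N, M⁆ = (a N - star (a N)) • M - b N • L - star (c N) • N
    - (a M + star (a Mb)) • N + b M • Mb + star (b Mb) • M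
  lie_NMb : ⁅N, Mb⁆ = (star (a N) - a N) • Mb - star (b N) • L - c N • N
    - (star (a M) + a Mb) • N + star (b M) • M + b Mb • Mb
  lie_MMb : ⁅M, Mb⁆ = (star (a Mb) - a M) • Mb - star (b Mb) • L - c M • N
    - (a Mb - star (a M)) • M + b Mb • L + star (c M) • N
  aLN : curvForm (-1) a b c L N = psi
  aMMb : curvForm (-1) a b c M Mb = psi
  aLM : curvForm (-1) a b c L M = 0
  aLMb : curvForm (-1) a b c L Mb = 0
  aNM : curvForm (-1) a b c N M = 0
  aNMb : curvForm (-1) a b c N Mb = 0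
  bLMb : curvForm (-2) b a b L Mb = psi
  bLN : curvForm (-2) b a b L N = 0
  bMMb : curvForm (-2) b a b M Mb = 0
  bLM : curvForm (-2) b a b L M = 0
  bNM : curvForm (-2) b a b N M = 0
  bNMb : curvForm (-2) b a b N Mb = 0
  cNM : curvForm 2 c a c N M = psi
  cLN : curvForm 2 c a c L N = 0
  cMMb : curvForm 2 c a c M Mb = 0
  cLM : curvForm 2 c a c L M = 0
  cLMb : curvForm 2 c a c L Mb = 0
  cNMb : curvForm 2 c a c N Mb = 0

namespace NullFrame

variable {R : Type*} [CommRing R] [Algebra ℂ R]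

/-- The second Bianchi identity $dF_b=2(a\wedge F_b-F_a\wedge b)$, where $F_a=da-b\wedge c$ and
$F_b=db-2a\wedge b$. It follows from $d^2b=0$ and the Leibniz rule. -/
lemma bianchi_b (a b c : Derivation ℂ R R →ₗ[R] R) (X Y Z : Derivation ℂ R R) :
    X (curvForm (-2) b a b Y Z) + Y (curvForm (-2) b a b Z X) + Z (curvForm (-2) b a b X Y)
      - curvForm (-2) b a b ⁅X, Y⁆ Z - curvForm (-2) b a b ⁅Y, Z⁆ X
      - curvForm (-2) b a b ⁅Z, X⁆ Y
    = 2 * (a X * curvForm (-2) b a b Y Z + a Y * curvForm (-2) b a b Z X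
        + a Z * curvForm (-2) b a b X Y)
      - 2 * (curvForm (-1) a b c X Y * b Z + curvForm (-1) a b c Y Z * b X
        + curvForm (-1) a b c Z X * b Y) := by
  have h := dForm_closed b X Y Z
  have s (P : Derivation ℂ R R →ₗ[R] R) (X Y : Derivation ℂ R R) :
    P ⁅X, Y⁆ = -P ⁅Y, X⁆ := by rw [← lie_skew, map_neg]
  simp only [curvForm, map_add, Derivation.leibniz, smul_eq_mul, map_sub,
    Int.cast_neg, Int.cast_ofNat, Int.cast_one, map_neg] at h ⊢
  have e2 (D : Derivation ℂ R R) : D 2 = 0 := by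
    simpa using D.map_natCast 2
  simp only [e2]
  simp only [dForm, map_sub, Derivation.commutator_apply] at h ⊢
  linear_combination h

lemma bianchi_c (a b c : Derivation ℂ R R →ₗ[R] R) (X Y Z : Derivation ℂ R R) :
    X (curvForm 2 c a c Y Z) + Y (curvForm 2 c a c Z X) + Z (curvForm 2 c a c X Y)
      - curvForm 2 c a c ⁅X, Y⁆ Z - curvForm 2 c a c ⁅Y, Z⁆ X
      - curvForm 2 c a c ⁅Z, X⁆ Y
    = -2 * (a X * curvForm 2 c a c Y Z + a Y * curvForm 2 c a c Z X
        + a Z * curvForm 2 c a c X Y)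
      + 2 * (curvForm (-1) a b c X Y * c Z + curvForm (-1) a b c Y Z * c X
        + curvForm (-1) a b c Z X * c Y) := by
  have h := dForm_closed c X Y Z
  simp only [curvForm, map_add, Derivation.leibniz, smul_eq_mul, map_sub,
    Int.cast_neg, Int.cast_ofNat, Int.cast_one] at h ⊢
  have e2 (D : Derivation ℂ R R) : D 2 = 0 := by
    simpa using D.map_natCast 2
  simp only [e2]
  simp only [dForm, map_sub, Derivation.commutator_apply] at h ⊢
  linear_combination h

variable [StarRing R] (F : NullFrame R)

lemma eq_zero_of_psi_mul {x : R} (h : F.psi * x = 0) : x = 0 :=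
  (F.isUnit_psi.mul_right_eq_zero).mp h

/-- Non-zero integers are units because `R` is an algebra over ℂ; no assumption on zero divisors in
`R` is needed. -/
lemma eq_zero_of_mul_psi {n : ℤ} (hn : n ≠ 0) {x : R} (h : n * (F.psi * x) = 0) : x = 0 := by
  apply F.eq_zero_of_psi_mul
  have : IsUnit ((n : ℤ) : R) := by
    have h2 : ((n : ℤ) : R) = algebraMap ℂ R n := by simp
    rw [h2]
    exact (IsUnit.mk0 (n : ℂ) (by exact_mod_cast hn)).map (algebraMap ℂ R)
  exact (this.mul_right_eq_zero).mp h

lemma lie_ML : ⁅F.M, F.L⁆ = -⁅F.L, F.M⁆ := (lie_skew _ _).symm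
lemma lie_MbL : ⁅F.Mb, F.L⁆ = -⁅F.L, F.Mb⁆ := (lie_skew _ _).symm
lemma lie_MbN : ⁅F.Mb, F.N⁆ = -⁅F.N, F.Mb⁆ := (lie_skew _ _).symm
lemma aML : curvForm (-1) F.a F.b F.c F.M F.L = 0 := by
  rw [curvForm_swap, F.aLM, neg_zero]
lemma aMbL : curvForm (-1) F.a F.b F.c F.Mb F.L = 0 := by
  rw [curvForm_swap, F.aLMb, neg_zero]
lemma aMbN : curvForm (-1) F.a F.b F.c F.Mb F.N = 0 := by
  rw [curvForm_swap, F.aNMb, neg_zero]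
lemma bNL : curvForm (-2) F.b F.a F.b F.N F.L = 0 := by
  rw [curvForm_swap, F.bLN, neg_zero]
lemma bML : curvForm (-2) F.b F.a F.b F.M F.L = 0 := by
  rw [curvForm_swap, F.bLM, neg_zero]
lemma bMbL : curvForm (-2) F.b F.a F.b F.Mb F.L = -F.psi := by
  rw [curvForm_swap, F.bLMb]
lemma bMN : curvForm (-2) F.b F.a F.b F.M F.N = 0 := by
  rw [curvForm_swap, F.bNM, neg_zero]
lemma bMbN : curvForm (-2) F.b F.a F.b F.Mb F.N = 0 := by
  rw [curvForm_swap, F.bNMb, neg_zero]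
lemma bMbM : curvForm (-2) F.b F.a F.b F.Mb F.M = 0 := by
  rw [curvForm_swap, F.bMMb, neg_zero]
lemma cNL : curvForm 2 F.c F.a F.c F.N F.L = 0 := by
  rw [curvForm_swap, F.cLN, neg_zero]
lemma cML : curvForm 2 F.c F.a F.c F.M F.L = 0 := by
  rw [curvForm_swap, F.cLM, neg_zero]
lemma cMbL : curvForm 2 F.c F.a F.c F.Mb F.L = 0 := by
  rw [curvForm_swap, F.cLMb, neg_zero]
lemma cMN : curvForm 2 F.c F.a F.c F.M F.N = -F.psi := by
  rw [curvForm_swap, F.cNM]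
lemma cMbN : curvForm 2 F.c F.a F.c F.Mb F.N = 0 := by
  rw [curvForm_swap, F.cNMb, neg_zero]
lemma cMbM : curvForm 2 F.c F.a F.c F.Mb F.M = 0 := by
  rw [curvForm_swap, F.cMMb, neg_zero]

set_option linter.unusedSimpArgs false
-- On the triple $(L,N,M)$ no derivative of $\psi$ enters the Bianchi identity: among the pairs of
-- frame vectors $F_b$ is non-zero only on $(L,\bar M)$, which can arise only from the $\bar
-- M$-component of a bracket. One multiple of $\psi\,b(M)$ comes from $[N,M]$ and two from
-- $F_a(L,N)$. With the three lemmas that follow, this says that both principal null directions are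
-- geodesic and shear-free.
lemma b_M : F.b F.M = 0 := by
  have h := bianchi_b F.a F.b F.c F.L F.N F.M
  simp only [F.lie_LN, F.lie_NM, F.lie_ML, F.lie_LM, curvForm_add_left, curvForm_sub_left,
    curvForm_neg_left, curvForm_smul_left, curvForm_self,
    F.bLN, F.bLM, F.bLMb, F.bNM, F.bNMb, F.bMMb, F.bNL, F.bML, F.bMbL, F.bMN, F.bMbN, F.bMbM,
    F.aLN, F.aNM, F.aML,
    map_zero, map_neg, map_sub, map_add, mul_zero] at h
  apply F.eq_zero_of_mul_psi (n := 3) (by norm_num)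
  push_cast
  linear_combination h

lemma b_N : F.b F.N = 0 := by
  have h := bianchi_b F.a F.b F.c F.N F.M F.Mb
  simp only [F.lie_NM, F.lie_MMb, F.lie_MbN, F.lie_NMb, curvForm_add_left, curvForm_sub_left,
    curvForm_neg_left, curvForm_smul_left, curvForm_self,
    F.bLN, F.bLM, F.bLMb, F.bNM, F.bNMb, F.bMMb, F.bNL, F.bML, F.bMbL, F.bMN, F.bMbN, F.bMbM,
    F.aNM, F.aMMb, F.aMbN,
    map_zero, map_neg, map_sub, map_add, mul_zero] at h
  apply F.eq_zero_of_mul_psi (n := 3) (by norm_num)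
  push_cast
  linear_combination h

lemma c_Mb : F.c F.Mb = 0 := by
  have h := bianchi_c F.a F.b F.c F.L F.N F.Mb
  simp only [F.lie_LN, F.lie_NMb, F.lie_MbL, F.lie_LMb, curvForm_add_left, curvForm_sub_left,
    curvForm_neg_left, curvForm_smul_left, curvForm_self,
    F.cLN, F.cLM, F.cLMb, F.cNM, F.cNMb, F.cMMb, F.cNL, F.cML, F.cMbL, F.cMN, F.cMbN, F.cMbM,
    F.aLN, F.aNMb, F.aMbL,
    map_zero, map_neg, map_sub, map_add, mul_zero] at h
  apply F.eq_zero_of_mul_psi (n := 3) (by norm_num)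
  push_cast
  linear_combination -h

lemma c_L : F.c F.L = 0 := by
  have h := bianchi_c F.a F.b F.c F.L F.M F.Mb
  simp only [F.lie_LM, F.lie_MMb, F.lie_MbL, F.lie_LMb, curvForm_add_left, curvForm_sub_left,
    curvForm_neg_left, curvForm_smul_left, curvForm_self,
    F.cLN, F.cLM, F.cLMb, F.cNM, F.cNMb, F.cMMb, F.cNL, F.cML, F.cMbL, F.cMN, F.cMbN, F.cMbM,
    F.aLM, F.aMMb, F.aMbL,
    map_zero, map_neg, map_sub, map_add, mul_zero] at h
  apply F.eq_zero_of_mul_psi (n := 3) (by norm_num)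
  push_cast
  linear_combination -h

/-- On the triples that contain the pair on which $F_b$ or $F_c$ equals $\psi$, the Bianchi identity
keeps one derivative of $\psi$. The four lemmas of this kind express $d\log\psi$ by the surviving
connection coefficients. -/
lemma N_psi : F.N F.psi = 3 * F.b F.Mb * F.psi := by
  have h := bianchi_b F.a F.b F.c F.L F.N F.Mb
  simp only [F.lie_LN, F.lie_NMb, F.lie_MbL, F.lie_LMb, curvForm_add_left, curvForm_sub_left,
    curvForm_neg_left, curvForm_smul_left, curvForm_self,
    F.bLN, F.bLM, F.bLMb, F.bNM, F.bNMb, F.bMMb, F.bNL, F.bML, F.bMbL, F.bMN, F.bMbN, F.bMbM,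
    F.aLN, F.aNMb, F.aMbL,
    map_zero, map_neg, map_sub, map_add, mul_zero] at h
  linear_combination -h

lemma M_psi : F.M F.psi = 3 * F.b F.L * F.psi := by
  have h := bianchi_b F.a F.b F.c F.L F.M F.Mb
  simp only [F.lie_LM, F.lie_MMb, F.lie_MbL, F.lie_LMb, curvForm_add_left, curvForm_sub_left,
    curvForm_neg_left, curvForm_smul_left, curvForm_self,
    F.bLN, F.bLM, F.bLMb, F.bNM, F.bNMb, F.bMMb, F.bNL, F.bML, F.bMbL, F.bMN, F.bMbN, F.bMbM,
    F.aLM, F.aMMb, F.aMbL,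
    map_zero, map_neg, map_sub, map_add, mul_zero] at h
  linear_combination -h

lemma L_psi : F.L F.psi = 3 * F.c F.M * F.psi := by
  have h := bianchi_c F.a F.b F.c F.L F.N F.M
  simp only [F.lie_LN, F.lie_NM, F.lie_ML, F.lie_LM, curvForm_add_left, curvForm_sub_left,
    curvForm_neg_left, curvForm_smul_left, curvForm_self,
    F.cLN, F.cLM, F.cLMb, F.cNM, F.cNMb, F.cMMb, F.cNL, F.cML, F.cMbL, F.cMN, F.cMbN, F.cMbM,
    F.aLN, F.aNM, F.aML,
    map_zero, map_neg, map_sub, map_add, mul_zero] at h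
  linear_combination h

lemma Mb_psi : F.Mb F.psi = 3 * F.c F.N * F.psi := by
  have h := bianchi_c F.a F.b F.c F.N F.M F.Mb
  simp only [F.lie_NM, F.lie_MMb, F.lie_MbN, F.lie_NMb, curvForm_add_left, curvForm_sub_left,
    curvForm_neg_left, curvForm_smul_left, curvForm_self,
    F.cLN, F.cLM, F.cLMb, F.cNM, F.cNMb, F.cMMb, F.cNL, F.cML, F.cMbL, F.cMN, F.cMbN, F.cMbM,
    F.aNM, F.aMMb, F.aMbN,
    map_zero, map_neg, map_sub, map_add, mul_zero] at h
  linear_combination h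

/-- With $c(L)=c(\bar M)=0$ and $b(M)=b(N)=0$, the equation $F_c(L,M)=0$ reduces to a Riccati
equation for $r=c(M)$. The lemmas down to `aLN_eq` extract in the same way the components of the
curvature equations, for $r$, $r'=b(\bar M)$, $t=c(N)$ and $t'=b(L)$. -/
lemma L_cM : F.L (F.c F.M) = (F.c F.M) ^ 2 - (F.a F.L + star (F.a F.L)) * F.c F.M := by
  have h := F.cLM
  simp only [curvForm, dForm, F.lie_LM, map_add, map_sub,
    map_smul, smul_eq_mul, F.c_L, F.c_Mb, F.b_M, F.b_N, map_zero, star_zero,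
    Int.cast_neg, Int.cast_ofNat, Int.cast_one] at h
  linear_combination h

lemma L_cN : F.L (F.c F.N) = (F.c F.N - star (F.b F.L)) * F.c F.M + (star (F.a F.L) - F.a F.L) * F.c F.N := by
  have h := F.cLN
  simp only [curvForm, dForm, F.lie_LN, map_add, map_sub,
    map_smul, smul_eq_mul, F.c_L, F.c_Mb, F.b_M, F.b_N, map_zero, star_zero,
    Int.cast_neg, Int.cast_ofNat, Int.cast_one] at h
  linear_combination h

lemma Mb_cN : F.Mb (F.c F.N) = (F.c F.N) ^ 2 + (star (F.a F.M) - F.a F.Mb) * F.c F.N := by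
  have h := F.cNMb
  simp only [curvForm, dForm, F.lie_NMb, map_add, map_sub,
    map_smul, smul_eq_mul, F.c_L, F.c_Mb, F.b_M, F.b_N, map_zero, star_zero,
    Int.cast_neg, Int.cast_ofNat, Int.cast_one] at h
  linear_combination -h

lemma Mb_cM : F.Mb (F.c F.M) = (F.c F.M - star (F.c F.M)) * F.c F.N - (F.a F.Mb + star (F.a F.M)) * F.c F.M := by
  have h := F.cMMb
  simp only [curvForm, dForm, F.lie_MMb, map_add, map_sub,
    map_smul, smul_eq_mul, F.c_L, F.c_Mb, F.b_M, F.b_N, map_zero, star_zero,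
    Int.cast_neg, Int.cast_ofNat, Int.cast_one] at h
  linear_combination -h

/-- Only a difference of two derivatives is determined here, and likewise in `L_bMb_sub`; the
commutators applied to $\psi$ below relate these derivatives further. -/
lemma N_cM_sub : F.N (F.c F.M) - F.M (F.c F.N) = F.psi + F.c F.M * star (F.b F.Mb) - F.c F.N * star (F.c F.N)
    - (F.a F.N + star (F.a F.N)) * F.c F.M + (F.a F.M - star (F.a F.Mb)) * F.c F.N := by
  have h := F.cNM
  simp only [curvForm, dForm, F.lie_NM, map_add, map_sub,
    map_smul, smul_eq_mul, F.c_L, F.c_Mb, F.b_M, F.b_N, map_zero, star_zero,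
    Int.cast_neg, Int.cast_ofNat, Int.cast_one] at h
  linear_combination h

lemma N_bMb : F.N (F.b F.Mb) = (F.b F.Mb) ^ 2 + (F.a F.N + star (F.a F.N)) * F.b F.Mb := by
  have h := F.bNMb
  simp only [curvForm, dForm, F.lie_NMb, map_add, map_sub,
    map_smul, smul_eq_mul, F.c_L, F.c_Mb, F.b_M, F.b_N, map_zero, star_zero,
    Int.cast_neg, Int.cast_ofNat, Int.cast_one] at h
  linear_combination h

lemma N_bL : F.N (F.b F.L) = (F.b F.L - star (F.c F.N)) * F.b F.Mb + (F.a F.N - star (F.a F.N)) * F.b F.L := by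
  have h := F.bLN
  simp only [curvForm, dForm, F.lie_LN, map_add, map_sub,
    map_smul, smul_eq_mul, F.c_L, F.c_Mb, F.b_M, F.b_N, map_zero, star_zero,
    Int.cast_neg, Int.cast_ofNat, Int.cast_one] at h
  linear_combination -h

lemma M_bL : F.M (F.b F.L) = (F.b F.L) ^ 2 + (F.a F.M - star (F.a F.Mb)) * F.b F.L := by
  have h := F.bLM
  simp only [curvForm, dForm, F.lie_LM, map_add, map_sub,
    map_smul, smul_eq_mul, F.c_L, F.c_Mb, F.b_M, F.b_N, map_zero, star_zero,
    Int.cast_neg, Int.cast_ofNat, Int.cast_one] at h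
  linear_combination -h

lemma M_bMb : F.M (F.b F.Mb) = (F.b F.Mb - star (F.b F.Mb)) * F.b F.L + (F.a F.M + star (F.a F.Mb)) * F.b F.Mb := by
  have h := F.bMMb
  simp only [curvForm, dForm, F.lie_MMb, map_add, map_sub,
    map_smul, smul_eq_mul, F.c_L, F.c_Mb, F.b_M, F.b_N, map_zero, star_zero,
    Int.cast_neg, Int.cast_ofNat, Int.cast_one] at h
  linear_combination h

lemma L_bMb_sub : F.L (F.b F.Mb) - F.Mb (F.b F.L) = F.psi + F.b F.Mb * star (F.c F.M) - F.b F.L * star (F.b F.L)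
    + (F.a F.L + star (F.a F.L)) * F.b F.Mb + (star (F.a F.M) - F.a F.Mb) * F.b F.L := by
  have h := F.bLMb
  simp only [curvForm, dForm, F.lie_LMb, map_add, map_sub,
    map_smul, smul_eq_mul, F.c_L, F.c_Mb, F.b_M, F.b_N, map_zero, star_zero,
    Int.cast_neg, Int.cast_ofNat, Int.cast_one] at h
  linear_combination h

lemma aMMb_eq : F.M (F.a F.Mb) - F.Mb (F.a F.M) = F.psi - F.b F.Mb * F.c F.M
    + (star (F.a F.Mb) - F.a F.M) * F.a F.Mb - star (F.b F.Mb) * F.a F.L - F.c F.M * F.a F.N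
    - (F.a F.Mb - star (F.a F.M)) * F.a F.M + F.b F.Mb * F.a F.L + star (F.c F.M) * F.a F.N := by
  have h := F.aMMb
  simp only [curvForm, dForm, F.lie_MMb, map_add, map_sub,
    map_smul, smul_eq_mul, F.c_L, F.c_Mb, F.b_M, F.b_N, map_zero, star_zero,
    Int.cast_neg, Int.cast_ofNat, Int.cast_one] at h
  linear_combination h

lemma aLN_eq : F.L (F.a F.N) - F.N (F.a F.L) = F.psi + F.b F.L * F.c F.N
    + (F.a F.L + star (F.a F.L)) * F.a F.N - F.b F.L * F.a F.Mb - star (F.b F.L) * F.a F.M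
    + (F.a F.N + star (F.a F.N)) * F.a F.L + F.c F.N * F.a F.M + star (F.c F.N) * F.a F.Mb := by
  have h := F.aLN
  simp only [curvForm, dForm, F.lie_LN, map_add, map_sub,
    map_smul, smul_eq_mul, F.c_L, F.c_Mb, F.b_M, F.b_N, map_zero, star_zero,
    Int.cast_neg, Int.cast_ofNat, Int.cast_one] at h
  linear_combination h

/-- The integrability condition $d(d\log\psi)=0$ on $(L,N)$: products of first logarithmic
derivatives cancel in the commutator, and what is left is $3\psi$ times the relation. The three
lemmas that follow do this for other pairs and give derivatives that the curvature equations do not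
contain. -/
lemma L_bMb_sub_N_cM : F.L (F.b F.Mb) - F.N (F.c F.M) = (F.a F.L + star (F.a F.L)) * F.b F.Mb + (F.a F.N + star (F.a F.N)) * F.c F.M
    - star (F.b F.L) * F.b F.L + star (F.c F.N) * F.c F.N := by
  have h := Derivation.commutator_apply (D1 := F.L) (D2 := F.N) F.psi
  have e3 (D : Derivation ℂ R R) : D 3 = 0 := by simpa using D.map_natCast 3
  simp only [F.lie_LN, Derivation.add_apply, Derivation.sub_apply, Derivation.smul_apply,
    smul_eq_mul, F.L_psi, F.N_psi, F.M_psi, F.Mb_psi, Derivation.leibniz, e3, F.c_L, F.c_Mb,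
    F.b_M, F.b_N, star_zero] at h
  apply sub_eq_zero.mp
  apply F.eq_zero_of_mul_psi (n := 3) (by norm_num)
  push_cast
  linear_combination -h

lemma L_bL_sub_M_cM : F.L (F.b F.L) - F.M (F.c F.M) = (F.a F.L - star (F.a F.L)) * F.b F.L + (F.a F.M + star (F.a F.Mb)) * F.c F.M := by
  have h := Derivation.commutator_apply (D1 := F.L) (D2 := F.M) F.psi
  have e3 (D : Derivation ℂ R R) : D 3 = 0 := by simpa using D.map_natCast 3
  simp only [F.lie_LM, Derivation.add_apply, Derivation.sub_apply, Derivation.smul_apply,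
    smul_eq_mul, F.L_psi, F.N_psi, F.M_psi, F.Mb_psi, Derivation.leibniz, e3, F.c_L, F.c_Mb,
    F.b_M, F.b_N, star_zero] at h
  apply sub_eq_zero.mp
  apply F.eq_zero_of_mul_psi (n := 3) (by norm_num)
  push_cast
  linear_combination -h

lemma N_cN_sub_Mb_bMb : F.N (F.c F.N) - F.Mb (F.b F.Mb) = (star (F.a F.N) - F.a F.N) * F.c F.N - (star (F.a F.M) + F.a F.Mb) * F.b F.Mb := by
  have h := Derivation.commutator_apply (D1 := F.N) (D2 := F.Mb) F.psi
  have e3 (D : Derivation ℂ R R) : D 3 = 0 := by simpa using D.map_natCast 3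
  simp only [F.lie_NMb, Derivation.add_apply, Derivation.sub_apply, Derivation.smul_apply,
    smul_eq_mul, F.L_psi, F.N_psi, F.M_psi, F.Mb_psi, Derivation.leibniz, e3, F.c_L, F.c_Mb,
    F.b_M, F.b_N, star_zero] at h
  apply sub_eq_zero.mp
  apply F.eq_zero_of_mul_psi (n := 3) (by norm_num)
  push_cast
  linear_combination -h

lemma M_cN_sub_Mb_bL : F.M (F.c F.N) - F.Mb (F.b F.L) = (star (F.a F.Mb) - F.a F.M) * F.c F.N - (F.a F.Mb - star (F.a F.M)) * F.b F.L
    - star (F.b F.Mb) * F.c F.M + star (F.c F.M) * F.b F.Mb := by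
  have h := Derivation.commutator_apply (D1 := F.M) (D2 := F.Mb) F.psi
  have e3 (D : Derivation ℂ R R) : D 3 = 0 := by simpa using D.map_natCast 3
  simp only [F.lie_MMb, Derivation.add_apply, Derivation.sub_apply, Derivation.smul_apply,
    smul_eq_mul, F.L_psi, F.N_psi, F.M_psi, F.Mb_psi, Derivation.leibniz, e3, F.c_L, F.c_Mb,
    F.b_M, F.b_N, star_zero] at h
  apply sub_eq_zero.mp
  apply F.eq_zero_of_mul_psi (n := 3) (by norm_num)
  push_cast
  linear_combination -h

end NullFrame

/-! ### Consequences of reality conditions on the connection coefficients -/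

namespace NullFrame

set_option linter.unusedSimpArgs false

variable {R : Type*} [CommRing R] [Algebra ℂ R] [StarRing R] (F : NullFrame R)

lemma two_mul_eq_zero {R : Type*} [CommRing R] [Algebra ℂ R] {x : R} (h : 2 * x = 0) : x = 0 := by
  have h2 : IsUnit (2 : R) := by
    have := (IsUnit.mk0 (2 : ℂ) two_ne_zero).map (algebraMap ℂ R)
    rwa [map_ofNat] at this
  exact (h2.mul_right_eq_zero).mp h

/-- In the Riccati equation for an imaginary $r$, conjugation changes the sign of the derivative and
of the linear term but not of $r^2$. -/
lemma cM_sq_eq_zero (h : star (F.c F.M) = -F.c F.M) : F.c F.M ^ 2 = 0 := by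
  have h1 := congrArg star F.L_cM
  simp only [F.star_L, star_sub, star_mul, star_add, star_star, star_pow, h, map_neg] at h1
  apply two_mul_eq_zero
  linear_combination (-1 : R) * (h1 + F.L_cM)

lemma bMb_sq_eq_zero (h : star (F.b F.Mb) = -F.b F.Mb) : F.b F.Mb ^ 2 = 0 := by
  have h1 := congrArg star F.N_bMb
  simp only [F.star_N, star_mul, star_add, star_star, star_pow, h, map_neg] at h1
  apply two_mul_eq_zero
  linear_combination (-1 : R) * (h1 + F.N_bMb)

/-- The conjugate of the equation for $Mt'$ is one for $\bar M\bar t'=-\bar Mt$. Added to the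
equation for $\bar Mt$, it leaves only $2t^2$. -/
lemma cN_sq_eq_zero (h : star (F.b F.L) = -F.c F.N) : F.c F.N ^ 2 = 0 := by
  have h1 := congrArg star F.M_bL
  simp only [F.star_M, star_sub, star_mul, star_add, star_star, star_pow, h, map_neg] at h1
  apply two_mul_eq_zero
  linear_combination (-1 : R) * (h1 + F.Mb_cN)

/-- For real $r$ and $r'$ the bracket $[M,\bar M]$ has no component along $L$ and $N$, so the
space-like planes are integrable, and $dr=-(a+\bar a)r$ on them. Hence $d(a+\bar a)(M,\bar M)$
annihilates $r$. This value is $\psi-\bar\psi$, because the real contributions $rr'$ of $b\wedge c$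
and its conjugate cancel. -/
lemma cM_mul_eq_zero (hr : star (F.c F.M) = F.c F.M) (hr' : star (F.b F.Mb) = F.b F.Mb) :
    F.c F.M * (F.psi - star F.psi) = 0 := by
  have h1 := F.Mb_cM
  have h2 := congrArg star h1
  have h3 := Derivation.commutator_apply (D1 := F.M) (D2 := F.Mb) (F.c F.M)
  have h4 := F.aMMb_eq
  have h5 := congrArg star h4
  simp only [F.star_Mb, F.star_M, star_sub, star_mul, star_add, star_star, hr, hr'] at h1 h2 h4 h5
  simp only [F.lie_MMb, Derivation.add_apply, Derivation.sub_apply, Derivation.smul_apply,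
    smul_eq_mul, hr, hr', h1, h2, map_sub, map_add, Derivation.leibniz, sub_self, zero_mul,
    zero_sub, map_neg, mul_zero, map_zero] at h3
  linear_combination h3 - F.c F.M * h4 + F.c F.M * h5

lemma bMb_mul_eq_zero (hr : star (F.c F.M) = F.c F.M) (hr' : star (F.b F.Mb) = F.b F.Mb) :
    F.b F.Mb * (F.psi - star F.psi) = 0 := by
  have h1 := F.M_bMb
  have h2 := congrArg star h1
  have h3 := Derivation.commutator_apply (D1 := F.M) (D2 := F.Mb) (F.b F.Mb)
  have h4 := F.aMMb_eq
  have h5 := congrArg star h4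
  simp only [F.star_Mb, F.star_M, star_sub, star_mul, star_add, star_star, hr, hr'] at h1 h2 h4 h5
  simp only [F.lie_MMb, Derivation.add_apply, Derivation.sub_apply, Derivation.smul_apply,
    smul_eq_mul, hr, hr', h1, h2, map_add, Derivation.leibniz, sub_self, zero_mul,
    zero_add, mul_zero, map_zero] at h3
  linear_combination -h3 - F.b F.Mb * h4 + F.b F.Mb * h5

lemma L_y (hr : star (F.c F.M) = F.c F.M) :
    F.L (F.psi - star F.psi) = 3 * F.c F.M * (F.psi - star F.psi) := by
  have h2 := congrArg star F.L_psi
  simp only [F.star_L, star_mul, hr] at h2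
  simp only [map_sub, F.L_psi, h2, star_ofNat]; ring

lemma N_y (hr' : star (F.b F.Mb) = F.b F.Mb) :
    F.N (F.psi - star F.psi) = 3 * F.b F.Mb * (F.psi - star F.psi) := by
  have h2 := congrArg star F.N_psi
  simp only [F.star_N, star_mul, hr'] at h2
  simp only [map_sub, F.N_psi, h2, star_ofNat]; ring

lemma Mb_y : F.Mb (F.psi - star F.psi) = 3 * F.c F.N * (F.psi - star F.psi)
    + 3 * star F.psi * (F.c F.N - star (F.b F.L)) := by
  have h2 := congrArg star F.M_psi
  simp only [F.star_M, star_mul] at h2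
  simp only [map_sub, F.Mb_psi, h2, star_ofNat]; ring

/-- No curvature equation contains $Lt'$. It is obtained from the commutator relation for $Lt'-Mr$,
whose conjugate involves the known derivative $\bar Mr$ because $r$ is real. -/
lemma L_s (hr : star (F.c F.M) = F.c F.M) :
    F.L (F.c F.N - star (F.b F.L)) =
    (F.c F.M + star (F.a F.L) - F.a F.L) * (F.c F.N - star (F.b F.L)) := by
  have h1 := F.L_cN
  have h2 := F.L_bL_sub_M_cM
  have h3 := congrArg star h2
  have h4 := F.Mb_cM
  simp only [F.star_L, F.star_M, star_sub, star_mul, star_add, star_star, hr] at h3 h4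
  rw [map_sub]
  linear_combination h1 - h3 - h4

lemma N_s (hr' : star (F.b F.Mb) = F.b F.Mb) :
    F.N (F.c F.N - star (F.b F.L)) =
    (F.b F.Mb + star (F.a F.N) - F.a F.N) * (F.c F.N - star (F.b F.L)) := by
  have h1 := F.N_cN_sub_Mb_bMb
  have h2 := F.N_bL
  have h3 := congrArg star h2
  have h4 := congrArg star F.M_bMb
  simp only [F.star_N, F.star_M, star_sub, star_mul, star_add, star_star, hr'] at h3 h4
  rw [map_sub]
  linear_combination h1 - h3 + h4

lemma Mb_s : F.Mb (F.c F.N - star (F.b F.L)) =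
    (F.c F.N + star (F.b F.L) + star (F.a F.M) - F.a F.Mb) * (F.c F.N - star (F.b F.L)) := by
  have h3 := congrArg star F.M_bL
  simp only [F.star_M, star_sub, star_mul, star_add, star_star, star_pow] at h3
  rw [map_sub]
  linear_combination F.Mb_cN - h3

/-- The derivatives $Mt$ and $M\bar t'$ occur together with $Nr$ and $Lr'$; the relation for
$Lr'-Nr$ eliminates these. The source $\psi-\bar\psi$ appears because one of the two equations is
conjugated. -/
lemma M_s (hr : star (F.c F.M) = F.c F.M) (hr' : star (F.b F.Mb) = F.b F.Mb) :
    F.M (F.c F.N - star (F.b F.L)) =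
    (F.a F.M - star (F.a F.Mb)) * (star (F.b F.L) - F.c F.N) - (F.psi - star F.psi) := by
  have h1 := F.N_cM_sub
  have h2 := congrArg star F.L_bMb_sub
  have h3 := F.L_bMb_sub_N_cM
  simp only [F.star_L, F.star_Mb, star_sub, star_mul, star_add, star_star, hr, hr'] at h1 h2 h3
  rw [map_sub]
  linear_combination -h1 + h2 - h3

lemma star_cN (ht : star (F.b F.L) = F.c F.N) :
    star (F.c F.N) = F.b F.L := by rw [← ht, star_star]

lemma L_cN' (ht : star (F.b F.L) = F.c F.N) :
    F.L (F.c F.N) = (star (F.a F.L) - F.a F.L) * F.c F.N := by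
  rw [F.L_cN, ht]; ring

lemma N_cN' (ht : star (F.b F.L) = F.c F.N) :
    F.N (F.c F.N) = (star (F.a F.N) - F.a F.N) * F.c F.N := by
  have h := congrArg star F.N_bL
  simp only [F.star_N, star_sub, star_mul, star_add, star_star, ht] at h
  linear_combination h

/-- The counterpart of `cM_mul_eq_zero` on the time-like planes: if $\bar t'=t$, then $[L,N]$ has no
component along $M$ and $\bar M$, and $dt=(\bar a-a)t$ on these planes. The curvature of the
rotation form $a-\bar a$ on $(L,N)$ then annihilates $t$. -/
lemma cN_mul_eq_zero (ht : star (F.b F.L) = F.c F.N) :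
    F.c F.N * (F.psi - star F.psi) = 0 := by
  have h1 := F.L_cN' ht
  have h2 := F.N_cN' ht
  have h3 := Derivation.commutator_apply (D1 := F.L) (D2 := F.N) (F.c F.N)
  have h4 := F.aLN_eq
  have h5 := congrArg star h4
  have hs := F.star_cN ht
  simp only [F.star_L, F.star_N, star_sub, star_mul, star_add, star_star, ht, hs] at h5 h4
  simp only [F.lie_LN, Derivation.add_apply, Derivation.sub_apply, Derivation.smul_apply,
    smul_eq_mul, h1, h2, map_sub, Derivation.leibniz, ht, hs] at h3
  linear_combination h3 - F.c F.N * h4 + F.c F.N * h5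

lemma L_y' : F.L (F.psi - star F.psi) = 3 * F.c F.M * (F.psi - star F.psi)
    + 3 * star F.psi * (F.c F.M - star (F.c F.M)) := by
  have h2 := congrArg star F.L_psi
  simp only [F.star_L, star_mul] at h2
  simp only [map_sub, F.L_psi, h2, star_ofNat]; ring

lemma N_y' : F.N (F.psi - star F.psi) = 3 * F.b F.Mb * (F.psi - star F.psi)
    + 3 * star F.psi * (F.b F.Mb - star (F.b F.Mb)) := by
  have h2 := congrArg star F.N_psi
  simp only [F.star_N, star_mul] at h2
  simp only [map_sub, F.N_psi, h2, star_ofNat]; ring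

lemma L_q : F.L (F.c F.M - star (F.c F.M)) =
    (F.c F.M + star (F.c F.M) - F.a F.L - star (F.a F.L)) * (F.c F.M - star (F.c F.M)) := by
  have h := congrArg star F.L_cM
  simp only [F.star_L, star_sub, star_mul, star_add, star_star, star_pow] at h
  rw [map_sub]
  linear_combination F.L_cM - h

lemma N_q' : F.N (F.b F.Mb - star (F.b F.Mb)) =
    (F.b F.Mb + star (F.b F.Mb) + F.a F.N + star (F.a F.N)) * (F.b F.Mb - star (F.b F.Mb)) := by
  have h := congrArg star F.N_bMb
  simp only [F.star_N, star_mul, star_add, star_star, star_pow] at h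
  rw [map_sub]
  linear_combination F.N_bMb - h

/-- The derivative $\bar M\bar r$ comes from the conjugate of the relation for $Lt'-Mr$, in which
$\bar t'=t$ makes $L\bar t'$ known. -/
lemma Mb_q (ht : star (F.b F.L) = F.c F.N) : F.Mb (F.c F.M - star (F.c F.M)) =
    (F.c F.N - F.a F.Mb - star (F.a F.M)) * (F.c F.M - star (F.c F.M)) := by
  have h1 := F.L_cN' ht
  have h2 := congrArg star h1
  have h3 := congrArg star F.L_bL_sub_M_cM
  simp only [F.star_L, F.star_M, star_sub, star_mul, star_add, star_star, ht] at h3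
  rw [map_sub]
  linear_combination F.Mb_cM + h3 - h1

lemma M_q' (ht : star (F.b F.L) = F.c F.N) : F.M (F.b F.Mb - star (F.b F.Mb)) =
    (F.b F.L + F.a F.M + star (F.a F.Mb)) * (F.b F.Mb - star (F.b F.Mb)) := by
  have h1 := congrArg star (F.N_cN' ht)
  have h3 := congrArg star F.N_cN_sub_Mb_bMb
  simp only [F.star_N, F.star_Mb, star_sub, star_mul, star_add, star_star, F.star_cN ht] at h1 h3
  rw [map_sub]
  linear_combination F.M_bMb + h3 - h1

lemma N_q (ht : star (F.b F.L) = F.c F.N) : F.N (F.c F.M - star (F.c F.M)) =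
    (F.psi - star F.psi) - (F.a F.N + star (F.a F.N)) * (F.c F.M - star (F.c F.M)) := by
  have h1 := F.N_cM_sub
  have h2 := congrArg star h1
  have h3 := F.M_cN_sub_Mb_bL
  simp only [F.star_N, F.star_M, star_sub, star_mul, star_add, star_star, F.star_cN ht, ht] at h1 h2 h3
  rw [map_sub]
  linear_combination h1 - h2 + h3

lemma L_q' (ht : star (F.b F.L) = F.c F.N) : F.L (F.b F.Mb - star (F.b F.Mb)) =
    (F.psi - star F.psi) + (F.a F.L + star (F.a F.L)) * (F.b F.Mb - star (F.b F.Mb)) := by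
  have h1 := F.L_bMb_sub
  have h2 := congrArg star h1
  have h3 := F.M_cN_sub_Mb_bL
  simp only [F.star_L, F.star_Mb, star_sub, star_mul, star_add, star_star, F.star_cN ht, ht]
    at h1 h2 h3
  rw [map_sub]
  linear_combination h1 - h2 - h3

/-- A property of derivations that passes from the null frame to its linear combinations. -/
def SpanDer (X : Derivation ℂ R R) : Prop :=
  X ∈ Submodule.span R {F.L, F.N, F.M, F.Mb}

lemma SpanDer.apply_mem {X : Derivation ℂ R R} (hX : F.SpanDer X) {I : Ideal R} {f : R}
    (hL : F.L f ∈ I) (hN : F.N f ∈ I) (hM : F.M f ∈ I) (hMb : F.Mb f ∈ I) : X f ∈ I := by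
  induction hX using Submodule.span_induction with
  | mem x hx =>
    rcases hx with rfl | rfl | rfl | rfl <;> assumption
  | zero => simp
  | add x y _ _ hx hy => exact I.add_mem hx hy
  | smul a x _ hx => exact I.mul_mem_left a hx

/-- If `r` and `r'` are real, then `ψ - ψ̄`, `t - t̄'` and its conjugate satisfy a closed system of
linear differential equations of first order. -/
lemma closed_system_of_twistFree (hr : star (F.c F.M) = F.c F.M)
    (hr' : star (F.b F.Mb) = F.b F.Mb) {X : Derivation ℂ R R} (hX : F.SpanDer X) {f : R}
    (hf : f ∈ ({F.psi - star F.psi, F.c F.N - star (F.b F.L),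
      star (F.c F.N) - F.b F.L} : Set R)) :
    X f ∈ Ideal.span ({F.psi - star F.psi, F.c F.N - star (F.b F.L),
      star (F.c F.N) - F.b F.L} : Set R) := by
  set I := Ideal.span ({F.psi - star F.psi, F.c F.N - star (F.b F.L),
      star (F.c F.N) - F.b F.L} : Set R) with hI
  have m1 : F.psi - star F.psi ∈ I := Ideal.subset_span (by simp)
  have m2 : F.c F.N - star (F.b F.L) ∈ I := Ideal.subset_span (by simp)
  have m3 : star (F.c F.N) - F.b F.L ∈ I := Ideal.subset_span (by simp)
  rcases hf with rfl | rfl | rfl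
  · refine SpanDer.apply_mem F hX ?_ ?_ ?_ ?_
    · rw [F.L_y hr]; exact I.mul_mem_left _ m1
    · rw [F.N_y hr']; exact I.mul_mem_left _ m1
    -- Since $\psi-\bar\psi$ is imaginary, its derivative along `M` is minus the conjugate of the
    -- one along `Mb`.
    · have h := congrArg star F.Mb_y
      simp only [F.star_Mb, star_sub, star_mul, star_add, star_star, star_ofNat] at h
      have h2 : F.M (F.psi - star F.psi) = -F.M (star F.psi - F.psi) := by
        rw [← map_neg, neg_sub]
      rw [h2, h]
      convert I.add_mem (I.mul_mem_left (3 * star (F.c F.N)) m1)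
        (I.mul_mem_left (-(3 * F.psi)) m3) using 1
      ring
    · rw [F.Mb_y]; exact I.add_mem (I.mul_mem_left _ m1) (I.mul_mem_left _ m2)
  · refine SpanDer.apply_mem F hX ?_ ?_ ?_ ?_
    · rw [F.L_s hr]; exact I.mul_mem_left _ m2
    · rw [F.N_s hr']; exact I.mul_mem_left _ m2
    · rw [F.M_s hr hr', ← neg_sub (F.c F.N)]
      exact I.sub_mem (I.mul_mem_left _ (I.neg_mem m2)) m1
    · rw [F.Mb_s]; exact I.mul_mem_left _ m2
  · have e : star (F.c F.N) - F.b F.L = star (F.c F.N - star (F.b F.L)) := by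
      rw [star_sub, star_star]
    refine SpanDer.apply_mem F hX ?_ ?_ ?_ ?_
    · rw [e, ← F.star_L, F.L_s hr, star_mul, ← e]; exact I.mul_mem_right _ m3
    · rw [e, ← F.star_N, F.N_s hr', star_mul, ← e]; exact I.mul_mem_right _ m3
    · rw [e, ← F.star_Mb, F.Mb_s, star_mul, ← e]; exact I.mul_mem_right _ m3
    · rw [e, ← F.star_M, F.M_s hr hr', ← neg_sub (F.c F.N), star_sub, star_mul, star_neg, ← e,
        star_sub F.psi, star_star F.psi, ← neg_sub F.psi]
      exact I.sub_mem (I.mul_mem_right _ (I.neg_mem m3)) (I.neg_mem m1)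

/-- If `t = t̄'`, then `ψ - ψ̄` and the imaginary parts of `r` and `r'` satisfy a closed system of
linear differential equations of first order. -/
lemma closed_system_of_symmetric (ht : star (F.b F.L) = F.c F.N)
    {X : Derivation ℂ R R} (hX : F.SpanDer X) {f : R}
    (hf : f ∈ ({F.psi - star F.psi, F.c F.M - star (F.c F.M),
      F.b F.Mb - star (F.b F.Mb)} : Set R)) :
    X f ∈ Ideal.span ({F.psi - star F.psi, F.c F.M - star (F.c F.M),
      F.b F.Mb - star (F.b F.Mb)} : Set R) := by
  set I := Ideal.span ({F.psi - star F.psi, F.c F.M - star (F.c F.M),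
      F.b F.Mb - star (F.b F.Mb)} : Set R) with hI
  have m1 : F.psi - star F.psi ∈ I := Ideal.subset_span (by simp)
  have m2 : F.c F.M - star (F.c F.M) ∈ I := Ideal.subset_span (by simp)
  have m3 : F.b F.Mb - star (F.b F.Mb) ∈ I := Ideal.subset_span (by simp)
  have sk (D D' : Derivation ℂ R R) (hD : ∀ f, star (D f) = D' (star f)) (u : R) :
      D' (u - star u) = -star (D (u - star u)) := by
    rw [hD, star_sub, star_star, ← map_neg, neg_sub]
  have hMb_y : F.Mb (F.psi - star F.psi) = 3 * F.c F.N * (F.psi - star F.psi) := by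
    rw [F.Mb_y, ht, sub_self, mul_zero, add_zero]
  rcases hf with rfl | rfl | rfl
  · refine SpanDer.apply_mem F hX ?_ ?_ ?_ ?_
    · rw [F.L_y']; exact I.add_mem (I.mul_mem_left _ m1) (I.mul_mem_left _ m2)
    · rw [F.N_y']; exact I.add_mem (I.mul_mem_left _ m1) (I.mul_mem_left _ m3)
    · rw [sk _ _ F.star_Mb, hMb_y, star_mul, star_sub, star_star, ← neg_sub F.psi]
      exact I.neg_mem (I.mul_mem_right _ (I.neg_mem m1))
    · rw [hMb_y]; exact I.mul_mem_left _ m1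
  · refine SpanDer.apply_mem F hX ?_ ?_ ?_ ?_
    · rw [F.L_q]; exact I.mul_mem_left _ m2
    · rw [F.N_q ht]; exact I.sub_mem m1 (I.mul_mem_left _ m2)
    · rw [sk _ _ F.star_Mb, F.Mb_q ht, star_mul, star_sub (F.c F.M), star_star,
        ← neg_sub (F.c F.M)]
      exact I.neg_mem (I.mul_mem_right _ (I.neg_mem m2))
    · rw [F.Mb_q ht]; exact I.mul_mem_left _ m2
  · refine SpanDer.apply_mem F hX ?_ ?_ ?_ ?_
    · rw [F.L_q' ht]; exact I.add_mem m1 (I.mul_mem_left _ m3)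
    · rw [F.N_q']; exact I.mul_mem_left _ m3
    · rw [F.M_q' ht]; exact I.mul_mem_left _ m3
    · rw [sk _ _ F.star_M, F.M_q' ht, star_mul, star_sub (F.b F.Mb), star_star,
        ← neg_sub (F.b F.Mb)]
      exact I.neg_mem (I.mul_mem_right _ (I.neg_mem m3))

end NullFrame

/-! ### Orthonormal frames adapted to a type D vacuum metric -/

/-- The Levi-Civita symbol. -/
def eps (a b c d : Fin 4) : ℤ :=
  Int.sign (((b : ℤ) - a) * ((c : ℤ) - a) * ((d : ℤ) - a) * ((c : ℤ) - b) * ((d : ℤ) - b)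
    * ((d : ℤ) - c))

/-- The diagonal of the Minkowski metric. -/
def mink : Fin 4 → ℤ := ![-1, 1, 1, 1]

/-- The components of `e⁰ ∧ e¹`. -/
def biv01 : Matrix (Fin 4) (Fin 4) ℤ := !![0, 1, 0, 0; -1, 0, 0, 0; 0, 0, 0, 0; 0, 0, 0, 0]

/-- The components of `e² ∧ e³`. -/
def biv23 : Matrix (Fin 4) (Fin 4) ℤ := !![0, 0, 0, 0; 0, 0, 0, 0; 0, 0, 0, 1; 0, 0, -1, 0]

/-- The components of `G` in an orthonormal frame. -/
def minkG (a b c d : Fin 4) : ℤ :=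
  (if a = c then mink a else 0) * (if b = d then mink b else 0)
    - (if a = d then mink a else 0) * (if b = c then mink b else 0)

/-- The image of the imaginary unit in a complex algebra. -/
def imUnit (R : Type*) [CommRing R] [Algebra ℂ R] : R := algebraMap ℂ R Complex.I

/-- The image of `1 / 2` in a complex algebra. -/
def half (R : Type*) [CommRing R] [Algebra ℂ R] : R := algebraMap ℂ R (1 / 2)

section

variable {R : Type*} [CommRing R] [Algebra ℂ R]

lemma imUnit_sq : imUnit R ^ 2 = -1 := by
  rw [imUnit, ← map_pow, Complex.I_sq, map_neg, map_one]

lemma two_mul_half : 2 * half R = 1 := by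
  rw [half, ← map_ofNat (algebraMap ℂ R) 2, ← map_mul]; norm_num

lemma star_imUnit [StarRing R] [StarModule ℂ R] : star (imUnit R) = -imUnit R := by
  rw [imUnit, ← algebraMap_star_comm, ← map_neg]; congr 1; simp

lemma star_half [StarRing R] [StarModule ℂ R] : star (half R) = half R := by
  rw [half, ← algebraMap_star_comm]; congr 1; simp

lemma derivation_imUnit (X : Derivation ℂ R R) : X (imUnit R) = 0 := X.map_algebraMap _

lemma derivation_half (X : Derivation ℂ R R) : X (half R) = 0 := X.map_algebraMap _

/-- The curvature forms of the connection forms `θ`. -/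
def Omega (θ : Fin 4 → Fin 4 → Derivation ℂ R R →ₗ[R] R) (a b : Fin 4)
    (X Y : Derivation ℂ R R) : R :=
  dForm (θ a b) X Y + ∑ f, (mink f : R) * (θ a f X * θ f b Y - θ a f Y * θ f b X)

variable (R) in
/-- Half of the curvature tensor of type D with eigenvalue `w` in an adapted orthonormal frame is
the real part of this tensor. -/
def typeDTensor (w : R) (a b c d : Fin 4) : R :=
  w * (3 * ((biv01 a b : R) - imUnit R * (biv23 a b : R)) *
    ((biv01 c d : R) - imUnit R * (biv23 c d : R)) + (minkG a b c d : R)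
      + imUnit R * (eps a b c d : R))

end

/-- An orthonormal frame with its connection forms, in which the curvature tensor has the canonical
form of a type D vacuum metric. -/
structure OrthoFrame (R : Type*) [CommRing R] [Algebra ℂ R] [StarRing R] where
  e : Fin 4 → Derivation ℂ R R
  θ : Fin 4 → Fin 4 → Derivation ℂ R R →ₗ[R] R
  w : R
  isUnit_w : IsUnit w
  star_e : ∀ a f, star (e a f) = e a (star f)
  star_θ : ∀ a b c, star (θ a b (e c)) = θ a b (e c)
  θ_antisymm : ∀ a b, θ a b = -θ b a
  torsion : ∀ c d, ⁅e c, e d⁆ = ∑ a, ((mink a : R) * (θ a d (e c) - θ a c (e d))) • e a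
  curvature : ∀ a b c d, 2 * Omega θ a b (e c) (e d) =
    typeDTensor R w a b c d + star (typeDTensor R w a b c d)

namespace OrthoFrame

variable {R : Type*} [CommRing R] [Algebra ℂ R]

/-- The self-dual connection forms. -/
def formA (θ : Fin 4 → Fin 4 → Derivation ℂ R R →ₗ[R] R) : Derivation ℂ R R →ₗ[R] R :=
  half R • (θ 0 1 + imUnit R • θ 2 3)

/-- The self-dual connection forms. -/
def formB (θ : Fin 4 → Fin 4 → Derivation ℂ R R →ₗ[R] R) : Derivation ℂ R R →ₗ[R] R :=
  half R • (θ 0 2 - θ 1 2 + imUnit R • (θ 0 3 - θ 1 3))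

/-- The self-dual connection forms. -/
def formC (θ : Fin 4 → Fin 4 → Derivation ℂ R R →ₗ[R] R) : Derivation ℂ R R →ₗ[R] R :=
  half R • (θ 0 2 + θ 1 2 - imUnit R • (θ 0 3 + θ 1 3))

lemma sum_fin4 {A : Type*} [AddCommMonoid A] (f : Fin 4 → A) :
    ∑ i, f i = f 0 + f 1 + f 2 + f 3 := Fin.sum_univ_four f

section Curvature

variable (θ : Fin 4 → Fin 4 → Derivation ℂ R R →ₗ[R] R) (X Y : Derivation ℂ R R)

lemma dForm_add (P Q : Derivation ℂ R R →ₗ[R] R) : dForm (P + Q) X Y = dForm P X Y + dForm Q X Y := by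
  simp only [dForm, LinearMap.add_apply, map_add]; ring

lemma dForm_sub (P Q : Derivation ℂ R R →ₗ[R] R) : dForm (P - Q) X Y = dForm P X Y - dForm Q X Y := by
  simp only [dForm, LinearMap.sub_apply, map_sub]; ring

lemma dForm_imUnit (P : Derivation ℂ R R →ₗ[R] R) :
    dForm (imUnit R • P) X Y = imUnit R * dForm P X Y := by
  simp only [dForm, LinearMap.smul_apply, smul_eq_mul, Derivation.leibniz, derivation_imUnit]; ring

lemma dForm_half (P : Derivation ℂ R R →ₗ[R] R) :
    dForm (half R • P) X Y = half R * dForm P X Y := by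
  simp only [dForm, LinearMap.smul_apply, smul_eq_mul, Derivation.leibniz, derivation_half]; ring

lemma mink_values : mink 0 = -1 ∧ mink 1 = 1 ∧ mink 2 = 1 ∧ mink 3 = 1 := by
  refine ⟨rfl, rfl, rfl, rfl⟩

variable {θ} (hθ : ∀ a b, θ a b = -θ b a)
include hθ

lemma θ_self (a : Fin 4) : θ a a = 0 := by
  have h := hθ a a
  ext Z
  have h1 := congrArg (fun f => f Z) h
  simp only [LinearMap.neg_apply] at h1
  have := NullFrame.two_mul_eq_zero (x := θ a a Z) (by linear_combination h1)
  simpa using this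

set_option linter.unusedSimpArgs false

/-- The passage from `θ` to `formA`, `formB`, `formC` is the projection of the complexified Lorentz
algebra onto its self-dual factor $\mathfrak{sl}(2,\mathbb C)$. It is a homomorphism of Lie algebras
and so maps curvature to curvature; the quadratic terms match by $i^2=-1$ and $2\cdot\frac12=1$. -/
lemma curvForm_A : curvForm (-1) (formA θ) (formB θ) (formC θ) X Y =
    half R * (Omega θ 0 1 X Y + imUnit R * Omega θ 2 3 X Y) := by
  have hi := imUnit_sq (R := R)
  have hh := two_mul_half (R := R)
  have e : ∀ a b Z, θ a b Z = -θ b a Z := fun a b Z => by rw [hθ]; rfl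
  simp only [curvForm, Omega, formA, formB, formC, dForm_half, dForm_add, dForm_sub, dForm_imUnit,
    sum_fin4, LinearMap.smul_apply, LinearMap.add_apply, LinearMap.sub_apply, smul_eq_mul,
    θ_self hθ, LinearMap.zero_apply, mink_values, e 1 0, e 2 0, e 3 0, e 2 1, e 3 1, e 3 2]
  push_cast
  linear_combination (half R ^ 2 * ((θ 0 3 X - θ 1 3 X) * (θ 0 3 Y + θ 1 3 Y) - (θ 0 3 Y - θ 1 3 Y) * (θ 0 3 X + θ 1 3 X))) * hi
    + half R * ((-(θ 0 2 X * θ 1 2 Y - θ 0 2 Y * θ 1 2 X) - (θ 0 3 X * θ 1 3 Y - θ 0 3 Y * θ 1 3 X))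
      + imUnit R * ((θ 0 2 X * θ 0 3 Y - θ 0 2 Y * θ 0 3 X) - (θ 1 2 X * θ 1 3 Y - θ 1 2 Y * θ 1 3 X))) * hh

lemma curvForm_B : curvForm (-2) (formB θ) (formA θ) (formB θ) X Y =
    half R * (Omega θ 0 2 X Y - Omega θ 1 2 X Y + imUnit R * (Omega θ 0 3 X Y - Omega θ 1 3 X Y)) := by
  have hi := imUnit_sq (R := R)
  have hh := two_mul_half (R := R)
  have e : ∀ a b Z, θ a b Z = -θ b a Z := fun a b Z => by rw [hθ]; rfl
  simp only [curvForm, Omega, formA, formB, formC, dForm_half, dForm_add, dForm_sub, dForm_imUnit,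
    sum_fin4, LinearMap.smul_apply, LinearMap.add_apply, LinearMap.sub_apply, smul_eq_mul,
    θ_self hθ, LinearMap.zero_apply, mink_values, e 1 0, e 2 0, e 3 0, e 2 1, e 3 1, e 3 2]
  push_cast
  linear_combination (-2 * half R ^ 2 * (θ 2 3 X * (θ 0 3 Y - θ 1 3 Y) - θ 2 3 Y * (θ 0 3 X - θ 1 3 X))) * hi
    + half R * (((θ 0 1 X * θ 1 2 Y - θ 0 1 Y * θ 1 2 X) - (θ 0 3 X * θ 2 3 Y - θ 0 3 Y * θ 2 3 X))
      - ((θ 0 1 X * θ 0 2 Y - θ 0 1 Y * θ 0 2 X) - (θ 1 3 X * θ 2 3 Y - θ 1 3 Y * θ 2 3 X))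
      + imUnit R * (((θ 0 1 X * θ 1 3 Y - θ 0 1 Y * θ 1 3 X) + (θ 0 2 X * θ 2 3 Y - θ 0 2 Y * θ 2 3 X))
      - ((θ 0 1 X * θ 0 3 Y - θ 0 1 Y * θ 0 3 X) + (θ 1 2 X * θ 2 3 Y - θ 1 2 Y * θ 2 3 X)))) * hh

lemma curvForm_C : curvForm 2 (formC θ) (formA θ) (formC θ) X Y =
    half R * (Omega θ 0 2 X Y + Omega θ 1 2 X Y - imUnit R * (Omega θ 0 3 X Y + Omega θ 1 3 X Y)) := by
  have hi := imUnit_sq (R := R)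
  have hh := two_mul_half (R := R)
  have e : ∀ a b Z, θ a b Z = -θ b a Z := fun a b Z => by rw [hθ]; rfl
  simp only [curvForm, Omega, formA, formB, formC, dForm_half, dForm_add, dForm_sub, dForm_imUnit,
    sum_fin4, LinearMap.smul_apply, LinearMap.add_apply, LinearMap.sub_apply, smul_eq_mul,
    θ_self hθ, LinearMap.zero_apply, mink_values, e 1 0, e 2 0, e 3 0, e 2 1, e 3 1, e 3 2]
  push_cast
  linear_combination (-2 * half R ^ 2 * (θ 2 3 X * (θ 0 3 Y + θ 1 3 Y) - θ 2 3 Y * (θ 0 3 X + θ 1 3 X))) * hi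
    + half R * (((θ 0 1 X * θ 1 2 Y - θ 0 1 Y * θ 1 2 X) - (θ 0 3 X * θ 2 3 Y - θ 0 3 Y * θ 2 3 X))
      + ((θ 0 1 X * θ 0 2 Y - θ 0 1 Y * θ 0 2 X) - (θ 1 3 X * θ 2 3 Y - θ 1 3 Y * θ 2 3 X))
      - imUnit R * (((θ 0 1 X * θ 1 3 Y - θ 0 1 Y * θ 1 3 X) + (θ 0 2 X * θ 2 3 Y - θ 0 2 Y * θ 2 3 X))
      + ((θ 0 1 X * θ 0 3 Y - θ 0 1 Y * θ 0 3 X) + (θ 1 2 X * θ 2 3 Y - θ 1 2 Y * θ 2 3 X)))) * hh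

end Curvature

end OrthoFrame

/-! ### From orthonormal frames to null frames -/

namespace OrthoFrame

set_option linter.unusedSimpArgs false

variable {R : Type*} [CommRing R] [Algebra ℂ R]

lemma curvForm_add_right (k : ℤ) (P Q S : Derivation ℂ R R →ₗ[R] R) (X Y Z : Derivation ℂ R R) :
    curvForm k P Q S X (Y + Z) = curvForm k P Q S X Y + curvForm k P Q S X Z := by
  rw [curvForm_swap, curvForm_add_left, curvForm_swap k P Q S X, curvForm_swap k P Q S X Z]; ring

lemma curvForm_sub_right (k : ℤ) (P Q S : Derivation ℂ R R →ₗ[R] R) (X Y Z : Derivation ℂ R R) :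
    curvForm k P Q S X (Y - Z) = curvForm k P Q S X Y - curvForm k P Q S X Z := by
  rw [curvForm_swap, curvForm_sub_left, curvForm_swap k P Q S X, curvForm_swap k P Q S X Z]; ring

lemma curvForm_smul_right (k : ℤ) (P Q S : Derivation ℂ R R →ₗ[R] R) (X Y : Derivation ℂ R R)
    (f : R) : curvForm k P Q S X (f • Y) = f * curvForm k P Q S X Y := by
  rw [curvForm_swap, curvForm_smul_left, curvForm_swap k P Q S X]; ring

variable [StarRing R] (O : OrthoFrame R)

lemma θ_symm_apply (a b : Fin 4) (Z : Derivation ℂ R R) : O.θ a b Z = -O.θ b a Z := by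
  rw [O.θ_antisymm]; rfl

lemma two_Omega (a b c d : Fin 4) : Omega O.θ a b (O.e c) (O.e d) =
    half R * (typeDTensor R O.w a b c d + star (typeDTensor R O.w a b c d)) := by
  linear_combination half R * O.curvature a b c d
    - Omega O.θ a b (O.e c) (O.e d) * two_mul_half (R := R)

lemma θ_apply_self (a : Fin 4) (Z : Derivation ℂ R R) : O.θ a a Z = 0 := by
  rw [θ_self O.θ_antisymm]; rfl

variable [StarModule ℂ R]

/-- The tensor `typeDTensor` is self-dual in its first pair of indices and its conjugate is
anti-self-dual. The combination $\Omega_{01}+i\Omega_{23}$ doubles the former and annihilates the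
latter, so that `star O.w` drops out. -/
lemma A_curv (c d : Fin 4) : curvForm (-1) (formA O.θ) (formB O.θ) (formC O.θ) (O.e c) (O.e d) =
    O.w * ((biv01 c d : R) - imUnit R * (biv23 c d : R)) := by
  rw [curvForm_A _ _ O.θ_antisymm, two_Omega, two_Omega]
  have hi := imUnit_sq (R := R)
  have hh := two_mul_half (R := R)
  fin_cases c <;> fin_cases d <;>
  simp [typeDTensor, biv01, biv23, minkG, mink, eps, star_imUnit] <;> grind

lemma B_curv (c d : Fin 4) : curvForm (-2) (formB O.θ) (formA O.θ) (formB O.θ) (O.e c) (O.e d) =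
    -half R * O.w * (![1, 1, 0, 0] c * ![0, 0, 1, imUnit R] d
      - ![1, 1, 0, 0] d * ![0, 0, 1, imUnit R] c) := by
  rw [curvForm_B _ _ O.θ_antisymm, two_Omega, two_Omega, two_Omega, two_Omega]
  have hi := imUnit_sq (R := R)
  have hh := two_mul_half (R := R)
  fin_cases c <;> fin_cases d <;>
  simp [typeDTensor, biv01, biv23, minkG, mink, eps, star_imUnit] <;> grind

lemma C_curv (c d : Fin 4) : curvForm 2 (formC O.θ) (formA O.θ) (formC O.θ) (O.e c) (O.e d) =
    -half R * O.w * (![1, -1, 0, 0] c * ![0, 0, 1, -imUnit R] d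
      - ![1, -1, 0, 0] d * ![0, 0, 1, -imUnit R] c) := by
  rw [curvForm_C _ _ O.θ_antisymm, two_Omega, two_Omega, two_Omega, two_Omega]
  have hi := imUnit_sq (R := R)
  have hh := two_mul_half (R := R)
  fin_cases c <;> fin_cases d <;>
  simp [typeDTensor, biv01, biv23, minkG, mink, eps, star_imUnit] <;> grind

/-- The null vectors of an orthonormal frame. -/
def nullL : Derivation ℂ R R := O.e 0 + O.e 1

/-- The null vectors of an orthonormal frame. -/
def nullN : Derivation ℂ R R := O.e 0 - O.e 1

/-- The null vectors of an orthonormal frame. -/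
def nullM : Derivation ℂ R R := O.e 2 + imUnit R • O.e 3

/-- The null vectors of an orthonormal frame. -/
def nullMb : Derivation ℂ R R := O.e 2 - imUnit R • O.e 3

/-- Only `O.torsion` and the reality of the `θ a b (e c)` are used in the six bracket lemmas: they
rewrite the first structure equation in the null frame. -/
lemma lie_nullLN : ⁅O.nullL, O.nullN⁆ = ((formA O.θ) O.nullL + star ((formA O.θ) O.nullL)) • O.nullN - (formB O.θ) O.nullL • O.nullMb - star ((formB O.θ) O.nullL) • O.nullM
    + ((formA O.θ) O.nullN + star ((formA O.θ) O.nullN)) • O.nullL + (formC O.θ) O.nullN • O.nullM + star ((formC O.θ) O.nullN) • O.nullMb := by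
  have hi := imUnit_sq (R := R)
  have hh := two_mul_half (R := R)
  ext f
  simp [nullL, nullN, nullM, nullMb, lie_add, add_lie, lie_sub, sub_lie, smul_lie_derivation,
    derivation_imUnit, O.torsion, sum_fin4, mink_values, formA, formB, formC,
    O.star_θ, star_imUnit, star_half, θ_apply_self, O.θ_symm_apply 1 0, O.θ_symm_apply 2 0,
    O.θ_symm_apply 3 0, O.θ_symm_apply 2 1, O.θ_symm_apply 3 1, O.θ_symm_apply 3 2]
  grind

lemma lie_nullLM : ⁅O.nullL, O.nullM⁆ = ((formA O.θ) O.nullL - star ((formA O.θ) O.nullL)) • O.nullM - (formB O.θ) O.nullL • O.nullL - star ((formC O.θ) O.nullL) • O.nullN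
    + ((formA O.θ) O.nullM + star ((formA O.θ) O.nullMb)) • O.nullL + (formC O.θ) O.nullM • O.nullM + star ((formC O.θ) O.nullMb) • O.nullMb := by
  have hi := imUnit_sq (R := R)
  have hh := two_mul_half (R := R)
  ext f
  simp [nullL, nullN, nullM, nullMb, lie_add, add_lie, lie_sub, sub_lie, smul_lie_derivation,
    derivation_imUnit, O.torsion, sum_fin4, mink_values, formA, formB, formC,
    O.star_θ, star_imUnit, star_half, θ_apply_self, O.θ_symm_apply 1 0, O.θ_symm_apply 2 0,
    O.θ_symm_apply 3 0, O.θ_symm_apply 2 1, O.θ_symm_apply 3 1, O.θ_symm_apply 3 2]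
  grind

lemma lie_nullLMb : ⁅O.nullL, O.nullMb⁆ = (star ((formA O.θ) O.nullL) - (formA O.θ) O.nullL) • O.nullMb - star ((formB O.θ) O.nullL) • O.nullL - (formC O.θ) O.nullL • O.nullN
    + (star ((formA O.θ) O.nullM) + (formA O.θ) O.nullMb) • O.nullL + star ((formC O.θ) O.nullM) • O.nullMb + (formC O.θ) O.nullMb • O.nullM := by
  have hi := imUnit_sq (R := R)
  have hh := two_mul_half (R := R)
  ext f
  simp [nullL, nullN, nullM, nullMb, lie_add, add_lie, lie_sub, sub_lie, smul_lie_derivation,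
    derivation_imUnit, O.torsion, sum_fin4, mink_values, formA, formB, formC,
    O.star_θ, star_imUnit, star_half, θ_apply_self, O.θ_symm_apply 1 0, O.θ_symm_apply 2 0,
    O.θ_symm_apply 3 0, O.θ_symm_apply 2 1, O.θ_symm_apply 3 1, O.θ_symm_apply 3 2]
  grind

lemma lie_nullNM : ⁅O.nullN, O.nullM⁆ = ((formA O.θ) O.nullN - star ((formA O.θ) O.nullN)) • O.nullM - (formB O.θ) O.nullN • O.nullL - star ((formC O.θ) O.nullN) • O.nullN
    - ((formA O.θ) O.nullM + star ((formA O.θ) O.nullMb)) • O.nullN + (formB O.θ) O.nullM • O.nullMb + star ((formB O.θ) O.nullMb) • O.nullM := by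
  have hi := imUnit_sq (R := R)
  have hh := two_mul_half (R := R)
  ext f
  simp [nullL, nullN, nullM, nullMb, lie_add, add_lie, lie_sub, sub_lie, smul_lie_derivation,
    derivation_imUnit, O.torsion, sum_fin4, mink_values, formA, formB, formC,
    O.star_θ, star_imUnit, star_half, θ_apply_self, O.θ_symm_apply 1 0, O.θ_symm_apply 2 0,
    O.θ_symm_apply 3 0, O.θ_symm_apply 2 1, O.θ_symm_apply 3 1, O.θ_symm_apply 3 2]
  grind

lemma lie_nullNMb : ⁅O.nullN, O.nullMb⁆ = (star ((formA O.θ) O.nullN) - (formA O.θ) O.nullN) • O.nullMb - star ((formB O.θ) O.nullN) • O.nullL - (formC O.θ) O.nullN • O.nullN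
    - (star ((formA O.θ) O.nullM) + (formA O.θ) O.nullMb) • O.nullN + star ((formB O.θ) O.nullM) • O.nullM + (formB O.θ) O.nullMb • O.nullMb := by
  have hi := imUnit_sq (R := R)
  have hh := two_mul_half (R := R)
  ext f
  simp [nullL, nullN, nullM, nullMb, lie_add, add_lie, lie_sub, sub_lie, smul_lie_derivation,
    derivation_imUnit, O.torsion, sum_fin4, mink_values, formA, formB, formC,
    O.star_θ, star_imUnit, star_half, θ_apply_self, O.θ_symm_apply 1 0, O.θ_symm_apply 2 0,
    O.θ_symm_apply 3 0, O.θ_symm_apply 2 1, O.θ_symm_apply 3 1, O.θ_symm_apply 3 2]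
  grind

lemma lie_nullMMb : ⁅O.nullM, O.nullMb⁆ = (star ((formA O.θ) O.nullMb) - (formA O.θ) O.nullM) • O.nullMb - star ((formB O.θ) O.nullMb) • O.nullL - (formC O.θ) O.nullM • O.nullN
    - ((formA O.θ) O.nullMb - star ((formA O.θ) O.nullM)) • O.nullM + (formB O.θ) O.nullMb • O.nullL + star ((formC O.θ) O.nullM) • O.nullN := by
  have hi := imUnit_sq (R := R)
  have hh := two_mul_half (R := R)
  ext f
  simp [nullL, nullN, nullM, nullMb, lie_add, add_lie, lie_sub, sub_lie, smul_lie_derivation,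
    derivation_imUnit, O.torsion, sum_fin4, mink_values, formA, formB, formC,
    O.star_θ, star_imUnit, star_half, θ_apply_self, O.θ_symm_apply 1 0, O.θ_symm_apply 2 0,
    O.θ_symm_apply 3 0, O.θ_symm_apply 2 1, O.θ_symm_apply 3 1, O.θ_symm_apply 3 2]
  grind

lemma A_nullLN : curvForm (-1) (formA O.θ) (formB O.θ) (formC O.θ) O.nullL O.nullN = (-2 * O.w) := by
  have hi := imUnit_sq (R := R)
  have hh := two_mul_half (R := R)
  simp only [nullL, nullN, nullM, nullMb, curvForm_add_left, curvForm_sub_left, curvForm_smul_left,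
    curvForm_add_right, curvForm_sub_right, curvForm_smul_right, A_curv]
  simp [biv01, biv23]
  try grind

lemma A_nullMMb : curvForm (-1) (formA O.θ) (formB O.θ) (formC O.θ) O.nullM O.nullMb = (-2 * O.w) := by
  have hi := imUnit_sq (R := R)
  have hh := two_mul_half (R := R)
  simp only [nullL, nullN, nullM, nullMb, curvForm_add_left, curvForm_sub_left, curvForm_smul_left,
    curvForm_add_right, curvForm_sub_right, curvForm_smul_right, A_curv]
  simp [biv01, biv23]
  try grind

lemma A_nullLM : curvForm (-1) (formA O.θ) (formB O.θ) (formC O.θ) O.nullL O.nullM = 0 := by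
  have hi := imUnit_sq (R := R)
  have hh := two_mul_half (R := R)
  simp only [nullL, nullN, nullM, nullMb, curvForm_add_left, curvForm_sub_left, curvForm_smul_left,
    curvForm_add_right, curvForm_sub_right, curvForm_smul_right, A_curv]
  simp [biv01, biv23]
  try grind

lemma A_nullLMb : curvForm (-1) (formA O.θ) (formB O.θ) (formC O.θ) O.nullL O.nullMb = 0 := by
  have hi := imUnit_sq (R := R)
  have hh := two_mul_half (R := R)
  simp only [nullL, nullN, nullM, nullMb, curvForm_add_left, curvForm_sub_left, curvForm_smul_left,
    curvForm_add_right, curvForm_sub_right, curvForm_smul_right, A_curv]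
  simp [biv01, biv23]
  try grind

lemma A_nullNM : curvForm (-1) (formA O.θ) (formB O.θ) (formC O.θ) O.nullN O.nullM = 0 := by
  have hi := imUnit_sq (R := R)
  have hh := two_mul_half (R := R)
  simp only [nullL, nullN, nullM, nullMb, curvForm_add_left, curvForm_sub_left, curvForm_smul_left,
    curvForm_add_right, curvForm_sub_right, curvForm_smul_right, A_curv]
  simp [biv01, biv23]
  try grind

lemma A_nullNMb : curvForm (-1) (formA O.θ) (formB O.θ) (formC O.θ) O.nullN O.nullMb = 0 := by
  have hi := imUnit_sq (R := R)
  have hh := two_mul_half (R := R)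
  simp only [nullL, nullN, nullM, nullMb, curvForm_add_left, curvForm_sub_left, curvForm_smul_left,
    curvForm_add_right, curvForm_sub_right, curvForm_smul_right, A_curv]
  simp [biv01, biv23]
  try grind

lemma B_nullLN : curvForm (-2) (formB O.θ) (formA O.θ) (formB O.θ) O.nullL O.nullN = 0 := by
  have hi := imUnit_sq (R := R)
  have hh := two_mul_half (R := R)
  simp only [nullL, nullN, nullM, nullMb, curvForm_add_left, curvForm_sub_left, curvForm_smul_left,
    curvForm_add_right, curvForm_sub_right, curvForm_smul_right, B_curv]
  simp [biv01, biv23]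
  try grind

lemma B_nullMMb : curvForm (-2) (formB O.θ) (formA O.θ) (formB O.θ) O.nullM O.nullMb = 0 := by
  have hi := imUnit_sq (R := R)
  have hh := two_mul_half (R := R)
  simp only [nullL, nullN, nullM, nullMb, curvForm_add_left, curvForm_sub_left, curvForm_smul_left,
    curvForm_add_right, curvForm_sub_right, curvForm_smul_right, B_curv]
  simp [biv01, biv23]
  try grind

lemma B_nullLM : curvForm (-2) (formB O.θ) (formA O.θ) (formB O.θ) O.nullL O.nullM = 0 := by
  have hi := imUnit_sq (R := R)
  have hh := two_mul_half (R := R)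
  simp only [nullL, nullN, nullM, nullMb, curvForm_add_left, curvForm_sub_left, curvForm_smul_left,
    curvForm_add_right, curvForm_sub_right, curvForm_smul_right, B_curv]
  simp [biv01, biv23]
  try grind

lemma B_nullLMb : curvForm (-2) (formB O.θ) (formA O.θ) (formB O.θ) O.nullL O.nullMb = (-2 * O.w) := by
  have hi := imUnit_sq (R := R)
  have hh := two_mul_half (R := R)
  simp only [nullL, nullN, nullM, nullMb, curvForm_add_left, curvForm_sub_left, curvForm_smul_left,
    curvForm_add_right, curvForm_sub_right, curvForm_smul_right, B_curv]
  simp [biv01, biv23]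
  try grind

lemma B_nullNM : curvForm (-2) (formB O.θ) (formA O.θ) (formB O.θ) O.nullN O.nullM = 0 := by
  have hi := imUnit_sq (R := R)
  have hh := two_mul_half (R := R)
  simp only [nullL, nullN, nullM, nullMb, curvForm_add_left, curvForm_sub_left, curvForm_smul_left,
    curvForm_add_right, curvForm_sub_right, curvForm_smul_right, B_curv]
  simp [biv01, biv23]
  try grind

lemma B_nullNMb : curvForm (-2) (formB O.θ) (formA O.θ) (formB O.θ) O.nullN O.nullMb = 0 := by
  have hi := imUnit_sq (R := R)
  have hh := two_mul_half (R := R)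
  simp only [nullL, nullN, nullM, nullMb, curvForm_add_left, curvForm_sub_left, curvForm_smul_left,
    curvForm_add_right, curvForm_sub_right, curvForm_smul_right, B_curv]
  simp [biv01, biv23]
  try grind

lemma C_nullLN : curvForm 2 (formC O.θ) (formA O.θ) (formC O.θ) O.nullL O.nullN = 0 := by
  have hi := imUnit_sq (R := R)
  have hh := two_mul_half (R := R)
  simp only [nullL, nullN, nullM, nullMb, curvForm_add_left, curvForm_sub_left, curvForm_smul_left,
    curvForm_add_right, curvForm_sub_right, curvForm_smul_right, C_curv]
  simp [biv01, biv23]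
  try grind

lemma C_nullMMb : curvForm 2 (formC O.θ) (formA O.θ) (formC O.θ) O.nullM O.nullMb = 0 := by
  have hi := imUnit_sq (R := R)
  have hh := two_mul_half (R := R)
  simp only [nullL, nullN, nullM, nullMb, curvForm_add_left, curvForm_sub_left, curvForm_smul_left,
    curvForm_add_right, curvForm_sub_right, curvForm_smul_right, C_curv]
  simp [biv01, biv23]
  try grind

lemma C_nullLM : curvForm 2 (formC O.θ) (formA O.θ) (formC O.θ) O.nullL O.nullM = 0 := by
  have hi := imUnit_sq (R := R)
  have hh := two_mul_half (R := R)
  simp only [nullL, nullN, nullM, nullMb, curvForm_add_left, curvForm_sub_left, curvForm_smul_left,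
    curvForm_add_right, curvForm_sub_right, curvForm_smul_right, C_curv]
  simp [biv01, biv23]
  try grind

lemma C_nullLMb : curvForm 2 (formC O.θ) (formA O.θ) (formC O.θ) O.nullL O.nullMb = 0 := by
  have hi := imUnit_sq (R := R)
  have hh := two_mul_half (R := R)
  simp only [nullL, nullN, nullM, nullMb, curvForm_add_left, curvForm_sub_left, curvForm_smul_left,
    curvForm_add_right, curvForm_sub_right, curvForm_smul_right, C_curv]
  simp [biv01, biv23]
  try grind

lemma C_nullNM : curvForm 2 (formC O.θ) (formA O.θ) (formC O.θ) O.nullN O.nullM = (-2 * O.w) := by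
  have hi := imUnit_sq (R := R)
  have hh := two_mul_half (R := R)
  simp only [nullL, nullN, nullM, nullMb, curvForm_add_left, curvForm_sub_left, curvForm_smul_left,
    curvForm_add_right, curvForm_sub_right, curvForm_smul_right, C_curv]
  simp [biv01, biv23]
  try grind

lemma C_nullNMb : curvForm 2 (formC O.θ) (formA O.θ) (formC O.θ) O.nullN O.nullMb = 0 := by
  have hi := imUnit_sq (R := R)
  have hh := two_mul_half (R := R)
  simp only [nullL, nullN, nullM, nullMb, curvForm_add_left, curvForm_sub_left, curvForm_smul_left,
    curvForm_add_right, curvForm_sub_right, curvForm_smul_right, C_curv]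
  simp [biv01, biv23]
  try grind

/-- The null frame associated with an orthonormal frame. -/
def toNullFrame : NullFrame R where
  L := O.nullL
  N := O.nullN
  M := O.nullM
  Mb := O.nullMb
  a := formA O.θ
  b := formB O.θ
  c := formC O.θ
  psi := -2 * O.w
  isUnit_psi := by
    have h2 : IsUnit (-2 : R) := by
      have := (IsUnit.mk0 (-2 : ℂ) (by norm_num)).map (algebraMap ℂ R)
      rwa [map_neg, map_ofNat] at this
    exact h2.mul O.isUnit_w
  star_L f := by simp [nullL, O.star_e]
  star_N f := by simp [nullN, O.star_e]
  star_M f := by simp [nullM, nullMb, O.star_e, star_imUnit, sub_eq_add_neg, mul_comm]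
  star_Mb f := by simp [nullM, nullMb, O.star_e, star_imUnit, sub_eq_add_neg, mul_comm]
  lie_LN := O.lie_nullLN
  lie_LM := O.lie_nullLM
  lie_LMb := O.lie_nullLMb
  lie_NM := O.lie_nullNM
  lie_NMb := O.lie_nullNMb
  lie_MMb := O.lie_nullMMb
  aLN := O.A_nullLN
  aMMb := O.A_nullMMb
  aLM := O.A_nullLM
  aLMb := O.A_nullLMb
  aNM := O.A_nullNM
  aNMb := O.A_nullNMb
  bLN := O.B_nullLN
  bMMb := O.B_nullMMb
  bLM := O.B_nullLM
  bLMb := O.B_nullLMb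
  bNM := O.B_nullNM
  bNMb := O.B_nullNMb
  cLN := O.C_nullLN
  cMMb := O.C_nullMMb
  cLM := O.C_nullLM
  cLMb := O.C_nullLMb
  cNM := O.C_nullNM
  cNMb := O.C_nullNMb

end OrthoFrame

/-! ### Connections in coordinates -/

section Gauge

variable {R : Type*} [CommRing R] [Algebra ℂ R]

/-- The derivative of a matrix. -/
def dMat (D : Derivation ℂ R R) (A : Matrix (Fin 4) (Fin 4) R) : Matrix (Fin 4) (Fin 4) R :=
  A.map D

lemma dMat_mul (D : Derivation ℂ R R) (A B : Matrix (Fin 4) (Fin 4) R) :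
    dMat D (A * B) = dMat D A * B + A * dMat D B := by
  ext i j
  simp only [dMat, Matrix.map_apply, Matrix.mul_apply, Matrix.add_apply, map_sum,
    Derivation.leibniz, smul_eq_mul, ← Finset.sum_add_distrib]
  exact Finset.sum_congr rfl fun k _ => by ring

lemma dMat_add (D : Derivation ℂ R R) (A B : Matrix (Fin 4) (Fin 4) R) :
    dMat D (A + B) = dMat D A + dMat D B := by
  ext i j; simp [dMat]

lemma dMat_transpose (D : Derivation ℂ R R) (A : Matrix (Fin 4) (Fin 4) R) :
    dMat D A.transpose = (dMat D A).transpose := rfl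

/-- The curvature of a connection given by its matrices in coordinates. -/
def curvMat (D : Fin 4 → Derivation ℂ R R) (A : Fin 4 → Matrix (Fin 4) (Fin 4) R) (i j : Fin 4) :
    Matrix (Fin 4) (Fin 4) R :=
  dMat (D i) (A j) - dMat (D j) (A i) + (A i * A j - A j * A i)

/-- The hypothesis is the transformation law of connection matrices. Differentiating it once more
and antisymmetrising removes the second derivatives of `E`, and the inhomogeneous terms cancel; `E`
need not be invertible. The lemma serves both for the passage to the orthonormal frame and for
changes of coordinates. -/
lemma gauge_curvMat (D : Fin 4 → Derivation ℂ R R) (hD : ∀ i j f, D i (D j f) = D j (D i f))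
    (A B : Fin 4 → Matrix (Fin 4) (Fin 4) R) (E : Matrix (Fin 4) (Fin 4) R)
    (h : ∀ i, E * A i = B i * E + dMat (D i) E) (i j : Fin 4) :
    E * curvMat D A i j = curvMat D B i j * E := by
  have hd (i j) : dMat (D i) (E * A j) = dMat (D i) (B j * E + dMat (D j) E) := by rw [h]
  have hc : dMat (D i) (dMat (D j) E) = dMat (D j) (dMat (D i) E) := by
    ext a b; exact hD _ _ _
  have h1 := hd i j
  have h2 := hd j i
  simp only [dMat_mul, dMat_add] at h1 h2
  rw [hc] at h1
  have e (i) : dMat (D i) E = E * A i - B i * E := by rw [h]; abel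
  simp only [e i, e j] at h1 h2
  have h3 : E * dMat (D i) (A j) = dMat (D i) (B j) * E + B j * (E * A i - B i * E)
      + dMat (D j) (E * A i - B i * E) - (E * A i - B i * E) * A j := by
    rw [← h1]; abel
  have h4 : E * dMat (D j) (A i) = dMat (D j) (B i) * E + B i * (E * A j - B j * E)
      + dMat (D j) (E * A i - B i * E) - (E * A j - B j * E) * A i := by
    rw [← h2]; abel
  rw [curvMat, curvMat, mul_add, mul_sub, h3, h4]
  noncomm_ring

/-- The vector field with given components. -/
def fieldOf (D : Fin 4 → Derivation ℂ R R) (u : Fin 4 → R) : Derivation ℂ R R := ∑ i, u i • D i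

/-- The 1-form with given components. -/
def formOf (x : Fin 4 → R) (p : Fin 4 → R) : Derivation ℂ R R →ₗ[R] R where
  toFun X := ∑ i, p i * X (x i)
  map_add' X Y := by simp [mul_add, Finset.sum_add_distrib]
  map_smul' f X := by
    simp only [Derivation.smul_apply, smul_eq_mul, RingHom.id_apply, Finset.mul_sum]
    exact Finset.sum_congr rfl fun k _ => by ring

variable {D : Fin 4 → Derivation ℂ R R} {x : Fin 4 → R}

lemma fieldOf_apply (u : Fin 4 → R) (f : R) : fieldOf D u f = ∑ i, u i * D i f := by
  simp only [fieldOf, Fin.sum_univ_four, Derivation.add_apply, Derivation.smul_apply, smul_eq_mul]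

lemma fieldOf_coord (hx : ∀ i j, D i (x j) = if i = j then 1 else 0) (u : Fin 4 → R) (j : Fin 4) :
    fieldOf D u (x j) = u j := by
  simp [fieldOf_apply, hx]

lemma formOf_fieldOf (hx : ∀ i j, D i (x j) = if i = j then 1 else 0) (p u : Fin 4 → R) :
    formOf x p (fieldOf D u) = ∑ i, p i * u i := by
  simp [formOf, fieldOf_coord hx]

lemma lie_fieldOf (hD : ∀ i j f, D i (D j f) = D j (D i f)) (u v : Fin 4 → R) :
    ⁅fieldOf D u, fieldOf D v⁆ =
      fieldOf D fun j => fieldOf D u (v j) - fieldOf D v (u j) := by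
  ext f
  simp only [Derivation.commutator_apply, fieldOf_apply, map_sum, Derivation.leibniz, smul_eq_mul,
    Finset.mul_sum, Finset.sum_add_distrib, sub_mul, Finset.sum_sub_distrib,
    Finset.sum_mul]
  have e0 : (∑ x, ∑ i, v x * (u i * D i (D x f))) = ∑ x, ∑ i, u x * (v i * D i (D x f)) := by
    rw [Finset.sum_comm]
    exact Finset.sum_congr rfl fun i _ => Finset.sum_congr rfl fun j _ => by rw [hD]; ring
  have e1 (u v : Fin 4 → R) : (∑ x, ∑ i, D x f * (u i * D i (v x))) =
      ∑ x, ∑ i, u i * D i (v x) * D x f :=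
    Finset.sum_congr rfl fun i _ => Finset.sum_congr rfl fun j _ => by ring
  rw [e0, e1, e1]; ring

lemma dForm_formOf (hD : ∀ i j f, D i (D j f) = D j (D i f))
    (hx : ∀ i j, D i (x j) = if i = j then 1 else 0) (p u v : Fin 4 → R) :
    dForm (formOf x p) (fieldOf D u) (fieldOf D v) =
      ∑ i, ∑ j, u i * v j * (D i (p j) - D j (p i)) := by
  rw [dForm, lie_fieldOf hD]
  simp only [formOf_fieldOf hx, map_sum, Derivation.leibniz, smul_eq_mul, mul_sub,
    Finset.sum_add_distrib, Finset.sum_sub_distrib]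
  simp only [fieldOf_apply, Finset.mul_sum]
  rw [Finset.sum_comm (f := fun i j => u i * v j * D i (p j))]
  have e1 : (∑ i, ∑ j, v i * (u j * D j (p i))) = ∑ y, ∑ x, u x * v y * (D x) (p y) :=
    Finset.sum_congr rfl fun i _ => Finset.sum_congr rfl fun j _ => by ring
  have e2 : (∑ i, ∑ j, u i * (v j * D j (p i))) = ∑ x, ∑ y, u x * v y * (D y) (p x) :=
    Finset.sum_congr rfl fun i _ => Finset.sum_congr rfl fun j _ => by ring
  rw [e1, e2]; ring

end Gauge

/-- A metric with its Levi-Civita connection in coordinates `x`, together with an orthonormal frame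
in which the curvature has the canonical form of a type D vacuum metric. -/
structure CoordFrame (R : Type*) [CommRing R] [Algebra ℂ R] [StarRing R] where
  D : Fin 4 → Derivation ℂ R R
  x : Fin 4 → R
  D_comm : ∀ i j f, D i (D j f) = D j (D i f)
  D_x : ∀ i j, D i (x j) = if i = j then 1 else 0
  star_D : ∀ i f, star (D i f) = D i (star f)
  g : Matrix (Fin 4) (Fin 4) R
  Γ : Fin 4 → Matrix (Fin 4) (Fin 4) R
  E : Matrix (Fin 4) (Fin 4) R
  w : R
  isUnit_w : IsUnit w
  star_g : ∀ i j, star (g i j) = g i j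
  star_Γ : ∀ i j k, star (Γ i j k) = Γ i j k
  star_E : ∀ i j, star (E i j) = E i j
  g_symm : g.transpose = g
  Γ_symm : ∀ i j k, Γ i k j = Γ j k i
  compat : ∀ i, dMat (D i) g = (Γ i).transpose * g + g * Γ i
  ortho : E.transpose * g * E = Matrix.diagonal fun a => (mink a : R)
  curvature : ∀ a b c d, 2 * ∑ i, ∑ j, E i c * E j d *
    (E.transpose * g * curvMat D Γ i j * E) a b =
      typeDTensor R w a b c d + star (typeDTensor R w a b c d)

namespace CoordFrame

variable {R : Type*} [CommRing R] [Algebra ℂ R] [StarRing R] (C : CoordFrame R)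

/-- The Minkowski metric as a matrix. -/
def minkMat (R : Type*) [CommRing R] : Matrix (Fin 4) (Fin 4) R :=
  Matrix.diagonal fun a => (mink a : R)

lemma minkMat_sq {R : Type*} [CommRing R] : minkMat R * minkMat R = 1 := by
  rw [minkMat, Matrix.diagonal_mul_diagonal, ← Matrix.diagonal_one]
  congr 1; ext a; fin_cases a <;> simp [mink]

lemma left_inv : minkMat R * C.E.transpose * C.g * C.E = 1 := by
  rw [Matrix.mul_assoc, Matrix.mul_assoc, ← Matrix.mul_assoc C.E.transpose, C.ortho]
  exact minkMat_sq

lemma right_inv : C.E * (minkMat R * C.E.transpose * C.g) = 1 :=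
  mul_eq_one_comm.mp C.left_inv

/-- The connection forms. -/
def conn (i : Fin 4) : Matrix (Fin 4) (Fin 4) R :=
  C.E.transpose * C.g * (C.Γ i * C.E + dMat (C.D i) C.E)

lemma E_conn (i : Fin 4) : C.E * (minkMat R * C.conn i) = C.Γ i * C.E + dMat (C.D i) C.E := by
  calc C.E * (minkMat R * C.conn i)
      = C.E * (minkMat R * C.E.transpose * C.g) * (C.Γ i * C.E + dMat (C.D i) C.E) := by
        simp only [conn, Matrix.mul_assoc]
    _ = _ := by rw [C.right_inv, Matrix.one_mul]

/-- By compatibility with the metric, the derivative of the constant matrix $E^{\mathsf T}gE$ is the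
sum of `C.conn i` and its transpose. -/
lemma conn_antisymm (i : Fin 4) : (C.conn i).transpose = -C.conn i := by
  have h : dMat (C.D i) (C.E.transpose * C.g * C.E) = 0 := by
    rw [C.ortho]; ext a b
    simp only [dMat, Matrix.map_apply, Matrix.diagonal_apply, Matrix.zero_apply]
    split_ifs
    · exact (C.D i).map_intCast _
    · exact map_zero _
  rw [dMat_mul, dMat_mul, C.compat, dMat_transpose] at h
  rw [eq_neg_iff_add_eq_zero, ← h, conn]
  simp only [Matrix.transpose_mul, Matrix.transpose_add, Matrix.transpose_transpose, C.g_symm]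
  noncomm_ring

lemma minkMat_mul_conn_apply (i a b : Fin 4) :
    (minkMat R * C.conn i) a b = (mink a : R) * C.conn i a b := by
  rw [minkMat, Matrix.diagonal_mul]

/-- By `E_conn`, the matrices `minkMat R * C.conn i` are the gauge transforms of `C.Γ i` by `E`, so
`gauge_curvMat` applies. -/
lemma curvMat_conn (i j : Fin 4) :
    minkMat R * curvMat C.D (fun i => minkMat R * C.conn i) i j =
      C.E.transpose * C.g * curvMat C.D C.Γ i j * C.E := by
  have h := gauge_curvMat C.D C.D_comm _ C.Γ C.E C.E_conn i j
  have h2 := congrArg (fun A => C.E.transpose * C.g * A) h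
  simp only [← Matrix.mul_assoc, C.ortho] at h2
  exact h2

lemma minkMat_mul_curvMat_apply (i j a b : Fin 4) :
    (minkMat R * curvMat C.D (fun i => minkMat R * C.conn i) i j) a b =
      C.D i (C.conn j a b) - C.D j (C.conn i a b) +
        ∑ f, (mink f : R) * (C.conn i a f * C.conn j f b - C.conn j a f * C.conn i f b) := by
  have h1 : ∀ i j, minkMat R * (minkMat R * C.conn i * (minkMat R * C.conn j)) =
      C.conn i * (minkMat R * C.conn j) := fun i j => by
    simp only [← Matrix.mul_assoc, minkMat_sq, Matrix.one_mul]
  have h2 : ∀ i j, minkMat R * dMat (C.D i) (minkMat R * C.conn j) = dMat (C.D i) (C.conn j) := by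
    intro i j
    have : dMat (C.D i) (minkMat R) = 0 := by
      ext a b
      simp only [dMat, minkMat, Matrix.map_apply, Matrix.diagonal_apply, Matrix.zero_apply]
      split_ifs
      · exact (C.D i).map_intCast _
      · exact map_zero _
    rw [dMat_mul, this, Matrix.zero_mul, zero_add, ← Matrix.mul_assoc, minkMat_sq, Matrix.one_mul]
  rw [curvMat, Matrix.mul_add, Matrix.mul_sub, Matrix.mul_sub, h1, h1, h2, h2]
  simp only [Matrix.add_apply, Matrix.sub_apply, Matrix.mul_apply (M := C.conn _),
    minkMat_mul_conn_apply, ← Finset.sum_sub_distrib, dMat, Matrix.map_apply]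
  congr 1
  exact Finset.sum_congr rfl fun k _ => by ring

/-- The orthonormal frame and its connection forms. -/
def toOrthoFrame : OrthoFrame R where
  e a := fieldOf C.D fun i => C.E i a
  θ a b := formOf C.x fun i => C.conn i a b
  w := C.w
  isUnit_w := C.isUnit_w
  star_e a f := by simp [fieldOf_apply, C.star_D, C.star_E]
  star_θ a b c := by
    have : ∀ i, star (C.conn i a b) = C.conn i a b := fun i => by
      simp [conn, Matrix.mul_apply, C.star_E, C.star_g, C.star_Γ, dMat, C.star_D, mul_comm]
    simp [formOf_fieldOf C.D_x, C.star_E, this]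
  θ_antisymm a b := by
    ext X
    have this (i) : C.conn i a b = -C.conn i b a := by
      have := congrFun (congrFun (C.conn_antisymm i) b) a
      simpa using this
    simp only [formOf, LinearMap.coe_mk, AddHom.coe_mk, LinearMap.neg_apply,
      ← Finset.sum_neg_distrib]
    exact Finset.sum_congr rfl fun i _ => by rw [this i]; ring
  torsion c d := by
    rw [lie_fieldOf C.D_comm]
    have key (c d j : Fin 4) : fieldOf C.D (fun i => C.E i c) (C.E j d) =
        ∑ i, C.E i c * (∑ a, C.E j a * ((mink a : R) * C.conn i a d)
          - ∑ k, C.Γ i j k * C.E k d) := by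
      rw [fieldOf_apply]
      refine Finset.sum_congr rfl fun i _ => ?_
      have := congrFun (congrFun (C.E_conn i) j) d
      rw [Matrix.add_apply, Matrix.mul_apply, Matrix.mul_apply] at this
      simp only [minkMat_mul_conn_apply, dMat, Matrix.map_apply] at this
      rw [this]; ring
    -- The symmetry of `Γ` in its lower indices, the only place where the vanishing of the torsion
    -- in coordinates enters.
    have sym (c d j : Fin 4) : ∑ i, C.E i c * ∑ k, C.Γ i j k * C.E k d =
        ∑ i, C.E i d * ∑ k, C.Γ i j k * C.E k c := by
      simp only [Finset.mul_sum]
      rw [Finset.sum_comm]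
      refine Finset.sum_congr rfl fun i _ => Finset.sum_congr rfl fun k _ => ?_
      rw [C.Γ_symm]; ring
    have key2 (j : Fin 4) : fieldOf C.D (fun i => C.E i c) (C.E j d)
        - fieldOf C.D (fun i => C.E i d) (C.E j c) =
        ∑ a, C.E j a * ((mink a : R) * ((∑ i, C.conn i a d * C.E i c)
          - ∑ i, C.conn i a c * C.E i d)) := by
      rw [key, key]
      simp only [mul_sub, Finset.sum_sub_distrib]
      rw [sym d c]
      simp only [Fin.sum_univ_four]
      ring
    have key3 (k : Fin 4 → R) : fieldOf C.D (fun j => ∑ a, C.E j a * k a) =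
        ∑ a, k a • fieldOf C.D (fun i => C.E i a) := by
      ext f
      simp only [fieldOf_apply, Fin.sum_univ_four, Derivation.add_apply, Derivation.smul_apply,
        smul_eq_mul]
      ring
    simp only [key2, key3, formOf_fieldOf C.D_x]
  curvature a b c d := by
    rw [← C.curvature, Omega, dForm_formOf C.D_comm C.D_x]
    simp only [formOf_fieldOf C.D_x, ← curvMat_conn, minkMat_mul_curvMat_apply, Fin.sum_univ_four]
    ring

end CoordFrame

/-! ### The algebra of smooth functions on an open set -/

section SmoothAlgebra

open TopologicalSpace

/-- The extension by zero of a function on an open set. -/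
def extZero {V : Opens E4} (f : V → ℂ) (y : E4) : ℂ :=
  open Classical in if h : y ∈ V then f ⟨y, h⟩ else 0

lemma extZero_of_mem {V : Opens E4} (f : V → ℂ) {y : E4} (h : y ∈ V) : extZero f y = f ⟨y, h⟩ := by
  simp [extZero, h]

lemma extZero_coe {V : Opens E4} (f : V → ℂ) (y : V) : extZero f y = f y :=
  extZero_of_mem f y.2

lemma contDiffOn_extZero {V : Opens E4} {f : V → ℂ} {F : E4 → ℂ} (hF : ContDiffOn ℝ ∞ F V)
    (h : ∀ y : V, f y = F y) : ContDiffOn ℝ ∞ (extZero f) V :=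
  hF.congr fun y hy => by rw [extZero_of_mem f hy, h]

/-- The algebra of smooth complex functions on an open set. -/
def smoothAlg (V : Opens E4) : StarSubalgebra ℂ (V → ℂ) where
  carrier := {f | ContDiffOn ℝ ∞ (extZero f) V}
  mul_mem' {f g} hf hg := contDiffOn_extZero (ContDiffOn.mul hf hg) fun y => by
    simp [extZero_coe]
  add_mem' {f g} hf hg := contDiffOn_extZero (ContDiffOn.add hf hg) fun y => by
    simp [extZero_coe]
  algebraMap_mem' c := contDiffOn_extZero (F := fun _ => c) contDiffOn_const fun y => rfl
  star_mem' {f} hf := by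
    refine contDiffOn_extZero (F := fun y => Complex.conjCLE (extZero f y))
      (Complex.conjCLE.contDiff.comp_contDiffOn hf) fun y => ?_
    simp [extZero_coe]

variable {V : Opens E4}

lemma smooth_differentiableAt (f : smoothAlg V) (y : V) :
    DifferentiableAt ℝ (extZero f.1) y :=
  (f.2.contDiffAt (V.2.mem_nhds y.2)).differentiableAt (by simp)

lemma extZero_eventuallyEq {f : V → ℂ} {F : E4 → ℂ} (h : ∀ y : V, f y = F y) (y : V) :
    extZero f =ᶠ[nhds (y : E4)] F := by
  filter_upwards [V.2.mem_nhds y.2] with z hz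
  rw [extZero_of_mem f hz, h]

lemma fderiv_extZero_congr {f : V → ℂ} {F : E4 → ℂ} (h : ∀ y : V, f y = F y) (y : V) :
    fderiv ℝ (extZero f) y = fderiv ℝ F y :=
  (extZero_eventuallyEq h y).fderiv_eq

/-- The partial derivatives of smooth functions. -/
def pdFun (i : Fin 4) (f : V → ℂ) (y : V) : ℂ := fderiv ℝ (extZero f) y (EuclideanSpace.single i 1)

lemma pdFun_mem (i : Fin 4) (f : smoothAlg V) : pdFun i f.1 ∈ smoothAlg V := by
  refine contDiffOn_extZero
    (F := fun y => fderiv ℝ (extZero f.1) y (EuclideanSpace.single i 1)) ?_ fun y => rfl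
  exact (f.2.fderiv_of_isOpen V.2 (m := ∞) (by simp)).clm_apply contDiffOn_const

lemma pdFun_add (i : Fin 4) (f g : smoothAlg V) (y : V) :
    pdFun i (f.1 + g.1) y = pdFun i f.1 y + pdFun i g.1 y := by
  rw [pdFun, fderiv_extZero_congr (F := extZero f.1 + extZero g.1)
      (fun y => by simp [extZero_coe]) y,
    fderiv_add (smooth_differentiableAt f y) (smooth_differentiableAt g y)]
  rfl

lemma pdFun_smul (i : Fin 4) (c : ℂ) (f : smoothAlg V) (y : V) :
    pdFun i (c • f.1) y = c • pdFun i f.1 y := by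
  rw [pdFun, fderiv_extZero_congr (F := c • extZero f.1)
      (fun y => by simp [extZero_coe]) y, fderiv_const_smul (smooth_differentiableAt f y)]
  rfl

lemma pdFun_mul (i : Fin 4) (f g : smoothAlg V) (y : V) :
    pdFun i (f.1 * g.1) y = f.1 y * pdFun i g.1 y + g.1 y * pdFun i f.1 y := by
  rw [pdFun, fderiv_extZero_congr (F := extZero f.1 * extZero g.1)
      (fun y => by simp [extZero_coe]) y,
    fderiv_mul (smooth_differentiableAt f y) (smooth_differentiableAt g y)]
  simp [extZero_coe, pdFun]

lemma pdFun_one (i : Fin 4) (y : V) : pdFun i (1 : V → ℂ) y = 0 := by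
  rw [pdFun, fderiv_extZero_congr (f := 1) (F := fun _ => 1) (fun y => rfl) y]
  simp

/-- The partial derivatives as derivations. -/
def pdDer (V : Opens E4) (i : Fin 4) : Derivation ℂ (smoothAlg V) (smoothAlg V) where
  toFun f := ⟨pdFun i f.1, pdFun_mem i f⟩
  map_add' f g := Subtype.ext (funext fun y => pdFun_add i f g y)
  map_smul' c f := Subtype.ext (funext fun y => pdFun_smul i c f y)
  map_one_eq_zero' := Subtype.ext (funext fun y => pdFun_one i y)
  leibniz' f g := Subtype.ext (funext fun y => pdFun_mul i f g y)

lemma pdDer_apply (i : Fin 4) (f : smoothAlg V) (y : V) :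
    (pdDer V i f).1 y = fderiv ℝ (extZero f.1) y (EuclideanSpace.single i 1) := rfl

lemma pdDer_eq {i : Fin 4} {f : smoothAlg V} {F : E4 → ℂ} (h : ∀ y : V, f.1 y = F y) (y : V) :
    (pdDer V i f).1 y = fderiv ℝ F y (EuclideanSpace.single i 1) := by
  rw [pdDer_apply, fderiv_extZero_congr h]

lemma pdDer_comm (i j : Fin 4) (f : smoothAlg V) :
    pdDer V i (pdDer V j f) = pdDer V j (pdDer V i f) := by
  ext y
  have key (i j : Fin 4) : (pdDer V i (pdDer V j f)).1 y =
      fderiv ℝ (fderiv ℝ (extZero f.1)) y (EuclideanSpace.single i 1)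
        (EuclideanSpace.single j 1) := by
    rw [pdDer_eq (F := fun z => fderiv ℝ (extZero f.1) z (EuclideanSpace.single j 1))
      (fun z => rfl)]
    have hd : DifferentiableAt ℝ (fderiv ℝ (extZero f.1)) y :=
      ((f.2.fderiv_of_isOpen V.2 (m := ∞) (by simp)).contDiffAt
        (V.2.mem_nhds y.2)).differentiableAt (by simp)
    rw [fderiv_clm_apply hd (differentiableAt_const _)]
    simp
  rw [key, key]
  have hs : IsSymmSndFDerivAt ℝ (extZero f.1) y :=
    (f.2.contDiffAt (V.2.mem_nhds y.2)).isSymmSndFDerivAt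
      (by rw [minSmoothness_of_isRCLikeNormedField]; exact WithTop.coe_le_coe.mpr le_top)
  exact hs _ _

lemma star_pdDer (i : Fin 4) (f : smoothAlg V) : star (pdDer V i f) = pdDer V i (star f) := by
  ext y
  have h := pdDer_eq (i := i) (f := star f) (F := fun z => Complex.conjCLE (extZero f.1 z))
    (fun y => by simp [extZero_coe]) y
  rw [h]
  have h2 := (Complex.conjCLE.toContinuousLinearMap.hasFDerivAt.comp (y : E4)
    (smooth_differentiableAt f y).hasFDerivAt).fderiv
  change _ = fderiv ℝ (⇑Complex.conjCLE.toContinuousLinearMap ∘ extZero f.1) y _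
  rw [h2]
  rfl

/-- A smooth real function as an element of the algebra of smooth complex functions. -/
def ofRealFun (F : E4 → ℝ) (hF : ContDiffOn ℝ ∞ F V) : smoothAlg V :=
  ⟨fun y => (F y : ℂ), contDiffOn_extZero (F := fun y => (F y : ℂ))
    (Complex.ofRealCLM.contDiff.comp_contDiffOn hF) fun _ => rfl⟩

lemma ofRealFun_apply (F : E4 → ℝ) (hF : ContDiffOn ℝ ∞ F V) (y : V) :
    (ofRealFun F hF).1 y = (F y : ℂ) := rfl

lemma star_ofRealFun (F : E4 → ℝ) (hF : ContDiffOn ℝ ∞ F V) :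
    star (ofRealFun F hF) = ofRealFun F hF := by
  ext y
  exact Complex.conj_ofReal _

lemma contDiffOn_pd {F : E4 → ℝ} (hF : ContDiffOn ℝ ∞ F V) (i : Fin 4) :
    ContDiffOn ℝ ∞ (pd i F) V :=
  (hF.fderiv_of_isOpen V.2 (m := ∞) (by simp)).clm_apply contDiffOn_const

lemma pdDer_ofRealFun (i : Fin 4) (F : E4 → ℝ) (hF : ContDiffOn ℝ ∞ F V) :
    pdDer V i (ofRealFun F hF) = ofRealFun (pd i F) (contDiffOn_pd hF i) := by
  ext y
  rw [pdDer_eq (F := fun z => (F z : ℂ)) (fun z => rfl)]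
  have hd : DifferentiableAt ℝ F y := (hF.contDiffAt (V.2.mem_nhds y.2)).differentiableAt (by simp)
  have h2 := (Complex.ofRealCLM.hasFDerivAt.comp (y : E4) hd.hasFDerivAt).fderiv
  change fderiv ℝ (⇑Complex.ofRealCLM ∘ F) y _ = _
  rw [h2]
  rfl

/-- The coordinate functions. -/
def coordFun (V : Opens E4) (i : Fin 4) : smoothAlg V :=
  ofRealFun (fun y => y i) (by fun_prop)

lemma pdDer_coordFun (i j : Fin 4) : pdDer V i (coordFun V j) = if i = j then 1 else 0 := by
  ext y
  rw [coordFun, pdDer_ofRealFun, ofRealFun_apply]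
  have : pd i (fun z : E4 => z j) y = if i = j then 1 else 0 := by
    have h := (EuclideanSpace.proj (𝕜 := ℝ) (ι := Fin 4) j).hasFDerivAt
      (x := (y : E4)) |>.fderiv
    have e : (fun z : E4 => z j) = ⇑(EuclideanSpace.proj (𝕜 := ℝ) (ι := Fin 4) j) :=
      rfl
    rw [pd, e, h]
    simp [eq_comm]
  rw [this]
  split_ifs <;> simp

/-- A closed linear system of differential equations of first order on a convex open set: if its
unknowns vanish at one point, then they vanish everywhere. -/
lemma eq_zero_of_closed_system (hV : Convex ℝ (V : Set E4)) {n : ℕ} (f : Fin n → smoothAlg V)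
    (hf : ∀ i j, pdDer V i (f j) ∈ Ideal.span (Set.range f)) (y₀ : V) (h0 : ∀ j, (f j).1 y₀ = 0)
    (j : Fin n) : f j = 0 := by
  -- Membership in the ideal gives coefficients with which the partial derivatives are linear
  -- combinations of the unknowns.
  have hB : ∀ i j, ∃ B : Fin n → smoothAlg V, ∑ l, B l * f l = pdDer V i (f j) := fun i j =>
    Ideal.mem_span_range_iff_exists_fun.mp (hf i j)
  choose B hB using hB
  ext y
  -- On the segment from `y₀` to `y`, which lies in the convex set, the unknowns satisfy a linear
  -- ordinary differential equation. Its coefficients are bounded by compactness, so $\|F'\|\le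
  -- K\|F\|$ with $F(0)=0$, and Grönwall's inequality gives $F=0$.
  set u : E4 := (y : E4) - y₀ with hu
  set c : ℝ → E4 := fun t => (y₀ : E4) + t • u with hc
  have hcV : ∀ t ∈ Set.Icc (0 : ℝ) 1, c t ∈ V := fun t ht => by
    have : c t = AffineMap.lineMap (y₀ : E4) (y : E4) t := by
      simp [hc, hu, AffineMap.lineMap_apply, add_comm]
    rw [this]
    exact hV.segment_subset y₀.2 y.2 (by
      rw [segment_eq_image_lineMap]; exact ⟨t, ht, rfl⟩)
  have hcc : Continuous c := by fun_prop
  have hcont (h : smoothAlg V) : ContinuousOn (fun t => extZero h.1 (c t)) (Set.Icc 0 1) :=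
    h.2.continuousOn.comp hcc.continuousOn hcV
  set F : ℝ → Fin n → ℂ := fun t j => extZero (f j).1 (c t) with hF
  set F' : ℝ → Fin n → ℂ := fun t j => fderiv ℝ (extZero (f j).1) (c t) u with hF'
  have hder : ∀ t ∈ Set.Icc (0 : ℝ) 1, HasDerivAt F (F' t) t := fun t ht => by
    rw [hasDerivAt_pi]
    intro j
    have h1 := (smooth_differentiableAt (f j) ⟨c t, hcV t ht⟩).hasFDerivAt
    have h2 : HasDerivAt c u t := by
      have := ((hasDerivAt_id t).smul_const u).const_add (y₀ : E4)
      rwa [one_smul] at this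
    exact h1.comp_hasDerivAt t h2
  have hu_sum : u = ∑ i, u i • (EuclideanSpace.single i (1 : ℝ) : E4) := by
    ext k; simp [Pi.single_apply]
  have hF'_eq : ∀ t ∈ Set.Icc (0 : ℝ) 1, ∀ j, F' t j =
      ∑ i, ∑ l, (u i : ℂ) * extZero (B i j l).1 (c t) * F t l := fun t ht j => by
    have : F' t j = ∑ i, (u i : ℂ) *
        fderiv ℝ (extZero (f j).1) (c t) (EuclideanSpace.single i 1) := by
      simp only [hF']
      conv_lhs => rw [hu_sum, map_sum]
      simp
    rw [this]
    refine Finset.sum_congr rfl fun i _ => ?_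
    have h1 := pdDer_apply i (f j) ⟨c t, hcV t ht⟩
    rw [← hB] at h1
    simp only at h1
    rw [← h1, AddSubmonoidClass.coe_finsetSum, Finset.sum_apply, Finset.mul_sum]
    refine Finset.sum_congr rfl fun l _ => ?_
    simp only [hF]
    rw [extZero_of_mem (B i j l).1 (hcV t ht), extZero_of_mem (f l).1 (hcV t ht), mul_assoc]
    rfl
  -- The sum also runs over `j`, so that one constant bounds all components in the supremum norm.
  obtain ⟨K, hK⟩ : ∃ K, ∀ t ∈ Set.Icc (0 : ℝ) 1,
      ‖∑ j, ∑ i, ∑ l, ‖(u i : ℂ) * extZero (B i j l).1 (c t)‖‖ ≤ K := by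
    refine isCompact_Icc.exists_bound_of_continuousOn ?_
    exact continuousOn_finsetSum _ fun j _ => continuousOn_finsetSum _ fun i _ =>
      continuousOn_finsetSum _ fun l _ => (continuousOn_const.mul (hcont _)).norm
  have hnorm : ∀ t ∈ Set.Icc (0 : ℝ) 1, ‖F' t‖ ≤ K * ‖F t‖ := fun t ht => by
    have hK0 : 0 ≤ K := (norm_nonneg _).trans (hK t ht)
    refine (pi_norm_le_iff_of_nonneg (by positivity)).mpr fun j => ?_
    rw [hF'_eq t ht]
    calc ‖∑ i, ∑ l, (u i : ℂ) * extZero (B i j l).1 (c t) * F t l‖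
        ≤ ∑ i, ∑ l, ‖(u i : ℂ) * extZero (B i j l).1 (c t)‖ * ‖F t‖ := by
          refine (norm_sum_le _ _).trans (Finset.sum_le_sum fun i _ => ?_)
          refine (norm_sum_le _ _).trans (Finset.sum_le_sum fun l _ => ?_)
          rw [norm_mul]
          exact mul_le_mul_of_nonneg_left (norm_le_pi_norm _ _) (norm_nonneg _)
      _ = (∑ i, ∑ l, ‖(u i : ℂ) * extZero (B i j l).1 (c t)‖) * ‖F t‖ := by
          simp only [Finset.sum_mul]
      _ ≤ K * ‖F t‖ := by
          refine mul_le_mul_of_nonneg_right ?_ (norm_nonneg _)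
          refine le_trans ?_ ((le_abs_self _).trans (hK t ht))
          exact Finset.single_le_sum
            (f := fun j => ∑ i, ∑ l, ‖(u i : ℂ) * extZero (B i j l).1 (c t)‖)
            (fun j _ => by positivity) (Finset.mem_univ j)
  have hzero := eq_zero_of_abs_deriv_le_mul_abs_self_of_eq_zero_right (f := F) (f' := F') (K := K)
    (a := 0) (b := 1) (fun t ht => (hder t ht).continuousAt.continuousWithinAt)
    (fun t ht => (hder t (Set.Ico_subset_Icc_self ht)).hasDerivWithinAt)
    (by
      ext j
      simp only [hF, hc, zero_smul, add_zero, Pi.zero_apply]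
      rw [extZero_coe, h0])
    (fun t ht => hnorm t (Set.Ico_subset_Icc_self ht)) 1 (by simp)
  have h1 := congrFun hzero j
  simp only [hF, hc, hu, one_smul, add_sub_cancel, Pi.zero_apply] at h1
  rw [extZero_coe] at h1
  exact h1

end SmoothAlgebra

/-! ### Covariance of the algebraic constructions -/

section Covariance

open Matrix

/-- The pull-back of a covariant 2-tensor. -/
def pull2 {R : Type} [CommRing R] (E A : Tensor2 R) : Tensor2 R := Eᵀ * A * E

/-- The pull-back of a covariant 4-tensor. -/
def pull4 {R : Type} [CommRing R] (E : Tensor2 R) (T : Tensor4 R) : Tensor4 R := fun a b c d =>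
  ∑ i, ∑ j, ∑ k, ∑ l, E i a * E j b * (E k c * E l d * T i j k l)

lemma sum4_comm_prod {M : Type*} [AddCommMonoid M] (f : Fin 4 → Fin 4 → Fin 4 → Fin 4 → M) :
    ∑ i, ∑ j, ∑ k, ∑ l, f i j k l = ∑ k, ∑ l, ∑ i, ∑ j, f i j k l := by
  calc ∑ i, ∑ j, ∑ k, ∑ l, f i j k l = ∑ i, ∑ k, ∑ j, ∑ l, f i j k l :=
        Finset.sum_congr rfl fun i _ => Finset.sum_comm
    _ = ∑ k, ∑ i, ∑ j, ∑ l, f i j k l := Finset.sum_comm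
    _ = ∑ k, ∑ i, ∑ l, ∑ j, f i j k l := Finset.sum_congr rfl fun k _ =>
        Finset.sum_congr rfl fun i _ => Finset.sum_comm
    _ = _ := Finset.sum_congr rfl fun k _ => Finset.sum_comm

lemma sum4_comm_cross {M : Type*} [AddCommMonoid M] (f : Fin 4 → Fin 4 → Fin 4 → Fin 4 → M) :
    ∑ i, ∑ j, ∑ k, ∑ l, f i j k l = ∑ j, ∑ l, ∑ i, ∑ k, f i j k l := by
  calc ∑ i, ∑ j, ∑ k, ∑ l, f i j k l = ∑ j, ∑ i, ∑ k, ∑ l, f i j k l := Finset.sum_comm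
    _ = ∑ j, ∑ i, ∑ l, ∑ k, f i j k l := Finset.sum_congr rfl fun k _ =>
        Finset.sum_congr rfl fun i _ => Finset.sum_comm
    _ = _ := Finset.sum_congr rfl fun k _ => Finset.sum_comm

lemma sum4_comm_cross' {M : Type*} [AddCommMonoid M] (f : Fin 4 → Fin 4 → Fin 4 → Fin 4 → M) :
    ∑ i, ∑ j, ∑ k, ∑ l, f i j k l = ∑ j, ∑ k, ∑ i, ∑ l, f i j k l := by
  calc ∑ i, ∑ j, ∑ k, ∑ l, f i j k l = ∑ j, ∑ i, ∑ k, ∑ l, f i j k l := Finset.sum_comm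
    _ = _ := Finset.sum_congr rfl fun k _ => Finset.sum_comm

section

variable {R : Type} [CommRing R]

lemma pull2_apply (E A : Tensor2 R) (a b : Fin 4) :
    pull2 E A a b = ∑ i, ∑ j, E i a * E j b * A i j := by
  simp only [pull2, Matrix.mul_apply, Matrix.transpose_apply, Finset.sum_mul]
  rw [Finset.sum_comm]
  exact Finset.sum_congr rfl fun i _ => Finset.sum_congr rfl fun j _ => by ring

lemma pull2_sub (E A B : Tensor2 R) : pull2 E (A - B) = pull2 E A - pull2 E B := by
  simp only [pull2]; noncomm_ring

lemma pull2_smul (E A : Tensor2 R) (r : R) : pull2 E (r • A) = r • pull2 E A := by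
  simp only [pull2, Matrix.mul_smul, Matrix.smul_mul]

lemma pull2_pull2 (E F A : Tensor2 R) : pull2 E (pull2 F A) = pull2 (F * E) A := by
  simp only [pull2, Matrix.transpose_mul, Matrix.mul_assoc]

lemma pull4_prod (E A B : Tensor2 R) :
    pull4 E (fun a b c d => A a b * B c d) = fun a b c d => pull2 E A a b * pull2 E B c d := by
  ext a b c d
  simp only [pull4, pull2_apply, Finset.sum_mul, Finset.mul_sum]
  rw [sum4_comm_prod]
  exact Finset.sum_congr rfl fun i _ => Finset.sum_congr rfl fun j _ =>
    Finset.sum_congr rfl fun k _ => Finset.sum_congr rfl fun l _ => by ring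

lemma pull4_cross (E A B : Tensor2 R) :
    pull4 E (fun a b c d => A a c * B b d) = fun a b c d => pull2 E A a c * pull2 E B b d := by
  ext a b c d
  simp only [pull4, pull2_apply, Finset.sum_mul, Finset.mul_sum]
  rw [sum4_comm_cross]
  exact Finset.sum_congr rfl fun i _ => Finset.sum_congr rfl fun j _ =>
    Finset.sum_congr rfl fun k _ => Finset.sum_congr rfl fun l _ => by ring

lemma pull4_cross' (E A B : Tensor2 R) :
    pull4 E (fun a b c d => A a d * B b c) = fun a b c d => pull2 E A a d * pull2 E B b c := by
  ext a b c d
  simp only [pull4, pull2_apply, Finset.sum_mul, Finset.mul_sum]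
  rw [sum4_comm_cross']
  exact Finset.sum_congr rfl fun i _ => Finset.sum_congr rfl fun j _ =>
    Finset.sum_congr rfl fun k _ => Finset.sum_congr rfl fun l _ => by ring

lemma pull4_add (E : Tensor2 R) (S T : Tensor4 R) :
    pull4 E (fun a b c d => S a b c d + T a b c d) =
      fun a b c d => pull4 E S a b c d + pull4 E T a b c d := by
  ext a b c d
  simp only [pull4, mul_add, Finset.sum_add_distrib]

lemma pull4_sub (E : Tensor2 R) (S T : Tensor4 R) :
    pull4 E (fun a b c d => S a b c d - T a b c d) =
      fun a b c d => pull4 E S a b c d - pull4 E T a b c d := by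
  ext a b c d
  simp only [pull4, mul_sub, Finset.sum_sub_distrib]

lemma pull4_smul (E : Tensor2 R) (r : R) (T : Tensor4 R) :
    pull4 E (fun a b c d => r * T a b c d) = fun a b c d => r * pull4 E T a b c d := by
  ext a b c d
  simp only [pull4, Finset.mul_sum]
  exact Finset.sum_congr rfl fun i _ => Finset.sum_congr rfl fun j _ =>
    Finset.sum_congr rfl fun k _ => Finset.sum_congr rfl fun l _ => by ring

lemma of_pull4 (E : Tensor2 R) (T : Tensor4 R) (a b : Fin 4) :
    Matrix.of (pull4 E T a b) = ∑ i, ∑ j, (E i a * E j b) • pull2 E (Matrix.of (T i j)) := by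
  ext c d
  simp only [pull4, Matrix.of_apply, Matrix.sum_apply, Matrix.smul_apply, smul_eq_mul, pull2_apply,
    Finset.mul_sum]

end

/-- The complex matrix with the same entries as a real one. -/
def toC (A : Tensor2 ℝ) : Tensor2 ℂ := A.map (fun x => (x : ℂ))

/-- The complex 4-tensor with the same components as a real one. -/
def toC4 (T : Tensor4 ℝ) : Tensor4 ℂ := fun a b c d => (T a b c d : ℂ)

lemma toC_apply (A : Tensor2 ℝ) (a b : Fin 4) : toC A a b = A a b := rfl

lemma toC_mul (A B : Tensor2 ℝ) : toC (A * B) = toC A * toC B := by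
  ext a b; simp only [toC_apply, Matrix.mul_apply]; push_cast; rfl

lemma toC_transpose (A : Tensor2 ℝ) : toC Aᵀ = (toC A)ᵀ := rfl

lemma toC_pull2 (E A : Tensor2 ℝ) : toC (pull2 E A) = pull2 (toC E) (toC A) := by
  rw [pull2, toC_mul, toC_mul, toC_transpose, pull2]

lemma toC4_pull4 (E : Tensor2 ℝ) (T : Tensor4 ℝ) : toC4 (pull4 E T) = pull4 (toC E) (toC4 T) := by
  ext a b c d; simp only [toC4, toC_apply, pull4]; push_cast; rfl

/-- Written as a trace, the Hodge dual changes with the basis in a way that the cyclicity of the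
trace controls (`trace_pull2`). -/
lemma hodge_eq (g F : Tensor2 ℝ) (η : Tensor4 ℝ) (a b : Fin 4) :
    hodge g η F a b = 1 / 2 * (Matrix.of (η a b) * (g⁻¹ * F * g⁻¹ᵀ)ᵀ).trace := by
  simp only [hodge, Matrix.trace, Matrix.diag_apply, Matrix.mul_apply, Matrix.transpose_apply,
    Finset.sum_mul, Finset.mul_sum, Matrix.of_apply]
  refine Finset.sum_congr rfl fun c _ => Finset.sum_congr rfl fun d _ => ?_
  rw [Finset.sum_comm]
  exact Finset.sum_congr rfl fun i _ => Finset.sum_congr rfl fun j _ => by ring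

lemma inv_pull2 (g : Tensor2 ℝ) {E : Tensor2 ℝ} (hE : IsUnit E.det) :
    E * (pull2 E g)⁻¹ * Eᵀ = g⁻¹ := by
  have h1 : E * E⁻¹ = 1 := Matrix.mul_nonsing_inv E hE
  have h2 : (Eᵀ)⁻¹ * Eᵀ = 1 := Matrix.nonsing_inv_mul _ (by rwa [Matrix.det_transpose])
  rw [pull2, Matrix.mul_inv_rev, Matrix.mul_inv_rev]
  calc E * (E⁻¹ * (g⁻¹ * Eᵀ⁻¹)) * Eᵀ = (E * E⁻¹) * g⁻¹ * (Eᵀ⁻¹ * Eᵀ) := by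
        simp only [Matrix.mul_assoc]
    _ = g⁻¹ := by rw [h1, h2, Matrix.one_mul, Matrix.mul_one]

lemma inv_pull2_transpose (g : Tensor2 ℝ) {E : Tensor2 ℝ} (hE : IsUnit E.det) :
    E * ((pull2 E g)⁻¹)ᵀ * Eᵀ = (g⁻¹)ᵀ := by
  rw [← inv_pull2 g hE]
  simp only [Matrix.transpose_mul, Matrix.transpose_transpose, Matrix.mul_assoc]

lemma pull2_injective {E A B : Tensor2 ℝ} (hE : IsUnit E.det) (h : pull2 E A = pull2 E B) :
    A = B := by
  have h1 : E * E⁻¹ = 1 := Matrix.mul_nonsing_inv E hE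
  have e (A : Tensor2 ℝ) : A = pull2 E⁻¹ (pull2 E A) := by
    rw [pull2_pull2, h1, pull2]; simp
  rw [e A, e B, h]

lemma trace_pull2 {R : Type} [CommRing R] {E G H G' H' : Tensor2 R} (hG : E * G' * Eᵀ = G)
    (hH : E * H' * Eᵀ = H) (T F : Tensor2 R) :
    (pull2 E T * G' * (pull2 E F)ᵀ * H').trace = (T * G * Fᵀ * H).trace := by
  rw [← hG, ← hH]
  have : pull2 E T * G' * (pull2 E F)ᵀ * H' = Eᵀ * (T * E * G' * (pull2 E F)ᵀ * H') := by
    simp only [pull2, Matrix.mul_assoc]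
  rw [this, Matrix.trace_mul_comm]
  simp only [pull2, Matrix.mul_assoc, Matrix.transpose_mul, Matrix.transpose_transpose]

lemma hodge_pull (g : Tensor2 ℝ) (η : Tensor4 ℝ) {E : Tensor2 ℝ} (F : Tensor2 ℝ)
    (hE : IsUnit E.det) :
    hodge (pull2 E g) (pull4 E η) (pull2 E F) = pull2 E (hodge g η F) := by
  ext a b
  have key (T : Tensor2 ℝ) :
      (pull2 E T * ((pull2 E g)⁻¹ * pull2 E F * (pull2 E g)⁻¹ᵀ)ᵀ).trace =
        (T * (g⁻¹ * F * g⁻¹ᵀ)ᵀ).trace := by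
    have h := trace_pull2 (inv_pull2 g hE) (inv_pull2_transpose g hE) T F
    simp only [Matrix.transpose_mul, Matrix.transpose_transpose, Matrix.mul_assoc] at h ⊢
    exact h
  rw [hodge_eq, of_pull4, Matrix.sum_mul, Matrix.trace_sum, pull2_apply]
  simp only [Matrix.sum_mul, Matrix.trace_sum, Matrix.smul_mul, Matrix.trace_smul, key, hodge_eq,
    Finset.mul_sum, smul_eq_mul]
  exact Finset.sum_congr rfl fun i _ => Finset.sum_congr rfl fun j _ => by ring

/-- The Hodge dual as a linear map. -/
def hodgeLin (g : Tensor2 ℝ) (η : Tensor4 ℝ) : Tensor2 ℝ →ₗ[ℝ] Tensor2 ℝ where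
  toFun := hodge g η
  map_add' A B := by
    ext a b
    simp only [hodge_eq, Matrix.mul_add, Matrix.add_mul, Matrix.transpose_add, Matrix.trace_add,
      Matrix.add_apply]
    ring
  map_smul' r A := by
    ext a b
    simp only [hodge_eq, Matrix.mul_smul, Matrix.smul_mul, Matrix.transpose_smul,
      Matrix.trace_smul, Matrix.smul_apply, smul_eq_mul, RingHom.id_apply]
    ring

lemma hodge4_pull (g : Tensor2 ℝ) (η W : Tensor4 ℝ) {E : Tensor2 ℝ} (hE : IsUnit E.det) :
    hodge4 (pull2 E g) (pull4 E η) (pull4 E W) = pull4 E (hodge4 g η W) := by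
  have h1 (c d : Fin 4) : (Matrix.of fun e f => pull4 E W e f c d) =
      pull2 E (∑ k, ∑ l, (E k c * E l d) • Matrix.of fun i j => W i j k l) := by
    ext e f
    simp only [pull4, pull2_apply, Finset.mul_sum, Matrix.sum_apply, Matrix.smul_apply,
      smul_eq_mul, Matrix.of_apply]
  ext a b c d
  change hodgeLin (pull2 E g) (pull4 E η) (Matrix.of fun e f => pull4 E W e f c d) a b = _
  rw [h1]
  change hodge (pull2 E g) (pull4 E η) _ a b = _
  rw [hodge_pull g η _ hE]
  change pull2 E (hodgeLin g η _) a b = _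
  simp only [map_sum, map_smul, pull2_apply, pull4, Matrix.sum_apply, Matrix.smul_apply,
      smul_eq_mul, Finset.mul_sum]
  rfl

lemma bigG_pull (g E : Tensor2 ℝ) : bigG (pull2 E g) = pull4 E (bigG g) := by
  have : bigG g = fun a b c d => g a c * g b d - g a d * g b c := rfl
  rw [this, pull4_sub E (fun a b c d => g a c * g b d), pull4_cross, pull4_cross']
  rfl

/-- The self-dual 2-form `U - i *U`. -/
def sd (g : Tensor2 ℝ) (η : Tensor4 ℝ) (U : Tensor2 ℝ) : Tensor2 ℂ :=
  toC U - Complex.I • toC (hodge g η U)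

lemma sd_apply (g : Tensor2 ℝ) (η : Tensor4 ℝ) (U : Tensor2 ℝ) (a b : Fin 4) :
    sd g η U a b = U a b - Complex.I * hodge g η U a b := rfl

lemma sd_pull (g : Tensor2 ℝ) (η : Tensor4 ℝ) {E : Tensor2 ℝ} (U : Tensor2 ℝ)
    (hE : IsUnit E.det) :
    sd (pull2 E g) (pull4 E η) (pull2 E U) = pull2 (toC E) (sd g η U) := by
  rw [sd, hodge_pull g η U hE, toC_pull2, toC_pull2, sd, pull2_sub, pull2_smul]

/-- The self-dual tensor of type D with eigenvalue `w`. -/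
def typeDForm (g : Tensor2 ℝ) (η : Tensor4 ℝ) (w : ℂ) (U : Tensor2 ℝ) : Tensor4 ℂ :=
  fun a b c d => w * (3 * (sd g η U a b * sd g η U c d) + ((toC4 (bigG g)) a b c d
      - Complex.I * (toC4 η) a b c d))

lemma typeDForm_pull (g : Tensor2 ℝ) (η : Tensor4 ℝ) (w : ℂ) {E : Tensor2 ℝ} (U : Tensor2 ℝ)
    (hE : IsUnit E.det) :
    typeDForm (pull2 E g) (pull4 E η) w (pull2 E U) = pull4 (toC E) (typeDForm g η w U) := by
  unfold typeDForm
  rw [sd_pull g η U hE, bigG_pull, toC4_pull4, toC4_pull4,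
    pull4_smul (toC E) w (fun a b c d => (3 * (sd g η U a b * sd g η U c d) +
      ((toC4 (bigG g)) a b c d - Complex.I * (toC4 η) a b c d))),
    pull4_add (toC E) (fun a b c d => 3 * (sd g η U a b * sd g η U c d)),
    pull4_sub (toC E) (toC4 (bigG g)), pull4_smul (toC E) 3, pull4_smul (toC E) Complex.I,
    pull4_prod]

lemma sqrt_two_sq : ((1 / Real.sqrt 2 : ℝ) : ℂ) * ((1 / Real.sqrt 2 : ℝ) : ℂ) = 1 / 2 := by
  rw [← Complex.ofReal_mul, div_mul_div_comm, Real.mul_self_sqrt (by norm_num)]; norm_num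

/-- A form of the condition `IsCanonicalForm` that is manifestly covariant. -/
lemma isCanonicalForm_iff (g : Tensor2 ℝ) (η W : Tensor4 ℝ) (w : ℂ) (U : Tensor2 ℝ) :
    IsCanonicalForm g η W w U ↔ w ≠ 0 ∧ Uᵀ = -U ∧
      (sd g η U * toC g⁻¹ * (sd g η U)ᵀ * (toC g⁻¹)ᵀ).trace = -4 ∧
      (fun a b c d => toC4 W a b c d - Complex.I * toC4 (hodge4 g η W) a b c d) =
        typeDForm g η w U := by
  have hc (a b : Fin 4) : calU g η U a b = ((1 / Real.sqrt 2 : ℝ) : ℂ) * sd g η U a b := rfl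
  have hn : inner2 g (calU g η U) (calU g η U) =
      1 / 4 * (sd g η U * toC g⁻¹ * (sd g η U)ᵀ * (toC g⁻¹)ᵀ).trace := by
    simp only [inner2, hc, Matrix.trace, Matrix.diag_apply, Matrix.mul_apply,
      Matrix.transpose_apply, Finset.sum_mul, Finset.mul_sum, toC_apply]
    refine Finset.sum_congr rfl fun a _ => ?_
    rw [Finset.sum_comm]
    refine Finset.sum_congr rfl fun c _ => ?_
    conv_rhs => rw [Finset.sum_comm]
    refine Finset.sum_congr rfl fun b _ => Finset.sum_congr rfl fun d _ => ?_
    linear_combination (1 / 2 * sd g η U a b * (g⁻¹ a c : ℝ) * (g⁻¹ b d : ℝ) * sd g η U c d) *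
      sqrt_two_sq
  have hw (a b c d : Fin 4) : calW g η W a b c d =
        3 * w * (calU g η U a b * calU g η U c d) + w * calG g η a b c d ↔
      toC4 W a b c d - Complex.I * toC4 (hodge4 g η W) a b c d = typeDForm g η w U a b c d := by
    simp only [calW, calG, hc, typeDForm, toC4]
    constructor <;> intro h
    · linear_combination 2 * h + 6 * w * sd g η U a b * sd g η U c d * sqrt_two_sq
    · linear_combination 1 / 2 * h - 3 * w * sd g η U a b * sd g η U c d * sqrt_two_sq
  constructor
  · rintro ⟨h1, h2, h3, h4⟩
    refine ⟨h1, ?_, ?_, ?_⟩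
    · ext a b; simpa using h2 b a
    · rw [hn] at h3; linear_combination 4 * h3
    · ext a b c d; exact (hw a b c d).mp (h4 a b c d)
  · rintro ⟨h1, h2, h3, h4⟩
    refine ⟨h1, fun a b => ?_, ?_, fun a b c d => (hw a b c d).mpr ?_⟩
    · have := congrFun (congrFun h2 b) a; simpa using this
    · rw [hn, h3]; norm_num
    · rw [← h4]

lemma IsCanonicalForm.pull {g : Tensor2 ℝ} {η W : Tensor4 ℝ} {w : ℂ}
    {U E : Tensor2 ℝ} (h : IsCanonicalForm g η W w U) (hE : IsUnit E.det) :
    IsCanonicalForm (pull2 E g) (pull4 E η) (pull4 E W) w (pull2 E U) := by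
  rw [isCanonicalForm_iff] at h ⊢
  obtain ⟨h1, h2, h3, h4⟩ := h
  refine ⟨h1, ?_, ?_, ?_⟩
  · simp only [pull2, Matrix.transpose_mul, Matrix.transpose_transpose, h2]
    simp [Matrix.mul_assoc]
  · rw [sd_pull g η U hE, ← h3]
    refine trace_pull2 ?_ ?_ _ _
    · rw [← toC_mul, ← toC_transpose, ← toC_mul, inv_pull2 g hE]
    · rw [← toC_transpose, ← toC_mul, ← toC_transpose, ← toC_mul, inv_pull2_transpose g hE,
        toC_transpose]
  · rw [typeDForm_pull g η w U hE, ← h4, hodge4_pull g η W hE, toC4_pull4, toC4_pull4,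
      pull4_sub (toC E) (toC4 W), pull4_smul (toC E) Complex.I]

end Covariance

/-! ### The Levi-Civita symbol -/

section LeviCivita

open Matrix

/-- The sign of the Vandermonde product is the sign of the permutation, and zero if two indices
agree. After expansion of the determinant this is a finite check over all quadruples of indices. -/
lemma det_int_eps : ∀ a b c d : Fin 4, (Matrix.of fun i j => if i = (![a,b,c,d] : Fin 4 → Fin 4) j then (1:ℤ) else 0).det = eps a b c d := by
  simp only [Matrix.det_succ_row_zero, Matrix.det_fin_zero, Fin.sum_univ_succ]
  decide +kernel
lemma det_delta_eps (r : Fin 4 → Fin 4) : (Matrix.of fun j i => if i = r j then (1:ℝ) else 0).det = eps (r 0) (r 1) (r 2) (r 3) := by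
  rw [← det_int_eps, ← Matrix.det_transpose]
  have := (Int.castRingHom ℝ).map_det (Matrix.of fun i j => if i = (![r 0, r 1, r 2, r 3] : Fin 4 → Fin 4) j then (1:ℤ) else 0)
  refine Eq.trans ?_ this.symm
  have h : ![r 0, r 1, r 2, r 3] = r := by ext m; fin_cases m <;> rfl
  rw [h]
  congr 1
  ext i j
  change (if i = r j then (1 : ℝ) else 0) = ((if i = r j then (1 : ℤ) else 0 : ℤ) : ℝ)
  split_ifs <;> simp
lemma sum_fin_four_pi {α M : Type*} [Fintype α] [AddCommMonoid M] (f : α → α → α → α → M) :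
    ∑ i, ∑ j, ∑ k, ∑ l, f i j k l = ∑ r : Fin 4 → α, f (r 0) (r 1) (r 2) (r 3) := by
  have h {n : ℕ} (f : (Fin (n + 1) → α) → M) :
    ∑ r, f r = ∑ a, ∑ r : Fin n → α, f (Fin.cons a r) := by
    rw [← Fintype.sum_prod_type']
    exact (Fintype.sum_equiv (Fin.consEquiv fun _ => α) _ _ fun _ => rfl).symm
  simp only [h, Finset.univ_unique, Finset.sum_singleton]
  rfl
lemma det_eq_sum_eps (A : Tensor2 ℝ) : A.det = ∑ i, ∑ j, ∑ k, ∑ l, A i 0 * A j 1 * (A k 2 * A l 3 * (eps i j k l : ℝ)) := by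
  have h (j : Fin 4) : Aᵀ j = ∑ i, A i j • (fun m => if m = i then (1 : ℝ) else 0) := by
    ext i; simp [Finset.sum_apply]
  have h0 : Aᵀ = fun j => ∑ i, A i j • (fun m => if m = i then (1 : ℝ) else 0) := funext h
  rw [← Matrix.det_transpose, sum_fin_four_pi fun i j k l => A i 0 * A j 1 * (A k 2 * A l 3 * (eps i j k l : ℝ))]
  change Matrix.detRowAlternating.toMultilinearMap Aᵀ = _
  rw [h0, MultilinearMap.map_sum]
  refine Finset.sum_congr rfl fun r _ => ?_
  rw [MultilinearMap.map_smul_univ, ← det_delta_eps, Fin.prod_univ_four, smul_eq_mul, ← mul_assoc, ← mul_assoc]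
  rfl
lemma det_columns (E : Tensor2 ℝ) (a b c d : Fin 4) :
    (E.submatrix id ![a, b, c, d]).det = E.det * eps a b c d := by
  have h : E.submatrix id ![a, b, c, d] = E * (Matrix.of fun i j => if i = (![a,b,c,d] : Fin 4 → Fin 4) j then (1:ℤ) else 0).map (Int.cast : ℤ → ℝ) := by
    ext i j
    simp [Matrix.mul_apply, apply_ite]
  rw [h, Matrix.det_mul, ← det_int_eps]
  congr 1
  exact ((Int.castRingHom ℝ).map_det _).symm

/-- A multiple of the Levi-Civita symbol. -/
def epsTensor (s : ℝ) : Tensor4 ℝ := fun a b c d => s * (eps a b c d : ℝ)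

/-- The component with indices `a b c d` is the determinant of the matrix formed by these columns of
`E`. -/
lemma pull4_epsTensor (κ : ℝ) (E : Tensor2 ℝ) : pull4 E (epsTensor κ) = epsTensor (κ * E.det) := by
  ext a b c d
  have h := det_eq_sum_eps (E.submatrix id ![a, b, c, d])
  rw [det_columns] at h
  simp only [epsTensor]
  rw [mul_assoc, h]
  simp only [pull4, epsTensor, Finset.mul_sum]
  exact Finset.sum_congr rfl fun i _ => Finset.sum_congr rfl fun j _ =>
    Finset.sum_congr rfl fun k _ => Finset.sum_congr rfl fun l _ => by simp; ring

end LeviCivita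

/-! ### The canonical form in an orthonormal basis -/

section Orthonormal

open Matrix CoordFrame

/-- The 2-form with electric part `u` and magnetic part `b`. -/
def bivector {R : Type} [CommRing R] (u b : Fin 3 → R) : Tensor2 R :=
  !![0, u 0, u 1, u 2; -u 0, 0, b 2, -b 1; -u 1, -b 2, 0, b 0; -u 2, b 1, -b 0, 0]

lemma exists_bivector {U : Tensor2 ℝ} (h : Uᵀ = -U) : ∃ u b, U = bivector u b := by
  have h1 (a b : Fin 4) : U a b = -U b a := by
    have := congrFun (congrFun h b) a; simpa using this
  have h0 (a : Fin 4) : U a a = 0 := by have := h1 a a; linarith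
  refine ⟨![U 0 1, U 0 2, U 0 3], ![U 2 3, U 3 1, U 1 2], ?_⟩
  ext a b
  fin_cases a <;> fin_cases b <;> simp [bivector, h0] <;> exact h1 _ _

lemma minkMat_inv : (minkMat ℝ)⁻¹ = minkMat ℝ := Matrix.inv_eq_right_inv minkMat_sq

lemma minkMat_eq (R : Type) [CommRing R] :
    minkMat R = !![-1, 0, 0, 0; 0, 1, 0, 0; 0, 0, 1, 0; 0, 0, 0, 1] := by
  ext i j
  fin_cases i <;> fin_cases j <;> simp [minkMat, mink]

lemma minkMat_apply (a b : Fin 4) : minkMat ℝ a b = if a = b then (mink a : ℝ) else 0 := by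
  rw [minkMat, Matrix.diagonal_apply]

lemma toC_minkMat : toC (minkMat ℝ) = minkMat ℂ := by
  ext i j
  simp [toC_apply, minkMat_eq]
  fin_cases i <;> fin_cases j <;> simp

lemma det_minkMat : (minkMat ℝ).det = -1 := by
  simp [minkMat, Matrix.det_diagonal, Fin.prod_univ_four, mink]

lemma hodge_mink (η : Tensor4 ℝ) (F : Tensor2 ℝ) (a b : Fin 4) :
    hodge (minkMat ℝ) η F a b = 1 / 2 * ∑ c, ∑ d, η a b c d * mink c * mink d * F c d := by
  simp only [hodge, minkMat_inv, minkMat_apply, mul_ite, ite_mul, mul_zero, zero_mul,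
    Finset.sum_ite_eq, Finset.mem_univ, if_true]

lemma hodge_bivector (s : ℝ) (u b : Fin 3 → ℝ) :
    hodge (minkMat ℝ) (epsTensor s) (bivector u b) =
      bivector (fun i => s * b i) (fun i => -(s * u i)) := by
  ext x y
  rw [hodge_mink]
  fin_cases x <;> fin_cases y <;>
  simp [epsTensor, eps, bivector, Fin.sum_univ_four, mink, show Int.sign 2 = 1 from rfl,
    show Int.sign 3 = 1 from rfl] <;> ring

/-- A self-dual 2-form is determined by its complex electric part $p=u-isb$; its magnetic part is
$isp$. -/
lemma sd_bivector {s : ℝ} (hs : s ^ 2 = 1) (u b : Fin 3 → ℝ) :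
    sd (minkMat ℝ) (epsTensor s) (bivector u b) =
      bivector (fun i => (u i : ℂ) - Complex.I * (s * b i))
        (fun i => Complex.I * s * ((u i : ℂ) - Complex.I * (s * b i))) := by
  have hs' : (s : ℂ) ^ 2 = 1 := by exact_mod_cast hs
  have hI := Complex.I_sq
  have h (i : Fin 3) : (b i : ℂ) + Complex.I * (s * u i) =
      Complex.I * s * ((u i : ℂ) - Complex.I * (s * b i)) := by
    linear_combination (s : ℂ) ^ 2 * b i * hI - (b i : ℂ) * hs'
  ext x y
  rw [sd_apply, hodge_bivector]
  fin_cases x <;> fin_cases y <;> simp [bivector, ← h] <;> ring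

lemma mul_mink_mul_apply {R : Type} [CommRing R] (A B : Tensor2 R) (x y : Fin 4) :
    (A * minkMat R * B) x y =
      -(A x 0 * B 0 y) + A x 1 * B 1 y + A x 2 * B 2 y + A x 3 * B 3 y := by
  simp [Matrix.mul_apply, Fin.sum_univ_four, minkMat, Matrix.diagonal_apply, mink]

/-- `bivector b (-u)` is the Hodge dual up to the sign `s`. This lemma and `bivector_mul_dual` are
the classical facts that $F^2-(*F)^2$ and $F\,{*F}$ are multiples of the metric; the multiples are
the two quadratic invariants. -/
lemma bivector_mul_bivector {R : Type} [CommRing R] (u b : Fin 3 → R) :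
    bivector u b * minkMat R * bivector u b - bivector b (-u) * minkMat R * bivector b (-u) =
      (u 0 ^ 2 + u 1 ^ 2 + u 2 ^ 2 - (b 0 ^ 2 + b 1 ^ 2 + b 2 ^ 2)) • minkMat R := by
  ext x y
  rw [Matrix.sub_apply, mul_mink_mul_apply, mul_mink_mul_apply, minkMat_eq, Matrix.smul_apply,
    smul_eq_mul]
  fin_cases x <;> fin_cases y <;> simp [bivector] <;> ring

lemma bivector_mul_dual {R : Type} [CommRing R] (u b : Fin 3 → R) :
    bivector u b * minkMat R * bivector b (-u) =
      (u 0 * b 0 + u 1 * b 1 + u 2 * b 2) • minkMat R := by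
  ext x y
  rw [mul_mink_mul_apply, minkMat_eq, Matrix.smul_apply, smul_eq_mul]
  fin_cases x <;> fin_cases y <;> simp [bivector] <;> ring

lemma bivector_smul {R : Type} [CommRing R] (s : R) (u b : Fin 3 → R) :
    bivector (fun i => s * u i) (fun i => s * b i) = s • bivector u b := by
  ext x y
  fin_cases x <;> fin_cases y <;> simp [bivector]

lemma hodge_bivector' (s : ℝ) (u b : Fin 3 → ℝ) :
    hodge (minkMat ℝ) (epsTensor s) (bivector u b) = s • bivector b (-u) := by
  rw [hodge_bivector, ← bivector_smul]; simp

lemma trace_bivector {R : Type} [CommRing R] (p q : Fin 3 → R) :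
    (bivector p q * minkMat R * (bivector p q)ᵀ * (minkMat R)ᵀ).trace =
      2 * (q 0 ^ 2 + q 1 ^ 2 + q 2 ^ 2) - 2 * (p 0 ^ 2 + p 1 ^ 2 + p 2 ^ 2) := by
  have (A : Tensor2 R) : (A * (minkMat R)ᵀ).trace = -A 0 0 + A 1 1 + A 2 2 + A 3 3 := by
    simp [Matrix.trace, Matrix.mul_apply, Fin.sum_univ_four, minkMat, Matrix.diagonal_apply, mink]
  rw [this]
  simp only [mul_mink_mul_apply, Matrix.transpose_apply]
  simp [bivector]
  ring

variable {s : ℝ} {W : Tensor4 ℝ} {w : ℂ} {u b : Fin 3 → ℝ}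

/-- The normalisation $(\mathcal U,\mathcal U)=-1$ becomes $p\cdot p=1$ for the electric part; its
real and imaginary parts are separated in `bivector_real`. -/
lemma IsCanonicalForm.bivector_sum (hs : s ^ 2 = 1)
    (h : IsCanonicalForm (minkMat ℝ) (epsTensor s) W w (bivector u b)) :
    ∑ i, ((u i : ℂ) - Complex.I * (s * b i)) ^ 2 = 1 := by
  rw [isCanonicalForm_iff] at h
  have hs' : (s : ℂ) ^ 2 = 1 := by exact_mod_cast hs
  have hI := Complex.I_sq
  have := h.2.2.1
  rw [minkMat_inv, toC_minkMat, sd_bivector hs, trace_bivector] at this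
  rw [Fin.sum_univ_three]
  generalize (u 0 : ℂ) - Complex.I * (s * b 0) = p0 at *
  generalize (u 1 : ℂ) - Complex.I * (s * b 1) = p1 at *
  generalize (u 2 : ℂ) - Complex.I * (s * b 2) = p2 at *
  linear_combination -1 / 4 * this + (p0 ^ 2 + p1 ^ 2 + p2 ^ 2) / 2 * s ^ 2 * hI -
    (p0 ^ 2 + p1 ^ 2 + p2 ^ 2) / 2 * hs'

lemma IsCanonicalForm.bivector_real (hs : s ^ 2 = 1)
    (h : IsCanonicalForm (minkMat ℝ) (epsTensor s) W w (bivector u b)) :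
    u 0 ^ 2 + u 1 ^ 2 + u 2 ^ 2 - (b 0 ^ 2 + b 1 ^ 2 + b 2 ^ 2) = 1 ∧
      u 0 * b 0 + u 1 * b 1 + u 2 * b 2 = 0 := by
  have h1 := h.bivector_sum hs
  rw [Fin.sum_univ_three] at h1
  have hr := congrArg Complex.re h1
  have hi := congrArg Complex.im h1
  simp [pow_two] at hr hi
  have hs0 : s ≠ 0 := by rintro rfl; norm_num at hs
  refine ⟨by linear_combination hr + (b 0 ^ 2 + b 1 ^ 2 + b 2 ^ 2) * hs, ?_⟩
  have : s * (u 0 * b 0 + u 1 * b 1 + u 2 * b 2) = 0 := by linear_combination -1 / 2 * hi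
  exact (mul_eq_zero.mp this).resolve_left hs0

lemma typeDForm_bivector (hs : s ^ 2 = 1) (i j : Fin 3) :
    typeDForm (minkMat ℝ) (epsTensor s) w (bivector u b) 0 i.succ 0 j.succ =
      w * (3 * (((u i : ℂ) - Complex.I * (s * b i)) * ((u j : ℂ) - Complex.I * (s * b j))) -
        if i = j then 1 else 0) := by
  have h1 (i : Fin 3) : sd (minkMat ℝ) (epsTensor s) (bivector u b) 0 i.succ =
      (u i : ℂ) - Complex.I * (s * b i) := by
    rw [sd_bivector hs]; fin_cases i <;> rfl
  have h2 : toC4 (bigG (minkMat ℝ)) 0 i.succ 0 j.succ - Complex.I *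
      toC4 (epsTensor s) 0 i.succ 0 j.succ = -if i = j then 1 else 0 := by
    simp only [toC4, bigG, minkMat_eq, epsTensor, eps]
    fin_cases i <;> fin_cases j <;> simp
  simp only [typeDForm, h1, h2]
  ring

/-- The matrix $w(3pp^{\mathsf T}-1)$ with $p\cdot p=1$ has the eigenvalues $2w,-w,-w$. The traces
of its square and cube are $6w^2$ and $6w^3$, which together determine $w\neq0$. -/
lemma eigenvalue_unique_aux {w w' : ℂ} {p q : Fin 3 → ℂ} (hp : ∑ i, p i ^ 2 = 1)
    (hq : ∑ i, q i ^ 2 = 1) (hw : w ≠ 0)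
    (h : ∀ i j, w * (3 * (p i * p j) - if i = j then 1 else 0) =
      w' * (3 * (q i * q j) - if i = j then 1 else 0)) : w = w' := by
  let Q (w : ℂ) (p : Fin 3 → ℂ) : Matrix (Fin 3) (Fin 3) ℂ :=
    Matrix.of fun i j => w * (3 * (p i * p j) - if i = j then 1 else 0)
  have hQ : Q w p = Q w' q := by ext i j; exact h i j
  have h2 (w : ℂ) (p : Fin 3 → ℂ) (hp : ∑ i, p i ^ 2 = 1) : (Q w p * Q w p).trace = 6 * w ^ 2 := by
    rw [Fin.sum_univ_three] at hp
    simp [Q, Matrix.trace, Matrix.mul_apply, Fin.sum_univ_three]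
    linear_combination (w ^ 2 * (9 * (p 0 ^ 2 + p 1 ^ 2 + p 2 ^ 2) + 3)) * hp
  have h3 (w : ℂ) (p : Fin 3 → ℂ) (hp : ∑ i, p i ^ 2 = 1) :
      (Q w p * Q w p * Q w p).trace = 6 * w ^ 3 := by
    rw [Fin.sum_univ_three] at hp
    simp [Q, Matrix.trace, Matrix.mul_apply, Fin.sum_univ_three]
    generalize p 0 = x at *
    generalize p 1 = y at *
    generalize p 2 = z at *
    have : x ^ 2 = 1 - y ^ 2 - z ^ 2 := by linear_combination hp
    linear_combination (w ^ 3 * (27 * (x ^ 2 + y ^ 2 + z ^ 2) ^ 2 + 9)) * hp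
  have e2 : w ^ 2 = w' ^ 2 := by
    have := h2 w p hp
    rw [hQ, h2 w' q hq] at this
    linear_combination -1 / 6 * this
  have e3 : w ^ 3 = w' ^ 3 := by
    have := h3 w p hp
    rw [hQ, h3 w' q hq] at this
    linear_combination -1 / 6 * this
  have : w ^ 2 * (w - w') = 0 := by linear_combination e3 - w' * e2
  exact sub_eq_zero.mp ((mul_eq_zero.mp this).resolve_left (pow_ne_zero 2 hw))

end Orthonormal

/-! ### Algebra of the canonical bivector -/

section CanonicalBivector

open Matrix CoordFrame

/-- `g` is a Lorentzian metric and `η` its volume element. -/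
structure IsLorentzVol (g : Tensor2 ℝ) (η : Tensor4 ℝ) : Prop where
  exists_basis : ∃ E : Tensor2 ℝ, pull2 E g = minkMat ℝ
  exists_vol : ∃ κ : ℝ, κ ^ 2 = -g.det ∧ η = epsTensor κ

lemma det_pull2 (E g : Tensor2 ℝ) : (pull2 E g).det = E.det ^ 2 * g.det := by
  rw [pull2, Matrix.det_mul, Matrix.det_mul, Matrix.det_transpose]; ring

lemma isUnit_det_of_pull2 {E g : Tensor2 ℝ} (h : pull2 E g = minkMat ℝ) : IsUnit E.det := by
  have := det_pull2 E g
  rw [h, det_minkMat] at this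
  refine isUnit_iff_ne_zero.mpr fun h0 => ?_
  rw [h0] at this; norm_num at this

/-- In an orthonormal basis the volume element is the Levi-Civita symbol up to a sign. -/
lemma IsLorentzVol.pull4_eq {g : Tensor2 ℝ} {η : Tensor4 ℝ} (h : IsLorentzVol g η)
    {E : Tensor2 ℝ} (hE : pull2 E g = minkMat ℝ) :
    ∃ s : ℝ, s ^ 2 = 1 ∧ pull4 E η = epsTensor s := by
  obtain ⟨κ, hκ, rfl⟩ := h.exists_vol
  refine ⟨κ * E.det, ?_, pull4_epsTensor κ E⟩
  have := det_pull2 E g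
  rw [hE, det_minkMat] at this
  rw [mul_pow, hκ]
  linarith

lemma IsLorentzVol.symm {g : Tensor2 ℝ} {η : Tensor4 ℝ} (h : IsLorentzVol g η) : gᵀ = g := by
  obtain ⟨E, hE⟩ := h.exists_basis
  refine pull2_injective (isUnit_det_of_pull2 hE) ?_
  have : pull2 E gᵀ = (pull2 E g)ᵀ := by
    simp only [pull2, Matrix.transpose_mul, Matrix.transpose_transpose, Matrix.mul_assoc]
  rw [this, hE, minkMat, Matrix.diagonal_transpose]

lemma IsLorentzVol.isUnit_det {g : Tensor2 ℝ} {η : Tensor4 ℝ} (h : IsLorentzVol g η) :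
    IsUnit g.det := by
  obtain ⟨E, hE⟩ := h.exists_basis
  have := det_pull2 E g
  rw [hE, det_minkMat] at this
  refine isUnit_iff_ne_zero.mpr fun h0 => ?_
  rw [h0] at this; norm_num at this

lemma tprod_pull (g A B : Tensor2 ℝ) {E : Tensor2 ℝ} (hE : IsUnit E.det) :
    tprod (pull2 E g) (pull2 E A) (pull2 E B) = pull2 E (tprod g A B) := by
  rw [tprod, tprod, ← inv_pull2 g hE]
  simp only [pull2, Matrix.mul_assoc]

/-- The eigenvalue `w` of a tensor of type D is unique. -/
lemma IsCanonicalForm.eigenvalue_unique {g : Tensor2 ℝ} {η W : Tensor4 ℝ} {w w' : ℂ}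
    {U U' : Tensor2 ℝ} (hg : IsLorentzVol g η) (h : IsCanonicalForm g η W w U)
    (h' : IsCanonicalForm g η W w' U') : w = w' := by
  obtain ⟨E, hE⟩ := hg.exists_basis
  have hE' := isUnit_det_of_pull2 hE
  obtain ⟨s, hs, hη⟩ := hg.pull4_eq hE
  have h1 := h.pull hE'
  have h2 := h'.pull hE'
  rw [hE, hη] at h1 h2
  obtain ⟨u, b, hU⟩ := exists_bivector ((isCanonicalForm_iff _ _ _ _ _).mp h1).2.1
  obtain ⟨u', b', hU'⟩ := exists_bivector ((isCanonicalForm_iff _ _ _ _ _).mp h2).2.1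
  rw [hU] at h1
  rw [hU'] at h2
  refine eigenvalue_unique_aux (h1.bivector_sum hs) (h2.bivector_sum hs) h1.ne_zero fun i j => ?_
  have e := ((isCanonicalForm_iff _ _ _ _ _).mp h1).2.2.2.symm.trans
    ((isCanonicalForm_iff _ _ _ _ _).mp h2).2.2.2
  have := congrFun (congrFun (congrFun (congrFun e 0) i.succ) 0) j.succ
  rwa [typeDForm_bivector hs, typeDForm_bivector hs] at this

/-- The algebraic relations between a canonical bivector and its dual. -/
structure IsBivectorPair (g U S : Tensor2 ℝ) : Prop where
  symm : gᵀ = g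
  isUnit_det : IsUnit g.det
  antisymm_left : Uᵀ = -U
  antisymm_right : Sᵀ = -S
  sq_sub_sq : U * g⁻¹ * U - S * g⁻¹ * S = g
  mul_dual : U * g⁻¹ * S = 0

lemma IsCanonicalForm.exists_bivector {g : Tensor2 ℝ} {η W : Tensor4 ℝ} {w : ℂ} {U : Tensor2 ℝ}
    (hg : IsLorentzVol g η) (h : IsCanonicalForm g η W w U) :
    ∃ (E : Tensor2 ℝ) (s : ℝ) (u b : Fin 3 → ℝ), IsUnit E.det ∧ pull2 E g = minkMat ℝ ∧
      s ^ 2 = 1 ∧ pull2 E U = bivector u b ∧ pull2 E (hodge g η U) = s • bivector b (-u) ∧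
      u 0 ^ 2 + u 1 ^ 2 + u 2 ^ 2 - (b 0 ^ 2 + b 1 ^ 2 + b 2 ^ 2) = 1 ∧
      u 0 * b 0 + u 1 * b 1 + u 2 * b 2 = 0 := by
  obtain ⟨E, hE⟩ := hg.exists_basis
  have hE' := isUnit_det_of_pull2 hE
  obtain ⟨s, hs, hη⟩ := hg.pull4_eq hE
  have h1 := h.pull hE'
  obtain ⟨u, b, hU⟩ := TypeDVacuum.exists_bivector ((isCanonicalForm_iff _ _ _ _ _).mp h1).2.1
  rw [hE, hη, hU] at h1
  obtain ⟨h2, h3⟩ := h1.bivector_real hs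
  refine ⟨E, s, u, b, hE', hE, hs, hU, ?_, h2, h3⟩
  rw [← hodge_pull g η U hE', hE, hη, hU, hodge_bivector']

lemma bivector_transpose {R : Type} [CommRing R] (u b : Fin 3 → R) :
    (bivector u b)ᵀ = -bivector u b := by
  ext x y
  fin_cases x <;> fin_cases y <;> simp [bivector]

lemma IsCanonicalForm.isBivectorPair {g : Tensor2 ℝ} {η W : Tensor4 ℝ} {w : ℂ} {U : Tensor2 ℝ}
    (hg : IsLorentzVol g η) (h : IsCanonicalForm g η W w U) :
    IsBivectorPair g U (hodge g η U) := by
  obtain ⟨E, s, u, b, hE', hE, hs, hU, hS, h2, h3⟩ := h.exists_bivector hg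
  have hm (A B : Tensor2 ℝ) : pull2 E (A * g⁻¹ * B) = pull2 E A * minkMat ℝ * pull2 E B := by
    have := tprod_pull g A B hE'
    rw [tprod, tprod, hE, minkMat_inv] at this
    exact this.symm
  have ht (A : Tensor2 ℝ) : pull2 E Aᵀ = (pull2 E A)ᵀ := by
    simp only [pull2, Matrix.transpose_mul, Matrix.transpose_transpose, Matrix.mul_assoc]
  have hn (A : Tensor2 ℝ) : pull2 E (-A) = -pull2 E A := by
    simp only [pull2, Matrix.mul_neg, Matrix.neg_mul]
  refine ⟨hg.symm, hg.isUnit_det, pull2_injective hE' ?_, pull2_injective hE' ?_,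
    pull2_injective hE' ?_, pull2_injective hE' ?_⟩
  · rw [ht, hn, hU, bivector_transpose]
  · rw [ht, hn, hS, Matrix.transpose_smul, bivector_transpose, smul_neg]
  · rw [pull2_sub, hm, hm, hU, hS, hE]
    have : (s • bivector b (-u) : Tensor2 ℝ) * minkMat ℝ * (s • bivector b (-u)) =
        bivector b (-u) * minkMat ℝ * bivector b (-u) := by
      simp only [Matrix.smul_mul, Matrix.mul_smul, smul_smul]
      rw [← pow_two, hs, one_smul]
    rw [this, bivector_mul_bivector, h2, one_smul]
  · rw [hm, hU, hS, Matrix.mul_smul, bivector_mul_dual, h3]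
    simp [pull2]

/-- In an orthonormal basis $v_{00}=-|u|^2=-(1+|b|^2)$, so its first vector serves as `X`. The
spatial diagonal entries of $h$ add up to $3-|u|^2+2|b|^2=2+|b|^2$, so that one of them is positive
and the basis vector in question serves as `Y`. -/
lemma IsCanonicalForm.exists_vectors {g : Tensor2 ℝ} {η W : Tensor4 ℝ} {w : ℂ} {U : Tensor2 ℝ}
    (hg : IsLorentzVol g η) (h : IsCanonicalForm g η W w U) :
    (∃ X, X ⬝ᵥ (vProj g U *ᵥ X) < 0) ∧ ∃ Y, 0 < Y ⬝ᵥ (hProj g U *ᵥ Y) := by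
  obtain ⟨E, s, u, b, hE', hE, hs, hU, hS, h2, h3⟩ := h.exists_bivector hg
  have hv : pull2 E (vProj g U) = bivector u b * minkMat ℝ * bivector u b := by
    rw [vProj, ← tprod_pull g U U hE', hU, hE, tprod, minkMat_inv]
  have hh : pull2 E (hProj g U) = minkMat ℝ - bivector u b * minkMat ℝ * bivector u b := by
    rw [hProj, pull2_sub, hv, hE]
  have hc (A : Tensor2 ℝ) (a : Fin 4) : (fun i => E i a) ⬝ᵥ (A *ᵥ (fun i => E i a)) =
      pull2 E A a a := by
    simp only [pull2_apply, dotProduct, Matrix.mulVec, Finset.mul_sum]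
    exact Finset.sum_congr rfl fun i _ => Finset.sum_congr rfl fun j _ => by ring
  refine ⟨⟨fun i => E i 0, ?_⟩, ?_⟩
  · rw [hc, hv, mul_mink_mul_apply]
    simp [bivector]
    nlinarith [sq_nonneg (b 0), sq_nonneg (b 1), sq_nonneg (b 2)]
  · by_contra hne
    push Not at hne
    have k (a : Fin 4) : pull2 E (hProj g U) a a ≤ 0 := by rw [← hc]; exact hne _
    have k1 := k 1
    have k2 := k 2
    have k3 := k 3
    rw [hh, Matrix.sub_apply, mul_mink_mul_apply, minkMat_eq] at k1 k2 k3
    simp [bivector] at k1 k2 k3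
    nlinarith [sq_nonneg (b 0), sq_nonneg (b 1), sq_nonneg (b 2)]

end CanonicalBivector

/-! ### The adapted orthonormal frame -/

section AdaptedFrame

open Matrix CoordFrame

/-- The first vector of the time-like principal plane. -/
def timeVec (g U : Tensor2 ℝ) (X : Fin 4 → ℝ) : Fin 4 → ℝ :=
  (Real.sqrt (-(X ⬝ᵥ (vProj g U *ᵥ X))))⁻¹ • ((g⁻¹ * vProj g U) *ᵥ X)

/-- The first vector of the space-like principal plane. -/
def spaceVec (g U : Tensor2 ℝ) (Y : Fin 4 → ℝ) : Fin 4 → ℝ :=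
  (Real.sqrt (Y ⬝ᵥ (hProj g U *ᵥ Y)))⁻¹ • ((g⁻¹ * hProj g U) *ᵥ Y)

/-- The matrix whose columns are an orthonormal frame adapted to a canonical bivector. -/
def adaptedFrame (g U S : Tensor2 ℝ) (X Y : Fin 4 → ℝ) : Tensor2 ℝ := fun i a =>
  ![timeVec g U X, -((g⁻¹ * U) *ᵥ timeVec g U X), spaceVec g U Y,
    -((g⁻¹ * S) *ᵥ spaceVec g U Y)] a i

namespace IsBivectorPair

variable {g U S : Tensor2 ℝ} {X Y : Fin 4 → ℝ} (h : IsBivectorPair g U S)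
include h

lemma inv_mul : g⁻¹ * g = 1 := Matrix.nonsing_inv_mul g h.isUnit_det

lemma mul_inv : g * g⁻¹ = 1 := Matrix.mul_nonsing_inv g h.isUnit_det

lemma inv_symm : (g⁻¹)ᵀ = g⁻¹ := by rw [Matrix.transpose_nonsing_inv, h.symm]

lemma dual_mul : S * g⁻¹ * U = 0 := by
  have := congrArg Matrix.transpose h.mul_dual
  simpa [Matrix.transpose_mul, h.inv_symm, h.antisymm_left, h.antisymm_right,
    Matrix.mul_assoc] using this

lemma hProj_eq : hProj g U = -(S * g⁻¹ * S) := by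
  have := h.sq_sub_sq
  rw [hProj, show vProj g U = U * g⁻¹ * U from rfl]
  nth_rewrite 1 [← this]
  abel

/-- `û² - ŝ² = 1`. -/
lemma raised_sq_sub_sq : (g⁻¹ * U) * (g⁻¹ * U) - (g⁻¹ * S) * (g⁻¹ * S) = 1 := by
  calc _ = g⁻¹ * (U * g⁻¹ * U - S * g⁻¹ * S) := by noncomm_ring
    _ = 1 := by rw [h.sq_sub_sq, h.inv_mul]

lemma raised_mul_dual : (g⁻¹ * U) * (g⁻¹ * S) = 0 := by
  have := congrArg (g⁻¹ * ·) h.mul_dual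
  simpa [Matrix.mul_assoc] using this

lemma raised_dual_mul : (g⁻¹ * S) * (g⁻¹ * U) = 0 := by
  have := congrArg (g⁻¹ * ·) h.dual_mul
  simpa [Matrix.mul_assoc] using this

/-- With $\hat u=g^{-1}U$ and $\hat s=g^{-1}S$: $\hat u^4=\hat u^2(1+\hat s^2)=\hat u^2$, since
$\hat u\hat s=0$. So $\hat u^2$ is a projector. -/
lemma raised_sq_mul_sq : ((g⁻¹ * U) * (g⁻¹ * U)) * ((g⁻¹ * U) * (g⁻¹ * U)) =
    (g⁻¹ * U) * (g⁻¹ * U) := by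
  have h1 : (g⁻¹ * U) * (g⁻¹ * U) = 1 + (g⁻¹ * S) * (g⁻¹ * S) := by
    rw [← h.raised_sq_sub_sq]; abel
  nth_rewrite 2 [h1]
  rw [mul_add, mul_one]
  have : g⁻¹ * U * (g⁻¹ * U) * (g⁻¹ * S * (g⁻¹ * S)) =
    g⁻¹ * U * ((g⁻¹ * U) * (g⁻¹ * S)) * (g⁻¹ * S) := by noncomm_ring
  rw [this, h.raised_mul_dual]; simp

lemma dual_sq_mul_sq : ((g⁻¹ * S) * (g⁻¹ * S)) * ((g⁻¹ * S) * (g⁻¹ * S)) =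
    -((g⁻¹ * S) * (g⁻¹ * S)) := by
  have h1 : (g⁻¹ * S) * (g⁻¹ * S) = (g⁻¹ * U) * (g⁻¹ * U) - 1 := by
    rw [← h.raised_sq_sub_sq]; abel
  nth_rewrite 2 [h1]
  rw [mul_sub, mul_one]
  have : g⁻¹ * S * (g⁻¹ * S) * (g⁻¹ * U * (g⁻¹ * U)) =
    g⁻¹ * S * ((g⁻¹ * S) * (g⁻¹ * U)) * (g⁻¹ * U) := by noncomm_ring
  rw [this, h.raised_dual_mul]; simp

lemma inner_symm (x y : Fin 4 → ℝ) : x ⬝ᵥ (g *ᵥ y) = y ⬝ᵥ (g *ᵥ x) := by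
  rw [Matrix.dotProduct_mulVec, ← Matrix.mulVec_transpose, h.symm, dotProduct_comm]

lemma inner_raised (F : Tensor2 ℝ) (x y : Fin 4 → ℝ) :
    x ⬝ᵥ (g *ᵥ ((g⁻¹ * F) *ᵥ y)) = x ⬝ᵥ (F *ᵥ y) := by
  rw [Matrix.mulVec_mulVec, ← Matrix.mul_assoc, h.mul_inv, Matrix.one_mul]

lemma inner_antisymm {F : Tensor2 ℝ} (hF : Fᵀ = -F) (x y : Fin 4 → ℝ) :
    x ⬝ᵥ (g *ᵥ ((g⁻¹ * F) *ᵥ y)) = -(((g⁻¹ * F) *ᵥ x) ⬝ᵥ (g *ᵥ y)) := by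
  rw [h.inner_raised, h.inner_symm _ y, h.inner_raised, Matrix.dotProduct_mulVec x,
    ← Matrix.mulVec_transpose, hF, Matrix.neg_mulVec, neg_dotProduct, dotProduct_comm]

omit h in
lemma raised_vProj : g⁻¹ * vProj g U = (g⁻¹ * U) * (g⁻¹ * U) := by
  rw [show vProj g U = U * g⁻¹ * U from rfl]; simp only [Matrix.mul_assoc]

lemma raised_hProj : g⁻¹ * hProj g U = -((g⁻¹ * S) * (g⁻¹ * S)) := by
  rw [h.hProj_eq]; simp only [Matrix.mul_assoc, Matrix.mul_neg]

lemma sq_mulVec_sq (x : Fin 4 → ℝ) :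
    (g⁻¹ * U) *ᵥ ((g⁻¹ * U) *ᵥ ((g⁻¹ * vProj g U) *ᵥ x)) = (g⁻¹ * vProj g U) *ᵥ x := by
  rw [raised_vProj]
  calc _ = ((g⁻¹ * U) * (g⁻¹ * U) * ((g⁻¹ * U) * (g⁻¹ * U))) *ᵥ x := by
        simp only [Matrix.mulVec_mulVec, Matrix.mul_assoc]
    _ = _ := by rw [h.raised_sq_mul_sq]

lemma dual_sq_mulVec_sq (x : Fin 4 → ℝ) :
    (g⁻¹ * S) *ᵥ ((g⁻¹ * S) *ᵥ ((g⁻¹ * hProj g U) *ᵥ x)) = -((g⁻¹ * hProj g U) *ᵥ x) := by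
  rw [h.raised_hProj]
  calc _ = -(((g⁻¹ * S) * (g⁻¹ * S) * ((g⁻¹ * S) * (g⁻¹ * S))) *ᵥ x) := by
        simp only [Matrix.mulVec_mulVec, Matrix.mul_assoc, Matrix.neg_mulVec, Matrix.mulVec_neg]
    _ = _ := by rw [h.dual_sq_mul_sq]

lemma sq_timeVec : (g⁻¹ * U) *ᵥ ((g⁻¹ * U) *ᵥ timeVec g U X) = timeVec g U X := by
  rw [timeVec, Matrix.mulVec_smul, Matrix.mulVec_smul, h.sq_mulVec_sq]

lemma dual_timeVec : (g⁻¹ * S) *ᵥ timeVec g U X = 0 := by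
  rw [timeVec, Matrix.mulVec_smul, raised_vProj, Matrix.mulVec_mulVec, ← Matrix.mul_assoc,
    h.raised_dual_mul]
  simp

lemma dual_sq_spaceVec : (g⁻¹ * S) *ᵥ ((g⁻¹ * S) *ᵥ spaceVec g U Y) = -spaceVec g U Y := by
  rw [spaceVec, Matrix.mulVec_smul, Matrix.mulVec_smul, h.dual_sq_mulVec_sq, smul_neg]

lemma raised_spaceVec : (g⁻¹ * U) *ᵥ spaceVec g U Y = 0 := by
  rw [spaceVec, Matrix.mulVec_smul, h.raised_hProj, Matrix.mulVec_mulVec, Matrix.mul_neg,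
    ← Matrix.mul_assoc, h.raised_mul_dual]
  simp

lemma inner_raised_left {F : Tensor2 ℝ} (hF : Fᵀ = -F) (x y : Fin 4 → ℝ) :
    ((g⁻¹ * F) *ᵥ x) ⬝ᵥ (g *ᵥ y) = -(x ⬝ᵥ (g *ᵥ ((g⁻¹ * F) *ᵥ y))) := by
  rw [h.inner_antisymm hF, neg_neg]

lemma inner_timeVec (hX : X ⬝ᵥ (vProj g U *ᵥ X) < 0) :
    timeVec g U X ⬝ᵥ (g *ᵥ timeVec g U X) = -1 := by
  have e : ((g⁻¹ * vProj g U) *ᵥ X) ⬝ᵥ (g *ᵥ ((g⁻¹ * vProj g U) *ᵥ X)) =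
      X ⬝ᵥ (vProj g U *ᵥ X) := by
    have e1 : (g⁻¹ * vProj g U) *ᵥ X = (g⁻¹ * U) *ᵥ ((g⁻¹ * U) *ᵥ X) := by
      rw [raised_vProj, Matrix.mulVec_mulVec]
    have e2 := h.sq_mulVec_sq X
    rw [← h.inner_raised (vProj g U)]
    nth_rewrite 1 [e1]
    rw [h.inner_raised_left h.antisymm_left, h.inner_raised_left h.antisymm_left, neg_neg, e2]
  rw [timeVec, Matrix.mulVec_smul, smul_dotProduct, dotProduct_smul, e, smul_eq_mul, smul_eq_mul]
  have h0 : 0 < -(X ⬝ᵥ (vProj g U *ᵥ X)) := by linarith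
  have h1 := Real.sq_sqrt h0.le
  have h2 := (Real.sqrt_pos.mpr h0).ne'
  field_simp
  linarith

lemma inner_spaceVec (hY : 0 < Y ⬝ᵥ (hProj g U *ᵥ Y)) :
    spaceVec g U Y ⬝ᵥ (g *ᵥ spaceVec g U Y) = 1 := by
  have e : ((g⁻¹ * hProj g U) *ᵥ Y) ⬝ᵥ (g *ᵥ ((g⁻¹ * hProj g U) *ᵥ Y)) =
      Y ⬝ᵥ (hProj g U *ᵥ Y) := by
    have e1 : (g⁻¹ * hProj g U) *ᵥ Y = -((g⁻¹ * S) *ᵥ ((g⁻¹ * S) *ᵥ Y)) := by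
      rw [h.raised_hProj, Matrix.mulVec_mulVec, Matrix.neg_mulVec]
    have e2 := h.dual_sq_mulVec_sq Y
    rw [← h.inner_raised (hProj g U)]
    nth_rewrite 1 [e1]
    rw [neg_dotProduct, h.inner_raised_left h.antisymm_right,
      h.inner_raised_left h.antisymm_right, neg_neg, e2, Matrix.mulVec_neg, dotProduct_neg, neg_neg]
  rw [spaceVec, Matrix.mulVec_smul, smul_dotProduct, dotProduct_smul, e, smul_eq_mul, smul_eq_mul]
  have h1 := Real.sq_sqrt hY.le
  have h2 := (Real.sqrt_pos.mpr hY).ne'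
  field_simp
  linarith

omit h in
lemma pull2_adaptedFrame_apply (A : Tensor2 ℝ) (a b : Fin 4) :
    pull2 (adaptedFrame g U S X Y) A a b = (fun i => adaptedFrame g U S X Y i a) ⬝ᵥ
      (A *ᵥ fun i => adaptedFrame g U S X Y i b) := by
  simp only [pull2_apply, dotProduct, Matrix.mulVec, Finset.mul_sum]
  exact Finset.sum_congr rfl fun i _ => Finset.sum_congr rfl fun j _ => by ring

lemma raised_adaptedFrame :
    ((g⁻¹ * U) *ᵥ fun i => adaptedFrame g U S X Y i 0) =
        -(fun i => adaptedFrame g U S X Y i 1) ∧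
      ((g⁻¹ * U) *ᵥ fun i => adaptedFrame g U S X Y i 1) =
        -(fun i => adaptedFrame g U S X Y i 0) ∧
      ((g⁻¹ * U) *ᵥ fun i => adaptedFrame g U S X Y i 2) = 0 ∧
      ((g⁻¹ * U) *ᵥ fun i => adaptedFrame g U S X Y i 3) = 0 := by
  refine ⟨?_, ?_, ?_, ?_⟩
  · change _ = -(-((g⁻¹ * U) *ᵥ timeVec g U X))
    rw [neg_neg]; rfl
  · change (g⁻¹ * U) *ᵥ (-((g⁻¹ * U) *ᵥ timeVec g U X)) = -timeVec g U X
    rw [Matrix.mulVec_neg, h.sq_timeVec]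
  · exact h.raised_spaceVec
  · change (g⁻¹ * U) *ᵥ (-((g⁻¹ * S) *ᵥ spaceVec g U Y)) = 0
    rw [Matrix.mulVec_neg, Matrix.mulVec_mulVec, h.raised_mul_dual]; simp

lemma dual_adaptedFrame :
    ((g⁻¹ * S) *ᵥ fun i => adaptedFrame g U S X Y i 0) = 0 ∧
      ((g⁻¹ * S) *ᵥ fun i => adaptedFrame g U S X Y i 1) = 0 ∧
      ((g⁻¹ * S) *ᵥ fun i => adaptedFrame g U S X Y i 2) =
        -(fun i => adaptedFrame g U S X Y i 3) ∧
      ((g⁻¹ * S) *ᵥ fun i => adaptedFrame g U S X Y i 3) =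
        fun i => adaptedFrame g U S X Y i 2 := by
  refine ⟨h.dual_timeVec, ?_, ?_, ?_⟩
  · change (g⁻¹ * S) *ᵥ (-((g⁻¹ * U) *ᵥ timeVec g U X)) = 0
    rw [Matrix.mulVec_neg, Matrix.mulVec_mulVec, h.raised_dual_mul]; simp
  · change _ = -(-((g⁻¹ * S) *ᵥ spaceVec g U Y))
    rw [neg_neg]; rfl
  · change (g⁻¹ * S) *ᵥ (-((g⁻¹ * S) *ᵥ spaceVec g U Y)) = spaceVec g U Y
    rw [Matrix.mulVec_neg, h.dual_sq_spaceVec, neg_neg]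

/-- The frame `adaptedFrame` is orthonormal, and in it `U = e⁰ ∧ e¹` and `S = e² ∧ e³`. -/
lemma pull2_adaptedFrame (hX : X ⬝ᵥ (vProj g U *ᵥ X) < 0) (hY : 0 < Y ⬝ᵥ (hProj g U *ᵥ Y)) :
    pull2 (adaptedFrame g U S X Y) g = minkMat ℝ ∧
      pull2 (adaptedFrame g U S X Y) U = biv01.map (Int.cast : ℤ → ℝ) ∧
      pull2 (adaptedFrame g U S X Y) S = biv23.map (Int.cast : ℤ → ℝ) := by
  obtain ⟨u0, u1, u2, u3⟩ := h.raised_adaptedFrame (X := X) (Y := Y)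
  obtain ⟨s0, s1, s2, s3⟩ := h.dual_adaptedFrame (X := X) (Y := Y)
  have n0 : (fun i => adaptedFrame g U S X Y i 0) ⬝ᵥ
      (g *ᵥ fun i => adaptedFrame g U S X Y i 0) = -1 := h.inner_timeVec hX
  have n2 : (fun i => adaptedFrame g U S X Y i 2) ⬝ᵥ
      (g *ᵥ fun i => adaptedFrame g U S X Y i 2) = 1 := h.inner_spaceVec hY
  have hp (A : Tensor2 ℝ) (a b : Fin 4) : pull2 (adaptedFrame g U S X Y) A a b =
      ![fun i => adaptedFrame g U S X Y i 0, fun i => adaptedFrame g U S X Y i 1,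
        fun i => adaptedFrame g U S X Y i 2, fun i => adaptedFrame g U S X Y i 3] a ⬝ᵥ
      (A *ᵥ ![fun i => adaptedFrame g U S X Y i 0, fun i => adaptedFrame g U S X Y i 1,
        fun i => adaptedFrame g U S X Y i 2, fun i => adaptedFrame g U S X Y i 3] b) := by
    rw [pull2_adaptedFrame_apply]
    fin_cases a <;> fin_cases b <;> rfl
  generalize (fun i => adaptedFrame g U S X Y i 0) = e0 at *
  generalize (fun i => adaptedFrame g U S X Y i 1) = e1 at *
  generalize (fun i => adaptedFrame g U S X Y i 2) = e2 at *
  generalize (fun i => adaptedFrame g U S X Y i 3) = e3 at *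
  have f1 : e1 = -((g⁻¹ * U) *ᵥ e0) := by rw [u0, neg_neg]
  have f0 : e0 = -((g⁻¹ * U) *ᵥ e1) := by rw [u1, neg_neg]
  have f3 : e3 = -((g⁻¹ * S) *ᵥ e2) := by rw [s2, neg_neg]
  have hself {F : Tensor2 ℝ} (hF : Fᵀ = -F) (x : Fin 4 → ℝ) : x ⬝ᵥ (g *ᵥ ((g⁻¹ * F) *ᵥ x)) = 0 := by
    have h1 := h.inner_antisymm hF x x
    rw [h.inner_symm ((g⁻¹ * F) *ᵥ x)] at h1
    linarith
  -- The vectors `e0`, `e1` lie in the image of the skew map $g^{-1}U$, and `e2`, `e3` in its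
  -- kernel, which is orthogonal to the image.
  have hU {x y z : Fin 4 → ℝ} (hx : x = -((g⁻¹ * U) *ᵥ z)) (hy : (g⁻¹ * U) *ᵥ y = 0) :
      x ⬝ᵥ (g *ᵥ y) = 0 := by
    rw [hx, neg_dotProduct, h.inner_raised_left h.antisymm_left, hy]; simp
  have n01 : e0 ⬝ᵥ (g *ᵥ e1) = 0 := by
    rw [f1, Matrix.mulVec_neg, dotProduct_neg, hself h.antisymm_left, neg_zero]
  have n23 : e2 ⬝ᵥ (g *ᵥ e3) = 0 := by
    rw [f3, Matrix.mulVec_neg, dotProduct_neg, hself h.antisymm_right, neg_zero]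
  have n11 : e1 ⬝ᵥ (g *ᵥ e1) = 1 := by
    nth_rewrite 1 [f1]
    rw [neg_dotProduct, h.inner_raised_left h.antisymm_left, u1, Matrix.mulVec_neg,
      dotProduct_neg, n0]; norm_num
  have n33 : e3 ⬝ᵥ (g *ᵥ e3) = 1 := by
    nth_rewrite 1 [f3]
    rw [neg_dotProduct, h.inner_raised_left h.antisymm_right, s3, n2]; norm_num
  have n02 := hU f0 u2
  have n03 := hU f0 u3
  have n12 := hU f1 u2
  have n13 := hU f1 u3
  have n10 := (h.inner_symm e1 e0).trans n01
  have n20 := (h.inner_symm e2 e0).trans n02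
  have n30 := (h.inner_symm e3 e0).trans n03
  have n21 := (h.inner_symm e2 e1).trans n12
  have n31 := (h.inner_symm e3 e1).trans n13
  have n32 := (h.inner_symm e3 e2).trans n23
  refine ⟨?_, ?_, ?_⟩
  · ext a b
    rw [hp, minkMat_eq]
    fin_cases a <;> fin_cases b <;>
      simp [n0, n01, n02, n03, n10, n11, n12, n13, n20, n21, n2, n23, n30, n31, n32, n33]
  · ext a b
    rw [hp, ← h.inner_raised]
    fin_cases a <;> fin_cases b <;>
      simp [u0, u1, u2, u3, Matrix.mulVec_neg, dotProduct_neg, biv01, n0, n01, n10, n11, n20, n21,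
        n30, n31]
  · ext a b
    rw [hp, ← h.inner_raised]
    fin_cases a <;> fin_cases b <;>
      simp [s0, s1, s2, s3, Matrix.mulVec_neg, dotProduct_neg, biv23, n02, n03, n12, n13, n2, n23,
        n32, n33]

end IsBivectorPair

end AdaptedFrame

/-! ### The type D tensor in an adapted frame -/

section CanonicalFrame

open Matrix CoordFrame

lemma biv01_eq (R : Type) [CommRing R] :
    biv01.map (Int.cast : ℤ → R) = bivector ![1, 0, 0] 0 := by
  ext a b; fin_cases a <;> fin_cases b <;> simp [biv01, bivector]

lemma bigG_minkMat (a b c d : Fin 4) : bigG (minkMat ℝ) a b c d = (minkG a b c d : ℝ) := by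
  simp only [bigG, minkMat_apply, minkG]
  push_cast
  rfl

/-- For $\eta_{0123}=s$ the dual of $e^0\wedge e^1$ is $-s\,e^2\wedge e^3$. Since the frame is built
with $*U=e^2\wedge e^3$, it has $s=-1$. -/
lemma IsLorentzVol.pull4_adapted {g U E : Tensor2 ℝ} {η : Tensor4 ℝ} (hg : IsLorentzVol g η)
    (hE : pull2 E g = minkMat ℝ) (hU : pull2 E U = biv01.map (Int.cast : ℤ → ℝ))
    (hS : pull2 E (hodge g η U) = biv23.map (Int.cast : ℤ → ℝ)) :
    pull4 E η = epsTensor (-1) := by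
  obtain ⟨s, hs, hη⟩ := hg.pull4_eq hE
  rw [← hodge_pull g η U (isUnit_det_of_pull2 hE), hE, hη, hU, biv01_eq, hodge_bivector'] at hS
  have := congrFun (congrFun hS 2) 3
  simp [bivector, biv23] at this
  rw [hη]
  congr 1
  linarith

/-- In an adapted frame, a real Weyl tensor of type D is the real part of `typeDTensor`. -/
lemma IsCanonicalForm.two_mul_pull4 {g U E : Tensor2 ℝ} {η W : Tensor4 ℝ} {w : ℂ}
    (hg : IsLorentzVol g η) (h : IsCanonicalForm g η W w U)
    (hE : pull2 E g = minkMat ℝ) (hU : pull2 E U = biv01.map (Int.cast : ℤ → ℝ))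
    (hS : pull2 E (hodge g η U) = biv23.map (Int.cast : ℤ → ℝ)) (a b c d : Fin 4) :
    2 * ((pull4 E W a b c d : ℝ) : ℂ) = typeDTensor ℂ w a b c d + star (typeDTensor ℂ w a b c d) := by
  have hE' := isUnit_det_of_pull2 hE
  have hη := hg.pull4_adapted hE hU hS
  have h1 := ((isCanonicalForm_iff _ _ _ _ _).mp (h.pull hE')).2.2.2
  have hS' := hodge_pull g η U hE'
  rw [hS, hE, hη, hU] at hS'
  have key : typeDForm (pull2 E g) (pull4 E η) w (pull2 E U) a b c d = typeDTensor ℂ w a b c d := by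
    simp only [typeDForm, typeDTensor, sd_apply, hS', hU, hE, hη, Matrix.map_apply, toC4,
      bigG_minkMat, epsTensor, imUnit]
    push_cast
    simp only [Algebra.algebraMap_self, RingHom.id_apply]
    ring
  have h2 := congrFun (congrFun (congrFun (congrFun h1 a) b) c) d
  rw [key] at h2
  rw [← h2]
  simp only [toC4, star_sub, star_mul', Complex.star_def, Complex.conj_ofReal, Complex.conj_I]
  ring

/-- The eigenvalue in terms of the components of the Weyl tensor in an adapted frame. -/
lemma IsCanonicalForm.eigenvalue_eq {g U E : Tensor2 ℝ} {η W : Tensor4 ℝ} {w : ℂ}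
    (hg : IsLorentzVol g η) (h : IsCanonicalForm g η W w U)
    (hE : pull2 E g = minkMat ℝ) (hU : pull2 E U = biv01.map (Int.cast : ℤ → ℝ))
    (hS : pull2 E (hodge g η U) = biv23.map (Int.cast : ℤ → ℝ)) :
    w = 1 / 2 * (((pull4 E W 0 1 0 1 : ℝ) : ℂ) + Complex.I * ((pull4 E W 0 1 2 3 : ℝ) : ℂ)) := by
  -- In the adapted frame the 0101- and 0123-components of `typeDTensor` are $2w$ and $-2iw$, so
  -- those of `W` are $2\,\mathrm{Re}\,w$ and $2\,\mathrm{Im}\,w$.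
  have h1 := h.two_mul_pull4 hg hE hU hS 0 1 0 1
  have h2 := h.two_mul_pull4 hg hE hU hS 0 1 2 3
  simp [typeDTensor, biv01, biv23, minkG, mink, eps, imUnit,
    show Int.sign 12 = 1 from rfl] at h1 h2
  linear_combination -1 / 4 * h1 - Complex.I / 4 * h2 +
    (w / 2 - (starRingEnd ℂ) w / 2) * Complex.I_sq

end CanonicalFrame

/-! ### Smooth fields of matrices -/

section SmoothFields

open TopologicalSpace Matrix

/-- A field of matrices is smooth on `V`. -/
def SmoothOn (V : Set E4) (A : E4 → Tensor2 ℝ) : Prop :=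
  ∀ i j, ContDiffOn ℝ ∞ (fun y => A y i j) V

namespace SmoothOn

variable {V : Set E4} {A B : E4 → Tensor2 ℝ}

lemma mono {V' : Set E4} (hA : SmoothOn V A) (h : V' ⊆ V) : SmoothOn V' A :=
  fun i j => (hA i j).mono h

lemma mul (hA : SmoothOn V A) (hB : SmoothOn V B) : SmoothOn V fun y => A y * B y := by
  intro i j
  simp only [Matrix.mul_apply]
  exact ContDiffOn.sum fun k _ => (hA i k).mul (hB k j)

lemma sub (hA : SmoothOn V A) (hB : SmoothOn V B) : SmoothOn V fun y => A y - B y :=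
  fun i j => (hA i j).sub (hB i j)

lemma det (hA : SmoothOn V A) : ContDiffOn ℝ ∞ (fun y => (A y).det) V := by
  simp only [Matrix.det_apply]
  exact ContDiffOn.sum fun σ _ => (contDiffOn_prod fun i _ => hA (σ i) i).const_smul _

lemma inv (hA : SmoothOn V A) (h : ∀ y ∈ V, IsUnit (A y).det) : SmoothOn V fun y => (A y)⁻¹ := by
  intro i j
  simp only [Matrix.inv_def, Matrix.smul_apply, Ring.inverse_eq_inv', Matrix.adjugate_apply]
  refine (hA.det.inv fun y hy => (h y hy).ne_zero).smul (SmoothOn.det (A := fun y =>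
    (A y).updateRow j (Pi.single i 1)) fun k l => ?_)
  simp only [Matrix.updateRow_apply]
  split_ifs
  · exact contDiffOn_const
  · exact hA k l

lemma mulVec (hA : SmoothOn V A) {x : E4 → Fin 4 → ℝ}
    (hx : ∀ i, ContDiffOn ℝ ∞ (fun y => x y i) V) (i : Fin 4) :
    ContDiffOn ℝ ∞ (fun y => (A y *ᵥ x y) i) V := by
  simp only [Matrix.mulVec, dotProduct]
  exact ContDiffOn.sum fun k _ => (hA i k).mul (hx k)

lemma quadratic (hA : SmoothOn V A) (X : Fin 4 → ℝ) :
    ContDiffOn ℝ ∞ (fun y => X ⬝ᵥ (A y *ᵥ X)) V := by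
  simp only [dotProduct]
  exact ContDiffOn.sum fun k _ =>
    contDiffOn_const.mul (hA.mulVec (x := fun _ => X) (fun i => contDiffOn_const) k)

lemma hodge {g U : E4 → Tensor2 ℝ} {η : E4 → Tensor4 ℝ} (hg : SmoothOn V fun y => (g y)⁻¹)
    (hη : ∀ a b c d, ContDiffOn ℝ ∞ (fun y => η y a b c d) V) (hU : SmoothOn V U) :
    SmoothOn V (hodgeField g η U) := by
  intro a b
  simp only [hodgeField, TypeDVacuum.hodge]
  exact contDiffOn_const.mul (ContDiffOn.sum fun c _ => ContDiffOn.sum fun d _ =>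
    ContDiffOn.sum fun e _ => ContDiffOn.sum fun f _ =>
      (((hη a b c d).mul (hg c e)).mul (hg d f)).mul (hU e f))

end SmoothOn

lemma contDiffOn_christoffel {V : Opens E4} {g : E4 → Tensor2 ℝ} (hg : SmoothOn V g)
    (hi : SmoothOn V fun y => (g y)⁻¹) (k i j : Fin 4) :
    ContDiffOn ℝ ∞ (christoffel g k i j) V := by
  unfold christoffel
  exact contDiffOn_const.mul (ContDiffOn.sum fun l _ => (hi k l).mul
    (((contDiffOn_pd (hg j l) i).add (contDiffOn_pd (hg i l) j)).sub (contDiffOn_pd (hg i j) l)))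

lemma pd_congr {V : Opens E4} {f f' : E4 → ℝ} (h : ∀ y ∈ V, f y = f' y) (i : Fin 4) {y : E4}
    (hy : y ∈ V) : pd i f y = pd i f' y := by
  have : f =ᶠ[nhds y] f' := Filter.eventually_of_mem (V.2.mem_nhds hy) h
  rw [pd, this.fderiv_eq, pd]

lemma christoffel_symm {V : Opens E4} {g : E4 → Tensor2 ℝ} (hg : ∀ y ∈ V, (g y)ᵀ = g y)
    {y : E4} (hy : y ∈ V) (k i j : Fin 4) : christoffel g k i j y = christoffel g k j i y := by
  unfold christoffel
  congr 1
  refine Finset.sum_congr rfl fun l _ => ?_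
  rw [pd_congr (f := fun z => g z i j) (f' := fun z => g z j i)
    (fun z hz => congrFun (congrFun (hg z hz) j) i) l hy]
  ring

lemma lowered_christoffel {g : E4 → Tensor2 ℝ} {y : E4} (h : IsUnit (g y).det) (k i j : Fin 4) :
    ∑ l, g y k l * christoffel g l i j y =
      1 / 2 * (pd i (fun z => g z j k) y + pd j (fun z => g z i k) y
        - pd k (fun z => g z i j) y) := by
  have h1 := Matrix.mul_nonsing_inv _ h
  have : (fun l => christoffel g l i j y) = (g y)⁻¹ *ᵥ fun k => 1 / 2 *
      (pd i (fun z => g z j k) y + pd j (fun z => g z i k) y - pd k (fun z => g z i j) y) := by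
    ext l
    simp only [christoffel, Matrix.mulVec, dotProduct, Finset.mul_sum]
    exact Finset.sum_congr rfl fun k _ => by ring
  change (g y *ᵥ fun l => christoffel g l i j y) k = _
  rw [this, Matrix.mulVec_mulVec, h1, Matrix.one_mulVec]

/-- The Levi-Civita connection is metric. -/
lemma christoffel_compat {V : Opens E4} {g : E4 → Tensor2 ℝ} (hg : ∀ y ∈ V, (g y)ᵀ = g y)
    (hd : ∀ y ∈ V, IsUnit (g y).det) {y : E4} (hy : y ∈ V) (i j k : Fin 4) :
    pd i (fun z => g z j k) y =
      ∑ l, christoffel g l i j y * g y l k + ∑ l, g y j l * christoffel g l i k y := by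
  have e : ∑ l, christoffel g l i j y * g y l k = ∑ l, g y k l * christoffel g l i j y :=
    Finset.sum_congr rfl fun l _ => by
      rw [mul_comm, ← congrFun (congrFun (hg y hy) l) k, Matrix.transpose_apply]
  have s (i j k : Fin 4) := pd_congr (f := fun z => g z i j) (f' := fun z => g z j i)
    (fun z hz => congrFun (congrFun (hg z hz) j) i) k hy
  rw [e, lowered_christoffel (hd y hy), lowered_christoffel (hd y hy), s k j]
  ring

end SmoothFields

/-! ### Evaluation of smooth functions at points -/

section Evaluation

open TopologicalSpace

variable {V : Opens E4}

/-- The value of a smooth function at a point. -/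
def evalHom (y : V) : smoothAlg V →+* ℂ :=
  (Pi.evalRingHom (fun _ : V => ℂ) y).comp (smoothAlg V).subtype.toRingHom

lemma evalHom_apply (y : V) (f : smoothAlg V) : evalHom y f = f.1 y := rfl

lemma ext_evalHom {f f' : smoothAlg V} (h : ∀ y, evalHom y f = evalHom y f') : f = f' :=
  Subtype.ext (funext h)

lemma evalHom_star (y : V) (f : smoothAlg V) : evalHom y (star f) = star (evalHom y f) := rfl

lemma evalHom_ofRealFun (y : V) (F : E4 → ℝ) (hF : ContDiffOn ℝ ∞ F V) :
    evalHom y (ofRealFun F hF) = (F y : ℂ) := rfl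

lemma evalHom_imUnit (y : V) : evalHom y (imUnit (smoothAlg V)) = Complex.I := rfl

lemma evalHom_half (y : V) : evalHom y (half (smoothAlg V)) = 1 / 2 := rfl

lemma evalHom_typeDTensor (y : V) (w : smoothAlg V) (a b c d : Fin 4) :
    evalHom y (typeDTensor (smoothAlg V) w a b c d) = typeDTensor ℂ (evalHom y w) a b c d := by
  simp only [typeDTensor, map_mul, map_add, map_sub, map_intCast, evalHom_imUnit, map_ofNat]
  rfl

lemma isUnit_of_evalHom_ne_zero {f : smoothAlg V} (h : ∀ y, evalHom y f ≠ 0) : IsUnit f := by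
  have hi : ContDiffOn ℝ ∞ (extZero fun y => (f.1 y)⁻¹) V :=
    contDiffOn_extZero (F := fun y => (extZero f.1 y)⁻¹)
      (f.2.inv fun y hy => by rw [extZero_of_mem _ hy]; exact h ⟨y, hy⟩)
      fun y => by rw [extZero_coe]
  refine IsUnit.of_mul_eq_one ⟨fun y => (f.1 y)⁻¹, hi⟩ (ext_evalHom fun y => ?_)
  rw [map_mul, map_one]
  exact mul_inv_cancel₀ (h y)

/-- A smooth field of real matrices as a matrix over the algebra of smooth functions. -/
def matOf (A : E4 → Tensor2 ℝ) (hA : SmoothOn V A) : Tensor2 (smoothAlg V) :=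
  fun i j => ofRealFun (fun y => A y i j) (hA i j)

lemma map_matOf (A : E4 → Tensor2 ℝ) (hA : SmoothOn V A) (y : V) :
    (matOf A hA).map (evalHom y) = toC (A y) := rfl

end Evaluation

/-! ### The Levi-Civita connection over the algebra of smooth functions -/

section LeviCivitaConnection

open TopologicalSpace Matrix

/-- A smooth field of non-degenerate symmetric matrices. -/
structure IsMetricOn (V : Set E4) (g : E4 → Tensor2 ℝ) : Prop where
  smooth : SmoothOn V g
  symm : ∀ y ∈ V, (g y)ᵀ = g y
  isUnit_det : ∀ y ∈ V, IsUnit (g y).det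

namespace IsMetricOn

variable {V : Opens E4} {g : E4 → Tensor2 ℝ} (h : IsMetricOn V g)
include h

lemma smooth_inv : SmoothOn V fun y => (g y)⁻¹ := h.smooth.inv h.isUnit_det

lemma smooth_christoffel (k i j : Fin 4) : ContDiffOn ℝ ∞ (christoffel g k i j) V :=
  contDiffOn_christoffel h.smooth h.smooth_inv k i j

/-- The matrices of the Levi-Civita connection in coordinates. -/
def gammaMat (i : Fin 4) : Tensor2 (smoothAlg V) :=
  fun k j => ofRealFun (christoffel g k j i) (h.smooth_christoffel k j i)

lemma evalHom_curvMat (i j a b : Fin 4) (y : V) :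
    evalHom y (curvMat (pdDer V) h.gammaMat i j a b) = (riemannUp g a b i j y : ℂ) := by
  have hs (k i j : Fin 4) := christoffel_symm h.symm y.2 k i j
  simp only [curvMat, Matrix.add_apply, Matrix.sub_apply, dMat, Matrix.map_apply, gammaMat,
    pdDer_ofRealFun, map_add, map_sub, evalHom_ofRealFun, Matrix.mul_apply, map_sum, map_mul,
    riemannUp]
  push_cast
  rw [Finset.sum_sub_distrib]
  -- `gammaMat` has the derivative index last, `riemannUp` has it first; the symmetry of the
  -- Christoffel symbols reconciles the two.
  have e (p q : Fin 4) : ∑ k, (christoffel g a k p y : ℂ) * (christoffel g k b q y : ℂ) =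
      ∑ k, (christoffel g a p k y : ℂ) * (christoffel g k b q y : ℂ) :=
    Finset.sum_congr rfl fun k _ => by rw [hs a k p]
  rw [e, e]

lemma map_curvMat (i j : Fin 4) (y : V) :
    (curvMat (pdDer V) h.gammaMat i j).map (evalHom y) =
      toC (Matrix.of fun k l => riemannUp g k l i j y) := by
  ext k l; exact h.evalHom_curvMat i j k l y

lemma matOf_symm : (matOf g h.smooth)ᵀ = matOf g h.smooth :=
  Matrix.ext fun i j => ext_evalHom fun y => by
    change ((g y j i : ℝ) : ℂ) = (g y i j : ℝ)
    rw [← congrFun (congrFun (h.symm y y.2) i) j, Matrix.transpose_apply]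

lemma gammaMat_symm (i j k : Fin 4) : h.gammaMat i k j = h.gammaMat j k i :=
  ext_evalHom fun y => by
    simp only [gammaMat, evalHom_ofRealFun]
    rw [christoffel_symm h.symm y.2]

lemma gammaMat_compat (i : Fin 4) : dMat (pdDer V i) (matOf g h.smooth) =
    (h.gammaMat i)ᵀ * matOf g h.smooth + matOf g h.smooth * h.gammaMat i :=
  Matrix.ext fun j k => ext_evalHom fun y => by
    simp only [dMat, Matrix.map_apply, matOf, pdDer_ofRealFun, Matrix.add_apply, Matrix.mul_apply,
      Matrix.transpose_apply, gammaMat, map_add, map_sum, map_mul, evalHom_ofRealFun]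
    have hs := christoffel_symm h.symm y.2
    rw [christoffel_compat h.symm h.isUnit_det y.2]
    push_cast
    simp only [hs _ i]

end IsMetricOn

end LeviCivitaConnection

/-! ### Type D vacuum metrics on open sets of coordinates and their frames -/

section TypeDChart

open TopologicalSpace Matrix CoordFrame

/-- A vacuum metric with its volume element and a canonical bivector on an open set of
coordinates. -/
structure IsTypeDOn (V : Set E4) (g : E4 → Tensor2 ℝ) (η : E4 → Tensor4 ℝ)
    (U : E4 → Tensor2 ℝ) : Prop where
  smooth_g : SmoothOn V g
  smooth_η : ∀ a b c d, ContDiffOn ℝ ∞ (fun y => η y a b c d) V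
  smooth_U : SmoothOn V U
  lorentz : ∀ y ∈ V, IsLorentzVol (g y) (η y)
  vacuum : ∀ y ∈ V, ricci g y = 0
  canonical : ∀ y ∈ V, ∃ w, IsCanonicalForm (g y) (η y) (weyl g y) w (U y)

lemma IsTypeDOn.mono {V V' : Set E4} {g : E4 → Tensor2 ℝ} {η : E4 → Tensor4 ℝ}
    {U : E4 → Tensor2 ℝ} (h : IsTypeDOn V g η U) (hV : V' ⊆ V) : IsTypeDOn V' g η U where
  smooth_g := h.smooth_g.mono hV
  smooth_η a b c d := (h.smooth_η a b c d).mono hV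
  smooth_U := h.smooth_U.mono hV
  lorentz y hy := h.lorentz y (hV hy)
  vacuum y hy := h.vacuum y (hV hy)
  canonical y hy := h.canonical y (hV hy)

/-- In vacuum the canonical form of the Weyl tensor describes the whole curvature of the connection.
For the same reason only the naturality of the Riemann tensor is needed under changes of charts. -/
lemma weyl_eq_riemann {g : E4 → Tensor2 ℝ} {y : E4} (h : ricci g y = 0) :
    weyl g y = riemann g y := by
  ext a b c d
  simp [weyl, scalarCurv, h]

/-- The data of `IsTypeDOn` on an open set on which a vector `X` has a time-like component in the
time-like principal plane, and a vector `Y` has a non-zero component in the other one. -/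
structure IsFramedOn (V : Opens E4) (g : E4 → Tensor2 ℝ) (η : E4 → Tensor4 ℝ)
    (U : E4 → Tensor2 ℝ) (X Y : Fin 4 → ℝ) : Prop extends IsTypeDOn V g η U where
  time_neg : ∀ y ∈ V, X ⬝ᵥ (vProj (g y) (U y) *ᵥ X) < 0
  space_pos : ∀ y ∈ V, 0 < Y ⬝ᵥ (hProj (g y) (U y) *ᵥ Y)

variable {V : Opens E4} {g : E4 → Tensor2 ℝ} {η : E4 → Tensor4 ℝ} {U : E4 → Tensor2 ℝ}

lemma IsTypeDOn.isMetricOn {V : Set E4} (h : IsTypeDOn V g η U) : IsMetricOn V g :=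
  ⟨h.smooth_g, fun y hy => (h.lorentz y hy).symm, fun y hy => (h.lorentz y hy).isUnit_det⟩

lemma IsTypeDOn.smooth_inv {V : Set E4} (h : IsTypeDOn V g η U) : SmoothOn V fun y => (g y)⁻¹ :=
  h.smooth_g.inv fun y hy => (h.lorentz y hy).isUnit_det

lemma IsTypeDOn.smooth_dual {V : Set E4} (h : IsTypeDOn V g η U) :
    SmoothOn V (hodgeField g η U) :=
  SmoothOn.hodge h.smooth_inv h.smooth_η h.smooth_U

lemma IsTypeDOn.smooth_vProj {V : Set E4} (h : IsTypeDOn V g η U) :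
    SmoothOn V fun y => vProj (g y) (U y) :=
  (h.smooth_U.mul h.smooth_inv).mul h.smooth_U

lemma IsTypeDOn.smooth_hProj {V : Set E4} (h : IsTypeDOn V g η U) :
    SmoothOn V fun y => hProj (g y) (U y) :=
  h.smooth_g.sub h.smooth_vProj

lemma IsTypeDOn.pair {V : Set E4} (h : IsTypeDOn V g η U) {y : E4} (hy : y ∈ V) :
    IsBivectorPair (g y) (U y) (hodgeField g η U y) := by
  obtain ⟨w, hw⟩ := h.canonical y hy
  exact hw.isBivectorPair (h.lorentz y hy)

/-- Near each of its points an open set as in `IsTypeDOn` carries an adapted frame. -/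
lemma IsTypeDOn.exists_framed {V : Set E4} (hV : IsOpen V) (h : IsTypeDOn V g η U) {y : E4}
    (hy : y ∈ V) : ∃ (B : Opens E4) (X Y : Fin 4 → ℝ), y ∈ B ∧ (B : Set E4) ⊆ V ∧
      Convex ℝ (B : Set E4) ∧ IsFramedOn B g η U X Y := by
  obtain ⟨w, hw⟩ := h.canonical y hy
  obtain ⟨⟨X, hX⟩, Y, hY⟩ := hw.exists_vectors (h.lorentz y hy)
  have cX := ((h.smooth_vProj.quadratic X).continuousOn.continuousAt (hV.mem_nhds hy)).eventually
    (gt_mem_nhds hX)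
  have cY := ((h.smooth_hProj.quadratic Y).continuousOn.continuousAt (hV.mem_nhds hy)).eventually
    (lt_mem_nhds hY)
  -- The constant vectors `X`, `Y` found at `y` keep their strict inequalities nearby by continuity;
  -- a ball is taken because the uniqueness argument needs a convex set.
  obtain ⟨ε, hε, hB⟩ := Metric.mem_nhds_iff.mp (Filter.inter_mem (hV.mem_nhds hy)
    (Filter.inter_mem cX cY))
  refine ⟨⟨Metric.ball y ε, Metric.isOpen_ball⟩, X, Y, Metric.mem_ball_self hε,
    fun z hz => (hB hz).1, convex_ball y ε, ⟨h.mono fun z hz => (hB hz).1, fun z hz =>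
      (hB hz).2.1, fun z hz => (hB hz).2.2⟩⟩

namespace IsFramedOn

variable {X Y : Fin 4 → ℝ} (h : IsFramedOn V g η U X Y)
include h

/-- The adapted frame. -/
def frame (_ : IsFramedOn V g η U X Y) (y : E4) : Tensor2 ℝ :=
  adaptedFrame (g y) (U y) (hodgeField g η U y) X Y

lemma frame_spec {y : E4} (hy : y ∈ V) :
    pull2 (h.frame y) (g y) = minkMat ℝ ∧
      pull2 (h.frame y) (U y) = biv01.map (Int.cast : ℤ → ℝ) ∧
      pull2 (h.frame y) (hodgeField g η U y) = biv23.map (Int.cast : ℤ → ℝ) :=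
  (h.pair hy).pull2_adaptedFrame (h.time_neg y hy) (h.space_pos y hy)

lemma smooth_frame : SmoothOn V h.frame := by
  have hv := h.smooth_vProj
  have hh := h.smooth_hProj
  have ht : ∀ i, ContDiffOn ℝ ∞ (fun y => timeVec (g y) (U y) X i) V := fun i => by
    unfold timeVec
    refine ContDiffOn.smul (ContDiffOn.inv (ContDiffOn.sqrt (hv.quadratic X).neg ?_) ?_)
      ((h.smooth_inv.mul hv).mulVec (x := fun _ => X) (fun _ => contDiffOn_const) i)
    · exact fun y hy => (neg_pos.mpr (h.time_neg y hy)).ne'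
    · exact fun y hy => (Real.sqrt_pos.mpr (neg_pos.mpr (h.time_neg y hy))).ne'
  have hs : ∀ i, ContDiffOn ℝ ∞ (fun y => spaceVec (g y) (U y) Y i) V := fun i => by
    unfold spaceVec
    refine ContDiffOn.smul (ContDiffOn.inv (ContDiffOn.sqrt (hh.quadratic Y) ?_) ?_)
      ((h.smooth_inv.mul hh).mulVec (x := fun _ => Y) (fun _ => contDiffOn_const) i)
    · exact fun y hy => (h.space_pos y hy).ne'
    · exact fun y hy => (Real.sqrt_pos.mpr (h.space_pos y hy)).ne'
  intro i a
  fin_cases a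
  · exact ht i
  · exact ((h.smooth_inv.mul h.smooth_U).mulVec ht i).neg
  · exact hs i
  · exact ((h.smooth_inv.mul h.smooth_dual).mulVec hs i).neg

/-- The components of the curvature tensor in the adapted frame. -/
def curvComp (a b c d : Fin 4) : smoothAlg V :=
  ∑ i, ∑ j, matOf h.frame h.smooth_frame i c * matOf h.frame h.smooth_frame j d *
    ((matOf h.frame h.smooth_frame)ᵀ * matOf g h.smooth_g * curvMat (pdDer V) h.isMetricOn.gammaMat i j *
      matOf h.frame h.smooth_frame) a b

lemma evalHom_curvComp (a b c d : Fin 4) (y : V) :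
    evalHom y (h.curvComp a b c d) =
      ((pull4 (h.frame y) (weyl g y) a b c d : ℝ) : ℂ) := by
  rw [weyl_eq_riemann (h.vacuum y y.2)]
  have key (i j : Fin 4) : evalHom y (((matOf h.frame h.smooth_frame)ᵀ * matOf g h.smooth_g *
      curvMat (pdDer V) h.isMetricOn.gammaMat i j * matOf h.frame h.smooth_frame) a b) =
      ((pull2 (h.frame y) (Matrix.of fun k l => riemann g y k l i j) a b : ℝ) : ℂ) := by
    have hR := h.isMetricOn.map_curvMat i j y
    have hr : (Matrix.of fun k l => riemann g y k l i j) =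
        g y * Matrix.of fun k l => riemannUp g k l i j y := by
      ext k l; rfl
    rw [← Matrix.map_apply (f := evalHom y), Matrix.map_mul, Matrix.map_mul, Matrix.map_mul, hR,
      Matrix.transpose_map, map_matOf, map_matOf, ← toC_transpose, ← toC_mul, ← toC_mul,
      ← toC_mul, hr, pull2, toC_apply]
    simp only [Matrix.mul_assoc]
  simp only [curvComp, map_sum, map_mul, key, matOf, evalHom_ofRealFun, pull2_apply, pull4]
  rw [sum4_comm_prod]
  push_cast
  refine Finset.sum_congr rfl fun i _ => Finset.sum_congr rfl fun j _ => ?_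
  simp only [Finset.mul_sum, Matrix.of_apply]
  exact Finset.sum_congr rfl fun k _ => Finset.sum_congr rfl fun l _ => by ring

/-- The eigenvalue of the Weyl tensor. -/
def eigen : smoothAlg V :=
  half (smoothAlg V) * (h.curvComp 0 1 0 1 + imUnit (smoothAlg V) * h.curvComp 0 1 2 3)

/-- The eigenvalue is given only point by point. Its expression by two curvature components shows
that it is a smooth function, and its uniqueness that `U'` may be any canonical bivector at `y`. -/
lemma evalHom_eigen {y : V} {w : ℂ} {U' : Tensor2 ℝ}
    (hw : IsCanonicalForm (g y) (η y) (weyl g y) w U') : evalHom y h.eigen = w := by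
  obtain ⟨w', hw'⟩ := h.canonical y y.2
  rw [← hw'.eigenvalue_unique (h.lorentz y y.2) hw]
  obtain ⟨h1, h2, h3⟩ := h.frame_spec y.2
  rw [hw'.eigenvalue_eq (h.lorentz y y.2) h1 h2 h3]
  simp only [eigen, map_mul, map_add, evalHom_half, evalHom_imUnit, evalHom_curvComp]

lemma isUnit_eigen : IsUnit h.eigen := isUnit_of_evalHom_ne_zero fun y => by
  obtain ⟨w, hw⟩ := h.canonical y y.2
  rw [h.evalHom_eigen hw]
  exact hw.ne_zero

lemma frame_ortho : (matOf h.frame h.smooth_frame)ᵀ * matOf g h.smooth_g *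
    matOf h.frame h.smooth_frame = Matrix.diagonal fun a => (mink a : smoothAlg V) :=
  Matrix.ext fun a b => ext_evalHom fun y => by
    rw [← Matrix.map_apply (f := evalHom y), Matrix.map_mul, Matrix.map_mul, Matrix.transpose_map,
      map_matOf, map_matOf, ← toC_transpose, ← toC_mul, ← toC_mul]
    have := congrFun (congrFun (congrArg toC (h.frame_spec y.2).1) a) b
    rw [toC_minkMat] at this
    refine this.trans ?_
    simp only [minkMat, Matrix.diagonal_apply]
    split_ifs <;> simp

lemma two_mul_curvComp (a b c d : Fin 4) : 2 * h.curvComp a b c d =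
    typeDTensor (smoothAlg V) h.eigen a b c d +
      star (typeDTensor (smoothAlg V) h.eigen a b c d) := by
  refine ext_evalHom fun y => ?_
  obtain ⟨w, hw⟩ := h.canonical y y.2
  obtain ⟨h1, h2, h3⟩ := h.frame_spec y.2
  have := hw.two_mul_pull4 (h.lorentz y y.2) h1 h2 h3 a b c d
  rw [map_add, evalHom_star, evalHom_typeDTensor, h.evalHom_eigen hw, ← this, map_mul, map_ofNat,
    h.evalHom_curvComp]

/-- The adapted frame as a frame over the algebra of smooth functions. -/
def coordFrame : CoordFrame (smoothAlg V) where
  D := pdDer V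
  x := coordFun V
  D_comm := pdDer_comm
  D_x := pdDer_coordFun
  star_D := star_pdDer
  g := matOf g h.smooth_g
  Γ := h.isMetricOn.gammaMat
  E := matOf h.frame h.smooth_frame
  w := h.eigen
  isUnit_w := h.isUnit_eigen
  star_g _ _ := star_ofRealFun _ _
  star_Γ _ _ _ := star_ofRealFun _ _
  star_E _ _ := star_ofRealFun _ _
  g_symm := h.isMetricOn.matOf_symm
  Γ_symm := h.isMetricOn.gammaMat_symm
  compat := h.isMetricOn.gammaMat_compat
  ortho := h.frame_ortho
  curvature a b c d := by rw [← h.two_mul_curvComp, curvComp]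

end IsFramedOn

end TypeDChart

/-! ### Interior products and projectors in an adapted frame -/

section Concomitants

open Matrix CoordFrame

variable {g E : Tensor2 ℝ}

lemma inv_eq_of_ortho (hE : pull2 E g = minkMat ℝ) : g⁻¹ = E * minkMat ℝ * Eᵀ := by
  rw [← inv_pull2 g (isUnit_det_of_pull2 hE), hE, minkMat_inv]

lemma raise_eq (g : Tensor2 ℝ) (X : Fin 4 → ℝ) : raise g X = g⁻¹ *ᵥ X := rfl

/-- `Eᵀ *ᵥ X` lists the components of the covector `X` in the frame given by the columns of `E`; in
them every contraction uses the Minkowski metric. -/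
lemma transpose_mulVec_interior (hE : pull2 E g = minkMat ℝ) (X : Fin 4 → ℝ) (F : Tensor2 ℝ) :
    Eᵀ *ᵥ interior g X F = (pull2 E F)ᵀ *ᵥ (minkMat ℝ *ᵥ (Eᵀ *ᵥ X)) := by
  have : interior g X F = Fᵀ *ᵥ (g⁻¹ *ᵥ X) := by
    ext b
    simp only [interior, raise_eq, Matrix.mulVec, dotProduct, Matrix.transpose_apply]
    exact Finset.sum_congr rfl fun a _ => mul_comm _ _
  rw [this, inv_eq_of_ortho hE]
  simp only [Matrix.mulVec_mulVec, pull2, Matrix.transpose_mul, Matrix.transpose_transpose,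
    Matrix.mul_assoc]

lemma transpose_mulVec_act (hE : pull2 E g = minkMat ℝ) (X : Fin 4 → ℝ) (A : Tensor2 ℝ) :
    Eᵀ *ᵥ act g A X = pull2 E A *ᵥ (minkMat ℝ *ᵥ (Eᵀ *ᵥ X)) := by
  have : act g A X = A *ᵥ (g⁻¹ *ᵥ X) := rfl
  rw [this, inv_eq_of_ortho hE]
  simp only [Matrix.mulVec_mulVec, pull2, Matrix.mul_assoc]

lemma transpose_mulVec_eq_zero (hE : pull2 E g = minkMat ℝ) (X : Fin 4 → ℝ) :
    Eᵀ *ᵥ X = 0 ↔ X = 0 := by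
  refine ⟨fun h => ?_, fun h => by rw [h, Matrix.mulVec_zero]⟩
  have h1 : (Eᵀ)⁻¹ * Eᵀ = 1 :=
    Matrix.nonsing_inv_mul _ (by rw [Matrix.det_transpose]; exact isUnit_det_of_pull2 hE)
  rw [← Matrix.one_mulVec X, ← h1, ← Matrix.mulVec_mulVec, h, Matrix.mulVec_zero]

lemma minkMat_mulVec (p : Fin 4 → ℝ) : minkMat ℝ *ᵥ p = ![-p 0, p 1, p 2, p 3] := by
  ext a
  rw [minkMat_eq]
  fin_cases a <;> simp [Matrix.mulVec, dotProduct, Fin.sum_univ_four]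

variable {U S : Tensor2 ℝ} (hE : pull2 E g = minkMat ℝ)
  (hU : pull2 E U = biv01.map (Int.cast : ℤ → ℝ)) (hS : pull2 E S = biv23.map (Int.cast : ℤ → ℝ))

include hE in
lemma pull2_vProj (hU : pull2 E U = biv01.map (Int.cast : ℤ → ℝ)) : pull2 E (vProj g U) =
    !![-1, 0, 0, 0; 0, 1, 0, 0; 0, 0, 0, 0; 0, 0, 0, 0] := by
  rw [vProj, ← tprod_pull g U U (isUnit_det_of_pull2 hE), hU, hE, tprod, minkMat_inv]
  ext a b
  rw [mul_mink_mul_apply]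
  fin_cases a <;> fin_cases b <;> simp [biv01]

include hE in
lemma pull2_hProj (hU : pull2 E U = biv01.map (Int.cast : ℤ → ℝ)) : pull2 E (hProj g U) =
    !![0, 0, 0, 0; 0, 0, 0, 0; 0, 0, 1, 0; 0, 0, 0, 1] := by
  rw [hProj, pull2_sub, pull2_vProj hE hU, hE, minkMat_eq]
  ext a b
  fin_cases a <;> fin_cases b <;> simp

include hE hU in
lemma act_vProj_eq_zero (X : Fin 4 → ℝ) :
    act g (vProj g U) X = 0 ↔ (Eᵀ *ᵥ X) 0 = 0 ∧ (Eᵀ *ᵥ X) 1 = 0 := by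
  rw [← transpose_mulVec_eq_zero hE, transpose_mulVec_act hE, pull2_vProj hE hU, minkMat_mulVec]
  generalize Eᵀ *ᵥ X = p
  rw [funext_iff]
  simp [Fin.forall_fin_succ, Matrix.mulVec, dotProduct, Fin.sum_univ_four]

include hE hU in
lemma act_hProj_eq_zero (X : Fin 4 → ℝ) :
    act g (hProj g U) X = 0 ↔ (Eᵀ *ᵥ X) 2 = 0 ∧ (Eᵀ *ᵥ X) 3 = 0 := by
  rw [← transpose_mulVec_eq_zero hE, transpose_mulVec_act hE, pull2_hProj hE hU, minkMat_mulVec]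
  generalize Eᵀ *ᵥ X = p
  rw [funext_iff]
  simp [Fin.forall_fin_succ, Matrix.mulVec, dotProduct, Fin.sum_univ_four]

include hE hU in
lemma transpose_mulVec_interior_left (X : Fin 4 → ℝ) : Eᵀ *ᵥ interior g X U =
    ![-(Eᵀ *ᵥ X) 1, -(Eᵀ *ᵥ X) 0, 0, 0] := by
  rw [transpose_mulVec_interior hE, hU, minkMat_mulVec]
  generalize Eᵀ *ᵥ X = p
  ext a
  fin_cases a <;> simp [biv01, Matrix.mulVec, dotProduct, Fin.sum_univ_four]

include hE hS in
lemma transpose_mulVec_interior_right (X : Fin 4 → ℝ) : Eᵀ *ᵥ interior g X S =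
    ![0, 0, -(Eᵀ *ᵥ X) 3, (Eᵀ *ᵥ X) 2] := by
  rw [transpose_mulVec_interior hE, hS, minkMat_mulVec]
  generalize Eᵀ *ᵥ X = p
  ext a
  fin_cases a <;> simp [biv23, Matrix.mulVec, dotProduct, Fin.sum_univ_four]

end Concomitants

/-! ### The concomitants in terms of $\delta U$ and $\delta{*U}$ -/

section ConcomitantFields

open Matrix CoordFrame TopologicalSpace

variable {V : Opens E4} {g : E4 → Tensor2 ℝ} {η : E4 → Tensor4 ℝ} {U : E4 → Tensor2 ℝ}
  {X Y : Fin 4 → ℝ}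

namespace IsFramedOn

variable (h : IsFramedOn V g η U X Y)
include h

/-- The components of the codifferential of `U` in the adapted frame. -/
def divU (y : E4) : Fin 4 → ℝ := (h.frame y)ᵀ *ᵥ codiff g U y

/-- The components of the codifferential of `*U` in the adapted frame. -/
def divS (y : E4) : Fin 4 → ℝ := (h.frame y)ᵀ *ᵥ codiff g (hodgeField g η U) y

/-- $U=e^0\wedge e^1$ acts only on the time-like plane and $*U=e^2\wedge e^3$ only on the space-like
one. So $v(\Phi)$ and $h(\Psi)$ depend on $\delta U$ alone, and $h(\Phi)$ and $v(\Psi)$ on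
$\delta{*U}$ alone. -/
lemma frame_mulVec_Phi {y : E4} (hy : y ∈ V) : (h.frame y)ᵀ *ᵥ Phi g η U y =
    ![-h.divU y 1, -h.divU y 0, h.divS y 3, -h.divS y 2] := by
  obtain ⟨h1, h2, h3⟩ := h.frame_spec hy
  have : Phi g η U y = interior (g y) (codiff g U y) (U y) -
    interior (g y) (codiff g (hodgeField g η U) y) (hodgeField g η U y) := rfl
  rw [this, Matrix.mulVec_sub, transpose_mulVec_interior_left h1 h2,
    transpose_mulVec_interior_right h1 h3]
  ext a
  fin_cases a <;> simp [divU, divS]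

lemma frame_mulVec_Psi {y : E4} (hy : y ∈ V) : (h.frame y)ᵀ *ᵥ Psi g η U y =
    ![h.divS y 1, h.divS y 0, h.divU y 3, -h.divU y 2] := by
  obtain ⟨h1, h2, h3⟩ := h.frame_spec hy
  have : Psi g η U y = -interior (g y) (codiff g U y) (hodgeField g η U y) -
    interior (g y) (codiff g (hodgeField g η U) y) (U y) := rfl
  rw [this, Matrix.mulVec_sub, Matrix.mulVec_neg, transpose_mulVec_interior_left h1 h2,
    transpose_mulVec_interior_right h1 h3]
  ext a
  fin_cases a <;> simp [divU, divS]

lemma vPhi_eq_zero {y : E4} (hy : y ∈ V) :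
    vPhi g η U y = 0 ↔ h.divU y 0 = 0 ∧ h.divU y 1 = 0 := by
  obtain ⟨h1, h2, h3⟩ := h.frame_spec hy
  rw [vPhi, act_vProj_eq_zero h1 h2, h.frame_mulVec_Phi hy]
  simp [and_comm]

lemma hPhi_eq_zero {y : E4} (hy : y ∈ V) :
    hPhi g η U y = 0 ↔ h.divS y 2 = 0 ∧ h.divS y 3 = 0 := by
  obtain ⟨h1, h2, h3⟩ := h.frame_spec hy
  rw [hPhi, act_hProj_eq_zero h1 h2, h.frame_mulVec_Phi hy]
  simp [and_comm]

lemma vPsi_eq_zero {y : E4} (hy : y ∈ V) :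
    vPsi g η U y = 0 ↔ h.divS y 0 = 0 ∧ h.divS y 1 = 0 := by
  obtain ⟨h1, h2, h3⟩ := h.frame_spec hy
  rw [vPsi, act_vProj_eq_zero h1 h2, h.frame_mulVec_Psi hy]
  simp [and_comm]

lemma hPsi_eq_zero {y : E4} (hy : y ∈ V) :
    hPsi g η U y = 0 ↔ h.divU y 2 = 0 ∧ h.divU y 3 = 0 := by
  obtain ⟨h1, h2, h3⟩ := h.frame_spec hy
  rw [hPsi, act_hProj_eq_zero h1 h2, h.frame_mulVec_Psi hy]
  simp [and_comm]

end IsFramedOn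

end ConcomitantFields

/-! ### Covariant derivatives of tensors with constant frame components -/

namespace CoordFrame

open Matrix

variable {R : Type} [CommRing R] [Algebra ℂ R] [StarRing R] (C : CoordFrame R)

/-- The covariant derivative of a covariant 2-tensor. -/
def nabla (A : Tensor2 R) (i : Fin 4) : Tensor2 R :=
  dMat (C.D i) A - (C.Γ i)ᵀ * A - A * C.Γ i

/-- The covariant derivative of a tensor whose components in the frame are constant. -/
lemma nabla_frame {A : Tensor2 R} {u : Tensor2 ℤ}
    (h : C.Eᵀ * A * C.E = u.map (Int.cast : ℤ → R)) (i : Fin 4) :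
    C.Eᵀ * C.nabla A i * C.E = C.conn i * minkMat R * u.map (Int.cast : ℤ → R) -
      u.map (Int.cast : ℤ → R) * minkMat R * C.conn i := by
  have h0 : dMat (C.D i) (C.Eᵀ * A * C.E) = 0 := by
    rw [h]; ext a b
    exact (C.D i).map_intCast _
  have h1 := C.E_conn i
  have h2 := congrArg Matrix.transpose h1
  have hm : (minkMat R)ᵀ = minkMat R := Matrix.diagonal_transpose _
  simp only [Matrix.transpose_mul, Matrix.transpose_add, C.conn_antisymm, hm] at h2
  have e1 : dMat (C.D i) C.E = C.E * (minkMat R * C.conn i) - C.Γ i * C.E := by rw [h1]; abel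
  have e2 : dMat (C.D i) C.Eᵀ = -C.conn i * minkMat R * C.Eᵀ - C.Eᵀ * (C.Γ i)ᵀ := by
    rw [h2, dMat_transpose]; abel
  rw [dMat_mul, dMat_mul, e1, e2] at h0
  have e3 : C.Eᵀ * C.nabla A i * C.E =
      C.conn i * minkMat R * (C.Eᵀ * A * C.E) - (C.Eᵀ * A * C.E) * minkMat R * C.conn i +
      ((-C.conn i * minkMat R * C.Eᵀ - C.Eᵀ * (C.Γ i)ᵀ) * A * C.E + C.Eᵀ * dMat (C.D i) A * C.E +
        C.Eᵀ * A * (C.E * (minkMat R * C.conn i) - C.Γ i * C.E)) := by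
    rw [nabla]; noncomm_ring
  rw [e3, h]
  have h4 : ((-C.conn i * minkMat R * C.Eᵀ - C.Eᵀ * (C.Γ i)ᵀ) * A * C.E +
      C.Eᵀ * dMat (C.D i) A * C.E +
        C.Eᵀ * A * (C.E * (minkMat R * C.conn i) - C.Γ i * C.E)) = 0 := by
    rw [← h0]; noncomm_ring
  rw [h4, add_zero]

/-- The connection coefficients in the frame. -/
def coeff (a b c : Fin 4) : R := ∑ i, C.E i c * C.conn i a b

lemma toOrthoFrame_θ (a b c : Fin 4) :
    C.toOrthoFrame.θ a b (C.toOrthoFrame.e c) = C.coeff a b c := by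
  change formOf C.x _ (fieldOf C.D _) = _
  rw [formOf_fieldOf C.D_x]
  exact Finset.sum_congr rfl fun i _ => mul_comm _ _

lemma star_coeff (a b c : Fin 4) : star (C.coeff a b c) = C.coeff a b c := by
  rw [← toOrthoFrame_θ, C.toOrthoFrame.star_θ]

lemma coeff_antisymm (a b c : Fin 4) : C.coeff a b c = -C.coeff b a c := by
  rw [← toOrthoFrame_θ, ← toOrthoFrame_θ, C.toOrthoFrame.θ_antisymm a b]
  rfl

lemma sum_nabla_frame {A : Tensor2 R} {u : Tensor2 ℤ}
    (h : C.Eᵀ * A * C.E = u.map (Int.cast : ℤ → R)) (a b : Fin 4) :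
    ∑ i, C.E i a * (C.Eᵀ * C.nabla A i * C.E) a b =
      ∑ m, (mink m : R) * (C.coeff a m a * (u m b : R) - (u a m : R) * C.coeff m b a) := by
  have key (B : Tensor2 R) (G : Tensor2 R) (a b : Fin 4) : (B * minkMat R * G) a b =
      ∑ m, (mink m : R) * (B a m * G m b) := by
    rw [Matrix.mul_apply]
    refine Finset.sum_congr rfl fun m _ => ?_
    rw [minkMat, Matrix.mul_diagonal]; ring
  simp only [C.nabla_frame h, Matrix.sub_apply, key, Matrix.map_apply, coeff,
    ← Finset.sum_sub_distrib, Finset.mul_sum, Finset.sum_mul]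
  rw [Finset.sum_comm]
  exact Finset.sum_congr rfl fun m _ => Finset.sum_congr rfl fun i _ => by ring

end CoordFrame

/-! ### The codifferentials in terms of connection coefficients -/

section Divergence

open Matrix CoordFrame TopologicalSpace

lemma transpose_mulVec_codiff {g A : E4 → Tensor2 ℝ} {y : E4} {E : Tensor2 ℝ}
    (hE : pull2 E (g y) = minkMat ℝ) (b : Fin 4) : (Eᵀ *ᵥ codiff g A y) b =
      -∑ a, (mink a : ℝ) * ∑ i, E i a * pull2 E (Matrix.of fun k l => covDeriv g A i k l y) a b := by
  have hi (c a : Fin 4) : (g y)⁻¹ c a = ∑ m, (mink m : ℝ) * (E c m * E a m) := by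
    rw [inv_eq_of_ortho hE, Matrix.mul_apply]
    refine Finset.sum_congr rfl fun m _ => ?_
    rw [minkMat, Matrix.mul_diagonal, Matrix.transpose_apply]; ring
  simp only [Matrix.mulVec, dotProduct, codiff, hi, Matrix.transpose_apply, pull2_apply,
    Matrix.of_apply, mul_neg, Finset.sum_neg_distrib, Fin.sum_univ_four]
  ring

variable {V : Opens E4} {g : E4 → Tensor2 ℝ} {η : E4 → Tensor4 ℝ} {U : E4 → Tensor2 ℝ}
  {X Y : Fin 4 → ℝ}

namespace IsFramedOn

variable (h : IsFramedOn V g η U X Y)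
include h

lemma evalHom_nabla {A : E4 → Tensor2 ℝ} (hA : SmoothOn V A) (y : V) (i a b : Fin 4) :
    evalHom y (h.coordFrame.nabla (matOf A hA) i a b) = (covDeriv g A i a b y : ℂ) := by
  have hs (k i j : Fin 4) := christoffel_symm (fun z hz => (h.lorentz z hz).symm) y.2 k i j
  change evalHom y ((dMat (pdDer V i) (matOf A hA) - (h.isMetricOn.gammaMat i)ᵀ * matOf A hA -
    matOf A hA * h.isMetricOn.gammaMat i) a b) = _
  simp only [Matrix.sub_apply, dMat, Matrix.map_apply, matOf, IsMetricOn.gammaMat, pdDer_ofRealFun, map_sub,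
    evalHom_ofRealFun, Matrix.mul_apply, map_sum, map_mul, Matrix.transpose_apply, covDeriv]
  push_cast
  rw [Finset.sum_add_distrib]
  simp only [hs _ _ i, mul_comm]
  ring

lemma evalHom_frame_nabla {A : E4 → Tensor2 ℝ} (hA : SmoothOn V A) (y : V) (i a b : Fin 4) :
    evalHom y ((h.coordFrame.Eᵀ * h.coordFrame.nabla (matOf A hA) i * h.coordFrame.E) a b) =
      ((pull2 (h.frame y) (Matrix.of fun k l => covDeriv g A i k l y) a b : ℝ) : ℂ) := by
  have hR : (h.coordFrame.nabla (matOf A hA) i).map (evalHom y) =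
      toC (Matrix.of fun k l => covDeriv g A i k l y) := by
    ext k l; exact h.evalHom_nabla hA y i k l
  rw [← Matrix.map_apply (f := evalHom y), Matrix.map_mul, Matrix.map_mul, hR,
    Matrix.transpose_map, show h.coordFrame.E.map (evalHom y) = toC (h.frame y) from rfl,
    ← toC_transpose, ← toC_mul, ← toC_mul, toC_apply, pull2]

/-- The value of a connection coefficient. -/
def conn (a b c : Fin 4) (y : V) : ℝ := (evalHom y (h.coordFrame.coeff a b c)).re

lemma evalHom_coeff (a b c : Fin 4) (y : V) :
    evalHom y (h.coordFrame.coeff a b c) = (h.conn a b c y : ℂ) := by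
  have := congrArg (evalHom y) (h.coordFrame.star_coeff a b c)
  rw [evalHom_star] at this
  exact (Complex.conj_eq_iff_re.mp this).symm

lemma conn_antisymm (a b c : Fin 4) (y : V) : h.conn a b c y = -h.conn b a c y := by
  rw [conn, h.coordFrame.coeff_antisymm, map_neg, Complex.neg_re, conn]

lemma frame_mulVec_codiff {A : E4 → Tensor2 ℝ} (hA : SmoothOn V A) {u : Tensor2 ℤ}
    (hu : ∀ y ∈ V, pull2 (h.frame y) (A y) = u.map (Int.cast : ℤ → ℝ)) (y : V) (b : Fin 4) :
    ((h.frame y)ᵀ *ᵥ codiff g A y) b = -∑ a, (mink a : ℝ) *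
      ∑ m, (mink m : ℝ) * (h.conn a m a y * (u m b : ℝ) - (u a m : ℝ) * h.conn m b a y) := by
  have hc : h.coordFrame.Eᵀ * matOf A hA * h.coordFrame.E =
      u.map (Int.cast : ℤ → smoothAlg V) := Matrix.ext fun a b => ext_evalHom fun y => by
    rw [← Matrix.map_apply (f := evalHom y), Matrix.map_mul, Matrix.map_mul, Matrix.transpose_map,
      map_matOf, show h.coordFrame.E.map (evalHom y) = toC (h.frame y) from rfl,
      ← toC_transpose, ← toC_mul, ← toC_mul]
    have := congrFun (congrFun (congrArg toC (hu y y.2)) a) b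
    refine this.trans ?_
    simp [toC_apply]
  rw [transpose_mulVec_codiff (h.frame_spec y.2).1]
  congr 1
  refine Finset.sum_congr rfl fun a _ => ?_
  congr 1
  have := congrArg (evalHom y) (h.coordFrame.sum_nabla_frame hc a b)
  have hF (i a : Fin 4) : evalHom y (h.coordFrame.E i a) = ((h.frame y i a : ℝ) : ℂ) := rfl
  simp only [map_sum, map_mul, map_sub, map_intCast, h.evalHom_frame_nabla, h.evalHom_coeff,
    hF] at this
  exact_mod_cast this

/-- The components of `U` in the frame are constant, so $\delta U$ is algebraic in the connection.
Only the coefficients that mix the two principal planes remain, since $e^0\wedge e^1$ is invariant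
under boosts and rotations of the planes. -/
lemma divU_eq (y : V) : h.divU y =
    ![-h.conn 1 2 2 y - h.conn 1 3 3 y, -h.conn 0 2 2 y - h.conn 0 3 3 y,
      -h.conn 1 2 0 y + h.conn 0 2 1 y, -h.conn 1 3 0 y + h.conn 0 3 1 y] := by
  ext b
  have s := fun a b c => h.conn_antisymm a b c y
  have s0 : ∀ a c, h.conn a a c y = 0 := fun a c => by have := s a a c; linarith
  rw [divU, h.frame_mulVec_codiff h.smooth_U (fun y hy => (h.frame_spec hy).2.1) y b]
  fin_cases b <;> simp [biv01, mink, s0, Fin.sum_univ_four] <;>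
    linarith [s 1 2 2, s 1 3 3, s 0 1 0, s 0 2 2, s 0 3 3, s 0 1 1]

lemma divS_eq (y : V) : h.divS y =
    ![h.conn 0 2 3 y - h.conn 0 3 2 y, h.conn 1 2 3 y - h.conn 1 3 2 y,
      -h.conn 0 3 0 y + h.conn 1 3 1 y, h.conn 0 2 0 y - h.conn 1 2 1 y] := by
  ext b
  have s := fun a b c => h.conn_antisymm a b c y
  have s0 : ∀ a c, h.conn a a c y = 0 := fun a c => by have := s a a c; linarith
  rw [divS, h.frame_mulVec_codiff h.smooth_dual (fun y hy => (h.frame_spec hy).2.2) y b]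
  fin_cases b <;> simp [biv23, mink, s0, Fin.sum_univ_four] <;>
    linarith [s 0 2 3, s 0 3 2, s 1 2 3, s 1 3 2, s 2 3 2, s 2 3 3]

end IsFramedOn

end Divergence

/-! ### The coefficients $r$, $r'$, $t$, $t'$ in real terms -/

section NullCoefficients

open OrthoFrame

variable {R : Type} [CommRing R] [Algebra ℂ R] [StarRing R] [StarModule ℂ R] (O : OrthoFrame R)

lemma OrthoFrame.cM_eq : O.toNullFrame.c O.toNullFrame.M = half R *
    ((O.θ 0 2 (O.e 2) + O.θ 1 2 (O.e 2) + O.θ 0 3 (O.e 3) + O.θ 1 3 (O.e 3)) + imUnit R *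
      (O.θ 0 2 (O.e 3) + O.θ 1 2 (O.e 3) - O.θ 0 3 (O.e 2) - O.θ 1 3 (O.e 2))) := by
  have hI := imUnit_sq (R := R)
  change formC O.θ (nullM O) = _
  simp only [formC, nullM, LinearMap.smul_apply, LinearMap.add_apply, LinearMap.sub_apply, map_add,
    map_smul, smul_eq_mul]
  linear_combination -(half R * (O.θ 0 3 (O.e 3) + O.θ 1 3 (O.e 3))) * hI

lemma OrthoFrame.bMb_eq : O.toNullFrame.b O.toNullFrame.Mb = half R *
    ((O.θ 0 2 (O.e 2) - O.θ 1 2 (O.e 2) + O.θ 0 3 (O.e 3) - O.θ 1 3 (O.e 3)) + imUnit R *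
      (O.θ 0 3 (O.e 2) - O.θ 1 3 (O.e 2) - O.θ 0 2 (O.e 3) + O.θ 1 2 (O.e 3))) := by
  have hI := imUnit_sq (R := R)
  change formB O.θ (nullMb O) = _
  simp only [formB, nullMb, LinearMap.smul_apply, LinearMap.add_apply, LinearMap.sub_apply, map_sub,
    map_smul, smul_eq_mul]
  linear_combination -(half R * (O.θ 0 3 (O.e 3) - O.θ 1 3 (O.e 3))) * hI

lemma OrthoFrame.cN_eq : O.toNullFrame.c O.toNullFrame.N = half R *
    ((O.θ 0 2 (O.e 0) - O.θ 0 2 (O.e 1) + O.θ 1 2 (O.e 0) - O.θ 1 2 (O.e 1)) - imUnit R *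
      (O.θ 0 3 (O.e 0) - O.θ 0 3 (O.e 1) + O.θ 1 3 (O.e 0) - O.θ 1 3 (O.e 1))) := by
  change formC O.θ (nullN O) = _
  simp only [formC, nullN, LinearMap.smul_apply, LinearMap.add_apply, LinearMap.sub_apply, map_sub,
    smul_eq_mul]
  ring

lemma OrthoFrame.bL_eq : O.toNullFrame.b O.toNullFrame.L = half R *
    ((O.θ 0 2 (O.e 0) + O.θ 0 2 (O.e 1) - O.θ 1 2 (O.e 0) - O.θ 1 2 (O.e 1)) + imUnit R *
      (O.θ 0 3 (O.e 0) + O.θ 0 3 (O.e 1) - O.θ 1 3 (O.e 0) - O.θ 1 3 (O.e 1))) := by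
  change formB O.θ (nullL O) = _
  simp only [formB, nullL, LinearMap.smul_apply, LinearMap.add_apply, LinearMap.sub_apply, map_add,
    smul_eq_mul]
  ring

lemma star_half_eq_neg_iff (x y : ℝ) : star (1 / 2 * ((x : ℂ) + Complex.I * y)) =
    -(1 / 2 * ((x : ℂ) + Complex.I * y)) ↔ x = 0 := by
  simp [Complex.ext_iff]
  constructor <;> intro h <;> linarith

lemma star_half_eq_self_iff (x y : ℝ) : star (1 / 2 * ((x : ℂ) + Complex.I * y)) =
    1 / 2 * ((x : ℂ) + Complex.I * y) ↔ y = 0 := by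
  simp [Complex.ext_iff]
  constructor <;> intro h <;> linarith

lemma star_half_eq_iff (x y x' y' : ℝ) : star (1 / 2 * ((x : ℂ) + Complex.I * y)) =
    1 / 2 * ((x' : ℂ) - Complex.I * y') ↔ x = x' ∧ y = y' := by
  simp [Complex.ext_iff]

lemma star_half_eq_neg_iff' (x y x' y' : ℝ) : star (1 / 2 * ((x : ℂ) + Complex.I * y)) =
    -(1 / 2 * ((x' : ℂ) - Complex.I * y')) ↔ x = -x' ∧ y = -y' := by
  simp [Complex.ext_iff]
  constructor <;> rintro ⟨h1, h2⟩ <;> constructor <;> linarith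

end NullCoefficients

/-! ### The concomitants as reality conditions on $r$, $r'$, $t$, $t'$ -/

section NullConcomitants

open Matrix CoordFrame OrthoFrame TopologicalSpace

variable {V : Opens E4} {g : E4 → Tensor2 ℝ} {η : E4 → Tensor4 ℝ} {U : E4 → Tensor2 ℝ}
  {X Y : Fin 4 → ℝ}

namespace IsFramedOn

variable (h : IsFramedOn V g η U X Y)
include h

/-- The null frame associated with the adapted frame. -/
def nullFrame : NullFrame (smoothAlg V) := h.coordFrame.toOrthoFrame.toNullFrame

lemma psi_eq : h.nullFrame.psi = -2 * h.eigen := rfl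

lemma evalHom_θ (a b c : Fin 4) (y : V) :
    evalHom y (h.coordFrame.toOrthoFrame.θ a b (h.coordFrame.toOrthoFrame.e c)) =
      (h.conn a b c y : ℂ) := by
  rw [toOrthoFrame_θ, h.evalHom_coeff]

lemma evalHom_cM (y : V) : evalHom y (h.nullFrame.c h.nullFrame.M) =
    1 / 2 * (((h.conn 0 2 2 y + h.conn 1 2 2 y + h.conn 0 3 3 y + h.conn 1 3 3 y : ℝ) : ℂ) +
      Complex.I * ((h.conn 0 2 3 y + h.conn 1 2 3 y - h.conn 0 3 2 y - h.conn 1 3 2 y : ℝ) : ℂ))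
    := by
  rw [nullFrame, OrthoFrame.cM_eq]
  simp only [map_add, map_mul, map_sub, evalHom_half, evalHom_imUnit, h.evalHom_θ]
  push_cast
  rfl

lemma evalHom_bMb (y : V) : evalHom y (h.nullFrame.b h.nullFrame.Mb) =
    1 / 2 * (((h.conn 0 2 2 y - h.conn 1 2 2 y + h.conn 0 3 3 y - h.conn 1 3 3 y : ℝ) : ℂ) +
      Complex.I * ((h.conn 0 3 2 y - h.conn 1 3 2 y - h.conn 0 2 3 y + h.conn 1 2 3 y : ℝ) : ℂ))
    := by
  rw [nullFrame, OrthoFrame.bMb_eq]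
  simp only [map_add, map_mul, map_sub, evalHom_half, evalHom_imUnit, h.evalHom_θ]
  push_cast
  rfl

lemma evalHom_cN (y : V) : evalHom y (h.nullFrame.c h.nullFrame.N) =
    1 / 2 * (((h.conn 0 2 0 y - h.conn 0 2 1 y + h.conn 1 2 0 y - h.conn 1 2 1 y : ℝ) : ℂ) -
      Complex.I * ((h.conn 0 3 0 y - h.conn 0 3 1 y + h.conn 1 3 0 y - h.conn 1 3 1 y : ℝ) : ℂ))
    := by
  rw [nullFrame, OrthoFrame.cN_eq]
  simp only [map_add, map_mul, map_sub, evalHom_half, evalHom_imUnit, h.evalHom_θ]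
  push_cast
  rfl

lemma evalHom_bL (y : V) : evalHom y (h.nullFrame.b h.nullFrame.L) =
    1 / 2 * (((h.conn 0 2 0 y + h.conn 0 2 1 y - h.conn 1 2 0 y - h.conn 1 2 1 y : ℝ) : ℂ) +
      Complex.I * ((h.conn 0 3 0 y + h.conn 0 3 1 y - h.conn 1 3 0 y - h.conn 1 3 1 y : ℝ) : ℂ))
    := by
  rw [nullFrame, OrthoFrame.bL_eq]
  simp only [map_add, map_mul, map_sub, evalHom_half, evalHom_imUnit, h.evalHom_θ]
  push_cast
  rfl

/-- The first two components of $\delta U$ are, up to sign, the difference and the sum of the real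
parts of $r$ and $r'$. -/
lemma vPhi_iff (y : V) : vPhi g η U y = 0 ↔
    star (evalHom y (h.nullFrame.c h.nullFrame.M)) = -evalHom y (h.nullFrame.c h.nullFrame.M) ∧
    star (evalHom y (h.nullFrame.b h.nullFrame.Mb)) =
      -evalHom y (h.nullFrame.b h.nullFrame.Mb) := by
  rw [h.vPhi_eq_zero y.2, h.evalHom_cM, h.evalHom_bMb, h.divU_eq,
    star_half_eq_neg_iff, star_half_eq_neg_iff]
  simp only [Matrix.cons_val]
  constructor <;> rintro ⟨h1, h2⟩ <;> constructor <;> linarith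

/-- The first two components of $\delta{*U}$ are the difference and the sum of the imaginary parts
of $r$ and $r'$. -/
lemma vPsi_iff (y : V) : vPsi g η U y = 0 ↔
    star (evalHom y (h.nullFrame.c h.nullFrame.M)) = evalHom y (h.nullFrame.c h.nullFrame.M) ∧
    star (evalHom y (h.nullFrame.b h.nullFrame.Mb)) =
      evalHom y (h.nullFrame.b h.nullFrame.Mb) := by
  rw [h.vPsi_eq_zero y.2, h.evalHom_cM, h.evalHom_bMb, h.divS_eq,
    star_half_eq_self_iff, star_half_eq_self_iff]
  simp only [Matrix.cons_val]
  constructor <;> rintro ⟨h1, h2⟩ <;> constructor <;> linarith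

lemma hPhi_iff (y : V) : hPhi g η U y = 0 ↔
    star (evalHom y (h.nullFrame.b h.nullFrame.L)) =
      -evalHom y (h.nullFrame.c h.nullFrame.N) := by
  rw [h.hPhi_eq_zero y.2, h.evalHom_cN, h.evalHom_bL, h.divS_eq,
    star_half_eq_neg_iff']
  simp only [Matrix.cons_val]
  constructor <;> rintro ⟨h1, h2⟩ <;> constructor <;> linarith

lemma hPsi_iff (y : V) : hPsi g η U y = 0 ↔
    star (evalHom y (h.nullFrame.b h.nullFrame.L)) =
      evalHom y (h.nullFrame.c h.nullFrame.N) := by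
  rw [h.hPsi_eq_zero y.2, h.evalHom_cN, h.evalHom_bL, h.divU_eq,
    star_half_eq_iff]
  simp only [Matrix.cons_val]
  constructor <;> rintro ⟨h1, h2⟩ <;> constructor <;> linarith

end IsFramedOn

end NullConcomitants

/-! ### Coordinate derivations as combinations of the null frame -/

section SpanOfNullFrame

open Matrix CoordFrame OrthoFrame

lemma OrthoFrame.spanDer_e {R : Type} [CommRing R] [Algebra ℂ R] [StarRing R] [StarModule ℂ R]
    (O : OrthoFrame R) (a : Fin 4) : O.toNullFrame.SpanDer (O.e a) := by
  have hL : O.toNullFrame.SpanDer (nullL O) := Submodule.subset_span (by simp; left; rfl)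
  have hN : O.toNullFrame.SpanDer (nullN O) := Submodule.subset_span (by simp; right; left; rfl)
  have hM : O.toNullFrame.SpanDer (nullM O) :=
    Submodule.subset_span (by simp; right; right; left; rfl)
  have hMb : O.toNullFrame.SpanDer (nullMb O) :=
    Submodule.subset_span (by simp; right; right; right; rfl)
  have h2 : (2 : R) * half R = 1 := two_mul_half
  have hI := imUnit_sq (R := R)
  fin_cases a
  · change O.toNullFrame.SpanDer (O.e 0)
    have : O.e 0 = half R • (nullL O + nullN O) := by
      ext f
      simp only [nullL, nullN, Derivation.add_apply, Derivation.sub_apply, Derivation.smul_apply,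
        smul_eq_mul]
      linear_combination -(O.e 0 f) * h2
    rw [this]
    exact Submodule.smul_mem _ _ (Submodule.add_mem _ hL hN)
  · change O.toNullFrame.SpanDer (O.e 1)
    have : O.e 1 = half R • (nullL O - nullN O) := by
      ext f
      simp only [nullL, nullN, Derivation.add_apply, Derivation.sub_apply, Derivation.smul_apply,
        smul_eq_mul]
      linear_combination -(O.e 1 f) * h2
    rw [this]
    exact Submodule.smul_mem _ _ (Submodule.sub_mem _ hL hN)
  · change O.toNullFrame.SpanDer (O.e 2)
    have : O.e 2 = half R • (nullM O + nullMb O) := by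
      ext f
      simp only [nullM, nullMb, Derivation.add_apply, Derivation.sub_apply, Derivation.smul_apply,
        smul_eq_mul]
      linear_combination -(O.e 2 f) * h2
    rw [this]
    exact Submodule.smul_mem _ _ (Submodule.add_mem _ hM hMb)
  · change O.toNullFrame.SpanDer (O.e 3)
    have : O.e 3 = (-(imUnit R * half R)) • (nullM O - nullMb O) := by
      ext f
      simp only [nullM, nullMb, Derivation.add_apply, Derivation.sub_apply, Derivation.smul_apply,
        smul_eq_mul]
      linear_combination -(O.e 3 f) * h2 + (2 * half R * O.e 3 f) * hI
    rw [this]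
    exact Submodule.smul_mem _ _ (Submodule.sub_mem _ hM hMb)

/-- The inverse of the frame matrix is `minkMat R * C.Eᵀ * C.g`. This transfers the closed systems,
known along the null frame, to the partial derivatives. -/
lemma CoordFrame.spanDer_D {R : Type} [CommRing R] [Algebra ℂ R] [StarRing R] [StarModule ℂ R]
    (C : CoordFrame R) (i : Fin 4) : C.toOrthoFrame.toNullFrame.SpanDer (C.D i) := by
  have : C.D i = ∑ a, (minkMat R * C.Eᵀ * C.g) a i • C.toOrthoFrame.e a := by
    ext f
    have h1 := C.right_inv
    have h2 (j : Fin 4) : ∑ a, C.E j a * (minkMat R * C.Eᵀ * C.g) a i = if j = i then 1 else 0 := by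
      rw [← Matrix.mul_apply, h1, Matrix.one_apply]
    have h0 (s : Finset (Fin 4)) (X : Fin 4 → Derivation ℂ R R) : (∑ a ∈ s, X a) f = ∑ a ∈ s, X a f := by
      induction s using Finset.induction_on with
      | empty => simp
      | insert a s ha ih => rw [Finset.sum_insert ha, Finset.sum_insert ha, Derivation.add_apply, ih]
    rw [h0]
    change _ = ∑ a, (minkMat R * C.Eᵀ * C.g) a i • fieldOf C.D (fun j => C.E j a) f
    simp only [fieldOf_apply, smul_eq_mul, Finset.mul_sum]
    rw [Finset.sum_comm]
    have h3 (j : Fin 4) : ∑ a, (minkMat R * C.Eᵀ * C.g) a i * (C.E j a * C.D j f) =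
        (if j = i then 1 else 0) * C.D j f := by
      rw [← h2, Finset.sum_mul]
      exact Finset.sum_congr rfl fun a _ => by ring
    simp only [h3, ite_mul, one_mul, zero_mul, Finset.sum_ite_eq', Finset.mem_univ, if_true]
  rw [this]
  exact Submodule.sum_mem _ fun a _ => Submodule.smul_mem _ _ (C.toOrthoFrame.spanDer_e a)

end SpanOfNullFrame

/-! ### The closed systems as finite families, and their initial values -/

section ClosedSystems

namespace NullFrame

variable {R : Type} [CommRing R] [Algebra ℂ R] [StarRing R] (F : NullFrame R)

/-- The unknowns of the closed system of the case `v(Ψ) = 0`. -/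
def twistFreeSystem : Fin 3 → R :=
  ![F.psi - star F.psi, F.c F.N - star (F.b F.L), star (F.c F.N) - F.b F.L]

/-- The unknowns of the closed system of the case `h(Ψ) = 0`. -/
def symmetricSystem : Fin 3 → R :=
  ![F.psi - star F.psi, F.c F.M - star (F.c F.M), F.b F.Mb - star (F.b F.Mb)]

lemma twistFreeSystem_mem (hr : star (F.c F.M) = F.c F.M) (hr' : star (F.b F.Mb) = F.b F.Mb)
    {X : Derivation ℂ R R} (hX : F.SpanDer X) (j : Fin 3) :
    X (F.twistFreeSystem j) ∈ Ideal.span (Set.range F.twistFreeSystem) := by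
  have hs : Set.range F.twistFreeSystem = {F.psi - star F.psi, F.c F.N - star (F.b F.L),
      star (F.c F.N) - F.b F.L} := by
    simp only [twistFreeSystem, Matrix.range_cons, Matrix.range_empty, Set.union_empty,
      Set.singleton_union]
  rw [hs]
  exact F.closed_system_of_twistFree hr hr' hX (hs ▸ Set.mem_range_self j)

lemma symmetricSystem_mem (ht : star (F.b F.L) = F.c F.N) {X : Derivation ℂ R R}
    (hX : F.SpanDer X) (j : Fin 3) :
    X (F.symmetricSystem j) ∈ Ideal.span (Set.range F.symmetricSystem) := by
  have hs : Set.range F.symmetricSystem = {F.psi - star F.psi, F.c F.M - star (F.c F.M),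
      F.b F.Mb - star (F.b F.Mb)} := by
    simp only [symmetricSystem, Matrix.range_cons, Matrix.range_empty, Set.union_empty,
      Set.singleton_union]
  rw [hs]
  exact F.closed_system_of_symmetric ht hX (hs ▸ Set.mem_range_self j)

section Values

variable {K : Type} [Field K] [CharZero K] (φ : R →+* K) (hp : φ (star F.psi) ≠ 0)
  (h0 : φ (F.psi - star F.psi) = 0)
include hp h0

/-- An initial value of the closed system: where $\psi-\bar\psi$ and its derivative along `Mb`
vanish, `Mb_y` leaves $3\bar\psi(t-\bar t')=0$, and $\bar\psi\neq0$ there. -/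
lemma map_cN_sub_eq_zero (hd : φ (F.Mb (F.psi - star F.psi)) = 0) :
    φ (F.c F.N - star (F.b F.L)) = 0 := by
  rw [F.Mb_y, map_add, map_mul, h0, mul_zero, zero_add, map_mul, map_mul, map_ofNat] at hd
  exact (mul_eq_zero.mp hd).resolve_left (mul_ne_zero three_ne_zero hp)

lemma map_cM_sub_eq_zero (hd : φ (F.L (F.psi - star F.psi)) = 0) :
    φ (F.c F.M - star (F.c F.M)) = 0 := by
  rw [F.L_y', map_add, map_mul, h0, mul_zero, zero_add, map_mul, map_mul, map_ofNat] at hd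
  exact (mul_eq_zero.mp hd).resolve_left (mul_ne_zero three_ne_zero hp)

lemma map_bMb_sub_eq_zero (hd : φ (F.N (F.psi - star F.psi)) = 0) :
    φ (F.b F.Mb - star (F.b F.Mb)) = 0 := by
  rw [F.N_y', map_add, map_mul, h0, mul_zero, zero_add, map_mul, map_mul, map_ofNat] at hd
  exact (mul_eq_zero.mp hd).resolve_left (mul_ne_zero three_ne_zero hp)

end Values

end NullFrame

end ClosedSystems

/-! ### The four implications on a framed convex set -/

section LocalTheorems

open Matrix CoordFrame OrthoFrame TopologicalSpace Filter Topology

/-- The eigenvalue of a Weyl tensor of type D is real at `y`. -/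
def IsRealAt (g : E4 → Tensor2 ℝ) (η : E4 → Tensor4 ℝ) (y : E4) : Prop :=
  ∀ w U, IsCanonicalForm (g y) (η y) (weyl g y) w U → star w = w

variable {V : Opens E4} {g : E4 → Tensor2 ℝ} {η : E4 → Tensor4 ℝ} {U : E4 → Tensor2 ℝ}
  {X Y : Fin 4 → ℝ}

lemma eq_zero_of_sq {f : smoothAlg V} (h : f ^ 2 = 0) : f = 0 := ext_evalHom fun y => by
  have := congrArg (evalHom y) h
  rw [map_pow, map_zero] at this
  rw [map_zero]
  exact pow_eq_zero_iff two_ne_zero |>.mp this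

/-- Derivatives of a function that vanishes near a point. -/
lemma evalHom_pdDer_eq_zero {f : smoothAlg V} {y : V}
    (h : ∀ᶠ z in 𝓝 (y : E4), extZero f.1 z = 0) (i : Fin 4) : evalHom y (pdDer V i f) = 0 := by
  have h' : extZero f.1 =ᶠ[𝓝 (y : E4)] fun _ => 0 := h
  rw [evalHom_apply, pdDer_apply, h'.fderiv_eq]
  simp

namespace IsFramedOn

variable (h : IsFramedOn V g η U X Y)
include h

lemma isRealAt_iff (y : V) : IsRealAt g η y ↔ evalHom y (h.nullFrame.psi - star h.nullFrame.psi) = 0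
    := by
  have e : evalHom y (h.nullFrame.psi - star h.nullFrame.psi) =
      -2 * (evalHom y h.eigen - star (evalHom y h.eigen)) := by
    rw [h.psi_eq]
    simp only [map_sub, evalHom_star, map_mul, star_mul', map_neg, map_ofNat, star_neg, star_ofNat]
    ring
  rw [e]
  constructor
  · intro hr
    obtain ⟨w, hw⟩ := h.canonical y y.2
    rw [h.evalHom_eigen hw, hr w _ hw]; ring
  · intro he w U' hw
    rw [h.evalHom_eigen hw] at he
    have := (mul_eq_zero.mp he).resolve_left (by norm_num)
    exact (sub_eq_zero.mp this).symm

lemma eventually_of_isRealAt {y : V} (hr : ∀ᶠ z in 𝓝 (y : E4), IsRealAt g η z) :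
    ∀ᶠ z in 𝓝 (y : E4), extZero (h.nullFrame.psi - star h.nullFrame.psi).1 z = 0 := by
  filter_upwards [hr, V.2.mem_nhds y.2] with z hz hzV
  rw [extZero_of_mem _ hzV]
  exact (h.isRealAt_iff ⟨z, hzV⟩).mp hz

/-- Near a point where the factor `f` does not vanish, `f * (ψ - ψ̄) = 0` makes the eigenvalue
real. -/
lemma isRealAt_of_mul_eq_zero {f : smoothAlg V}
    (hf : f * (h.nullFrame.psi - star h.nullFrame.psi) = 0) {y : V} (hy : evalHom y f ≠ 0) :
    ∀ᶠ z in 𝓝 (y : E4), IsRealAt g η z := by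
  have hc : ContinuousAt (extZero f.1) y := f.2.continuousOn.continuousAt (V.2.mem_nhds y.2)
  have h0 : extZero f.1 y ≠ 0 := by rw [extZero_coe]; exact hy
  filter_upwards [hc.eventually_ne h0, V.2.mem_nhds y.2] with z hz hzV
  rw [h.isRealAt_iff ⟨z, hzV⟩]
  have := congrArg (evalHom ⟨z, hzV⟩) hf
  rw [map_mul, map_zero] at this
  refine (mul_eq_zero.mp this).resolve_left ?_
  rw [extZero_of_mem _ hzV] at hz
  exact hz

lemma star_cM (hv : ∀ y ∈ V, vPsi g η U y = 0) :
    star (h.nullFrame.c h.nullFrame.M) = h.nullFrame.c h.nullFrame.M :=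
  ext_evalHom fun y => ((h.vPsi_iff y).mp (hv y y.2)).1

lemma star_bMb (hv : ∀ y ∈ V, vPsi g η U y = 0) :
    star (h.nullFrame.b h.nullFrame.Mb) = h.nullFrame.b h.nullFrame.Mb :=
  ext_evalHom fun y => ((h.vPsi_iff y).mp (hv y y.2)).2

lemma star_bL (hh : ∀ y ∈ V, hPsi g η U y = 0) :
    star (h.nullFrame.b h.nullFrame.L) = h.nullFrame.c h.nullFrame.N :=
  ext_evalHom fun y => (h.hPsi_iff y).mp (hh y y.2)

/-- More is true: $r$ and $r'$ vanish, as their squares do and `smoothAlg V` has no nilpotent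
elements. -/
lemma vPsi_eq_zero_of_vPhi (hv : ∀ y ∈ V, vPhi g η U y = 0) : ∀ y ∈ V, vPsi g η U y = 0 := by
  have h1 : star (h.nullFrame.c h.nullFrame.M) = -h.nullFrame.c h.nullFrame.M :=
    ext_evalHom fun y => by rw [map_neg]; exact ((h.vPhi_iff y).mp (hv y y.2)).1
  have h2 : star (h.nullFrame.b h.nullFrame.Mb) = -h.nullFrame.b h.nullFrame.Mb :=
    ext_evalHom fun y => by rw [map_neg]; exact ((h.vPhi_iff y).mp (hv y y.2)).2
  have e1 := eq_zero_of_sq (h.nullFrame.cM_sq_eq_zero h1)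
  have e2 := eq_zero_of_sq (h.nullFrame.bMb_sq_eq_zero h2)
  intro y hy
  rw [h.vPsi_iff ⟨y, hy⟩, e1, e2]
  simp

lemma hPsi_eq_zero_of_hPhi (hh : ∀ y ∈ V, hPhi g η U y = 0) : ∀ y ∈ V, hPsi g η U y = 0 := by
  have h1 : star (h.nullFrame.b h.nullFrame.L) = -h.nullFrame.c h.nullFrame.N :=
    ext_evalHom fun y => by rw [map_neg]; exact (h.hPhi_iff y).mp (hh y y.2)
  have e1 := eq_zero_of_sq (h.nullFrame.cN_sq_eq_zero h1)
  intro y hy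
  rw [h.hPsi_iff ⟨y, hy⟩, ← evalHom_star, h1, e1]
  simp

/-- If $v(\Phi)\neq0$ at `y`, then $r$ or $r'$ is non-zero there, hence also near `y`, and its
product with $\psi-\bar\psi$ is zero. -/
lemma isRealAt_of_vPhi_ne_zero (hv : ∀ y ∈ V, vPsi g η U y = 0) {y : E4} (hy : y ∈ V)
    (hne : vPhi g η U y ≠ 0) : ∀ᶠ z in 𝓝 y, IsRealAt g η z := by
  rw [Ne, h.vPhi_iff ⟨y, hy⟩] at hne
  by_cases hc : evalHom ⟨y, hy⟩ (h.nullFrame.c h.nullFrame.M) = 0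
  · refine h.isRealAt_of_mul_eq_zero (y := ⟨y, hy⟩)
      (h.nullFrame.bMb_mul_eq_zero (h.star_cM hv) (h.star_bMb hv)) fun hb => hne ?_
    rw [hc, hb]; simp
  · exact h.isRealAt_of_mul_eq_zero (y := ⟨y, hy⟩)
      (h.nullFrame.cM_mul_eq_zero (h.star_cM hv) (h.star_bMb hv)) hc

lemma isRealAt_of_hPhi_ne_zero (hh : ∀ y ∈ V, hPsi g η U y = 0) {y : E4} (hy : y ∈ V)
    (hne : hPhi g η U y ≠ 0) : ∀ᶠ z in 𝓝 y, IsRealAt g η z := by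
  rw [Ne, h.hPhi_iff ⟨y, hy⟩] at hne
  refine h.isRealAt_of_mul_eq_zero (y := ⟨y, hy⟩) (h.nullFrame.cN_mul_eq_zero (h.star_bL hh))
    fun hc => hne ?_
  rw [← evalHom_star, h.star_bL hh, hc, neg_zero]

lemma evalHom_e_eq_zero {f : smoothAlg V} {y : V} (hf : ∀ᶠ z in 𝓝 (y : E4), extZero f.1 z = 0)
    (a : Fin 4) : evalHom y (h.coordFrame.toOrthoFrame.e a f) = 0 := by
  change evalHom y (fieldOf (pdDer V) _ f) = 0
  rw [fieldOf_apply, map_sum]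
  exact Finset.sum_eq_zero fun i _ => by rw [map_mul, evalHom_pdDer_eq_zero hf, mul_zero]

lemma spanDer_pd (i : Fin 4) : h.nullFrame.SpanDer (pdDer V i) := h.coordFrame.spanDer_D i

lemma twistFreeSystem_eq_zero (hconv : Convex ℝ (V : Set E4)) (hv : ∀ y ∈ V, vPsi g η U y = 0)
    (y₀ : V) (h0 : evalHom y₀ (h.nullFrame.twistFreeSystem 0) = 0)
    (h1 : evalHom y₀ (h.nullFrame.twistFreeSystem 1) = 0)
    (h2 : evalHom y₀ (h.nullFrame.twistFreeSystem 2) = 0) (j : Fin 3) :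
    h.nullFrame.twistFreeSystem j = 0 := by
  have hz : ∀ j, (h.nullFrame.twistFreeSystem j).1 y₀ = 0 := by
    rw [Fin.forall_fin_succ, Fin.forall_fin_two]
    exact ⟨h0, h1, h2⟩
  exact eq_zero_of_closed_system hconv _ (fun i j =>
    h.nullFrame.twistFreeSystem_mem (h.star_cM hv) (h.star_bMb hv) (h.spanDer_pd i) j) y₀ hz j

lemma symmetricSystem_eq_zero (hconv : Convex ℝ (V : Set E4)) (hh : ∀ y ∈ V, hPsi g η U y = 0)
    (y₀ : V) (h0 : evalHom y₀ (h.nullFrame.symmetricSystem 0) = 0)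
    (h1 : evalHom y₀ (h.nullFrame.symmetricSystem 1) = 0)
    (h2 : evalHom y₀ (h.nullFrame.symmetricSystem 2) = 0) (j : Fin 3) :
    h.nullFrame.symmetricSystem j = 0 := by
  have hz : ∀ j, (h.nullFrame.symmetricSystem j).1 y₀ = 0 := by
    rw [Fin.forall_fin_succ, Fin.forall_fin_two]
    exact ⟨h0, h1, h2⟩
  exact eq_zero_of_closed_system hconv _ (fun i j =>
    h.nullFrame.symmetricSystem_mem (h.star_bL hh) (h.spanDer_pd i) j) y₀ hz j

lemma evalHom_star_psi_ne_zero (y : V) : evalHom y (star h.nullFrame.psi) ≠ 0 :=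
  (h.nullFrame.isUnit_psi.star.map (evalHom y)).ne_zero

/-- If `v(Ψ) = 0` and the eigenvalue is real near a point of a convex set, then it is real on this
set and `h(Ψ) = 0` there. -/
lemma real_of_vPsi (hconv : Convex ℝ (V : Set E4)) (hv : ∀ y ∈ V, vPsi g η U y = 0) {y₀ : E4}
    (hy₀ : y₀ ∈ V) (hr : ∀ᶠ z in 𝓝 y₀, IsRealAt g η z) :
    ∀ y ∈ V, IsRealAt g η y ∧ hPsi g η U y = 0 := by
  have he := h.eventually_of_isRealAt (y := ⟨y₀, hy₀⟩) hr
  have h0 := (h.isRealAt_iff ⟨y₀, hy₀⟩).mp hr.self_of_nhds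
  -- Reality in a whole neighbourhood is used here: it makes the derivative of $\psi-\bar\psi$ at
  -- `y₀` vanish too.
  have h1 := h.nullFrame.map_cN_sub_eq_zero (evalHom ⟨y₀, hy₀⟩) (h.evalHom_star_psi_ne_zero _) h0 <| by
    change evalHom _ (nullMb h.coordFrame.toOrthoFrame _) = 0
    rw [nullMb, Derivation.sub_apply, Derivation.smul_apply, smul_eq_mul, map_sub, map_mul,
      h.evalHom_e_eq_zero he, h.evalHom_e_eq_zero he, mul_zero, sub_zero]
  -- The third unknown is the conjugate of the second.
  have h2 : evalHom ⟨y₀, hy₀⟩ (h.nullFrame.twistFreeSystem 2) = 0 := by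
    have := congrArg star h1
    rw [← evalHom_star, star_sub, star_star, star_zero] at this
    exact this
  have hsys := h.twistFreeSystem_eq_zero hconv hv ⟨y₀, hy₀⟩ h0 h1 h2
  have k0 : h.nullFrame.psi - star h.nullFrame.psi = 0 := hsys 0
  have k1 : h.nullFrame.c h.nullFrame.N - star (h.nullFrame.b h.nullFrame.L) = 0 := hsys 1
  refine fun y hy => ⟨(h.isRealAt_iff ⟨y, hy⟩).mpr (by rw [k0, map_zero]),
    (h.hPsi_iff ⟨y, hy⟩).mpr ?_⟩
  rw [← evalHom_star, ← sub_eq_zero.mp k1]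

/-- If `h(Ψ) = 0` and the eigenvalue is real near a point of a convex set, then it is real on this
set and `v(Ψ) = 0` there. -/
lemma real_of_hPsi (hconv : Convex ℝ (V : Set E4)) (hh : ∀ y ∈ V, hPsi g η U y = 0) {y₀ : E4}
    (hy₀ : y₀ ∈ V) (hr : ∀ᶠ z in 𝓝 y₀, IsRealAt g η z) :
    ∀ y ∈ V, IsRealAt g η y ∧ vPsi g η U y = 0 := by
  have he := h.eventually_of_isRealAt (y := ⟨y₀, hy₀⟩) hr
  have h0 := (h.isRealAt_iff ⟨y₀, hy₀⟩).mp hr.self_of_nhds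
  have h1 := h.nullFrame.map_cM_sub_eq_zero (evalHom ⟨y₀, hy₀⟩) (h.evalHom_star_psi_ne_zero _) h0 <| by
    change evalHom _ (nullL h.coordFrame.toOrthoFrame _) = 0
    rw [nullL, Derivation.add_apply, map_add,
      h.evalHom_e_eq_zero he, h.evalHom_e_eq_zero he, add_zero]
  have h2 := h.nullFrame.map_bMb_sub_eq_zero (evalHom ⟨y₀, hy₀⟩) (h.evalHom_star_psi_ne_zero _) h0 <| by
    change evalHom _ (nullN h.coordFrame.toOrthoFrame _) = 0
    rw [nullN, Derivation.sub_apply, map_sub,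
      h.evalHom_e_eq_zero he, h.evalHom_e_eq_zero he, sub_zero]
  have hsys := h.symmetricSystem_eq_zero hconv hh ⟨y₀, hy₀⟩ h0 h1 h2
  have k0 : h.nullFrame.psi - star h.nullFrame.psi = 0 := hsys 0
  have k1 : h.nullFrame.c h.nullFrame.M - star (h.nullFrame.c h.nullFrame.M) = 0 := hsys 1
  have k2 : h.nullFrame.b h.nullFrame.Mb - star (h.nullFrame.b h.nullFrame.Mb) = 0 := hsys 2
  refine fun y hy => ⟨(h.isRealAt_iff ⟨y, hy⟩).mpr (by rw [k0, map_zero]),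
    (h.vPsi_iff ⟨y, hy⟩).mpr ⟨?_, ?_⟩⟩
  · rw [← evalHom_star, ← sub_eq_zero.mp k1]
  · rw [← evalHom_star, ← sub_eq_zero.mp k2]

end IsFramedOn

end LocalTheorems

/-! ### Tensors in a chart -/

section GramMatrix

open Matrix CoordFrame

variable {T : Type*} [AddCommGroup T] [Module ℝ T] (v : Module.Basis (Fin 4) ℝ T)

lemma gram_eq_pull2 {T : Type*} [AddCommGroup T] [Module ℝ T] (m : T →ₗ[ℝ] T →ₗ[ℝ] ℝ)
    (u v : Fin 4 → T) (J : Tensor2 ℝ) (hu : ∀ i, u i = ∑ k, J k i • v k) :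
    (Matrix.of fun i j => m (u i) (u j)) = pull2 J (Matrix.of fun i j => m (v i) (v j)) := by
  ext i j
  simp only [Matrix.of_apply, pull2_apply, hu, map_sum, map_smul, LinearMap.sum_apply,
    LinearMap.smul_apply, smul_eq_mul, Finset.mul_sum]
  rw [Finset.sum_comm]
  exact Finset.sum_congr rfl fun k _ => Finset.sum_congr rfl fun l _ => by ring

/-- An alternating form of top degree is a multiple of the determinant in the basis `v`; `J` holds
the coordinates of the vectors `u`. -/
lemma vol_eq_epsTensor (vol : T [⋀^Fin 4]→ₗ[ℝ] ℝ) (u : Fin 4 → T) (J : Tensor2 ℝ)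
    (hu : ∀ i, u i = ∑ k, J k i • v k) :
    (fun i j k l => vol ![u i, u j, u k, u l]) = epsTensor (vol v * J.det) := by
  ext i j k l
  rw [vol.eq_smul_basis_det v, AlternatingMap.smul_apply, AlternatingMap.smul_apply,
    v.det_apply, v.det_self]
  have : v.toMatrix ![u i, u j, u k, u l] = J.submatrix id ![i, j, k, l] := by
    ext a b
    rw [Module.Basis.toMatrix_apply, Matrix.submatrix_apply, id]
    have : ∀ i, v.repr (u i) a = J a i := fun i => by
      simp [hu, Finsupp.single_apply]
    fin_cases b <;> exact this _
  rw [this, det_columns]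
  simp only [epsTensor, smul_eq_mul, mul_one]
  ring

lemma isLorentzVol_gram (m : T →ₗ[ℝ] T →ₗ[ℝ] ℝ)
    (b : Module.Basis (Fin 4) ℝ T)
    (hb : ∀ i j, m (b i) (b j) = if i = j then (if i = 0 then -1 else 1) else 0)
    (vol : T [⋀^Fin 4]→ₗ[ℝ] ℝ)
    (hvol : vol v ^ 2 = -(Matrix.of fun i j => m (v i) (v j)).det) :
    IsLorentzVol (Matrix.of fun i j => m (v i) (v j))
      (fun i j k l => vol ![v i, v j, v k, v l]) := by
  refine ⟨⟨Matrix.of fun i a => v.repr (b a) i, ?_⟩, ⟨vol v, hvol, ?_⟩⟩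
  · rw [← gram_eq_pull2 m b v (Matrix.of fun i a => v.repr (b a) i)
      fun i => (v.sum_repr (b i)).symm]
    ext i j
    rw [Matrix.of_apply, hb, minkMat_apply]
    fin_cases i <;> fin_cases j <;> simp [mink]
  · rw [vol_eq_epsTensor v vol v 1 fun i => by simp [Matrix.one_apply], det_one, mul_one]

end GramMatrix

section Chart

open Matrix

variable {M : Type*} [TopologicalSpace M] [ChartedSpace E4 M] [IsManifold (𝓡 4) ∞ M]
  {e : OpenPartialHomeomorph M E4}

/-- The coordinate vectors of a chart form a basis. -/
def coordBasis (he : e ∈ atlas E4 M) {y : E4} (hy : y ∈ e.target) :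
    Module.Basis (Fin 4) ℝ (TangentSpace (𝓡 4) (e.symm y)) :=
  (EuclideanSpace.basisFun (Fin 4) ℝ).toBasis.map
    (OpenPartialHomeomorph.MDifferentiable.mfderiv (I := 𝓡 4) (I' := 𝓡 4)
      (haveI : IsManifold (𝓡 4) 1 M := IsManifold.of_le (n := ∞) (by simp)
       (mdifferentiable_of_mem_atlas he).symm) hy).toLinearEquiv

lemma coordBasis_eq (he : e ∈ atlas E4 M) {y : E4} (hy : y ∈ e.target) :
    (coordBasis he hy : Fin 4 → _) = coordVec e y := by
  ext1 i
  refine (Module.Basis.map_apply _ _ _).trans ?_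
  change mfderiv (𝓡 4) (𝓡 4) e.symm y ((EuclideanSpace.basisFun (Fin 4) ℝ).toBasis i) = _
  rw [OrthonormalBasis.coe_toBasis, EuclideanSpace.basisFun_apply, coordVec]

variable (S : OrientedSpacetime M)

namespace OrientedSpacetime

lemma isLorentzVol (he : e ∈ atlas E4 M) {y : E4} (hy : y ∈ e.target) :
    IsLorentzVol (S.gIn e y) (S.volIn e y) := by
  obtain ⟨b, hb⟩ := S.lorentzian (e.symm y)
  have := isLorentzVol_gram (coordBasis he hy) (S.metric (e.symm y)) b hb (S.vol (e.symm y))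
    (S.vol_sq _ _)
  rw [coordBasis_eq] at this
  exact this

lemma volIn_eq (he : e ∈ atlas E4 M) {y : E4} (hy : y ∈ e.target) :
    S.volIn e y = epsTensor (S.vol (e.symm y) (coordVec e y)) := by
  have := vol_eq_epsTensor (coordBasis he hy) (S.vol (e.symm y)) (coordBasis he hy) 1 fun i => by
    simp [Matrix.one_apply]
  rw [coordBasis_eq, det_one, mul_one] at this
  exact this

lemma smooth_gIn (he : e ∈ atlas E4 M) : SmoothOn e.target (S.gIn e) :=
  fun i j => S.metric_smooth e he i j

lemma smooth_volIn (he : e ∈ atlas E4 M) (a b c d : Fin 4) :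
    ContDiffOn ℝ ∞ (fun y => S.volIn e y a b c d) e.target :=
  ((S.vol_smooth e he).mul contDiffOn_const).congr fun y hy => by
    rw [S.volIn_eq he hy, epsTensor]

variable {S}

lemma IsCanonicalBivectorOn.isTypeDOn {V : Set E4} {U : E4 → Tensor2 ℝ}
    (h : S.IsCanonicalBivectorOn e V U) (hvac : S.IsVacuum) (he : e ∈ atlas E4 M) :
    IsTypeDOn V (S.gIn e) (S.volIn e) U where
  smooth_g := (S.smooth_gIn he).mono h.subset
  smooth_η a b c d := (S.smooth_volIn he a b c d).mono h.subset
  smooth_U := h.smooth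
  lorentz _ hy := S.isLorentzVol he (h.subset hy)
  vacuum y hy := hvac e he y (h.subset hy)
  canonical := h.canonical

end OrientedSpacetime

end Chart

/-! ### Change of coordinates -/

section PulledConnection

open Matrix

/-- The algebraic core of the uniqueness of the Levi-Civita connection: symmetry in the outer
indices and antisymmetry in the last two, applied alternately, turn `K` into `-K`. -/
lemma eq_zero_of_antisymm_of_symm {R : Type*} [CommRing R] [Algebra ℂ R]
    (K : Fin 4 → Fin 4 → Fin 4 → R) (ha : ∀ i a b, K i a b = -K i b a)
    (hs : ∀ i a b, K i a b = K b a i) (i a b : Fin 4) : K i a b = 0 := by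
  refine NullFrame.two_mul_eq_zero ?_
  linear_combination hs i a b + ha b a i - hs b i a - ha a i b + hs a b i + ha i b a

variable {R : Type*} [CommRing R] [Algebra ℂ R] {D : Fin 4 → Derivation ℂ R R}
  {J G : Matrix (Fin 4) (Fin 4) R} {Γ A : Fin 4 → Matrix (Fin 4) (Fin 4) R}

/-- The matrices of a connection pulled back by a map with Jacobian matrix `J`. -/
def pullConn (J : Matrix (Fin 4) (Fin 4) R) (Γ : Fin 4 → Matrix (Fin 4) (Fin 4) R) (i : Fin 4) :
    Matrix (Fin 4) (Fin 4) R := ∑ m, J m i • Γ m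

lemma pullConn_mul_apply (i k j : Fin 4) :
    (pullConn J Γ i * J) k j = ∑ m, ∑ l, J m i * J l j * Γ m k l := by
  rw [pullConn, Matrix.sum_mul, Matrix.sum_apply]
  simp only [Matrix.smul_apply, Matrix.mul_apply, smul_eq_mul]
  exact Finset.sum_congr rfl fun m _ => Finset.sum_congr rfl fun l _ => by ring

/-- The Levi-Civita connection of a pulled back metric is the pulled back connection. -/
lemma leviCivita_pull (hG : Gᵀ = G) (hJ : ∀ i j n, D i (J n j) = D j (J n i))
    (hΓ : ∀ i j k, Γ i k j = Γ j k i)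
    (hΓc : ∀ i, dMat (D i) G = (pullConn J Γ i)ᵀ * G + G * pullConn J Γ i)
    (hA : ∀ i j k, A i k j = A j k i)
    (hAc : ∀ i, dMat (D i) (Jᵀ * G * J) = (A i)ᵀ * (Jᵀ * G * J) + Jᵀ * G * J * A i)
    {P : Matrix (Fin 4) (Fin 4) R} (hP : P * (Jᵀ * G) = 1) (i : Fin 4) :
    J * A i = pullConn J Γ i * J + dMat (D i) J := by
  -- The difference of the two sides, a tensor, is symmetric in its lower indices because both
  -- connections are torsion-free and the second derivatives of the map commute.
  have hX (i k j : Fin 4) : (J * A i - (pullConn J Γ i * J + dMat (D i) J)) k j =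
      (J * A j - (pullConn J Γ j * J + dMat (D j) J)) k i := by
    rw [Matrix.sub_apply, Matrix.sub_apply, Matrix.add_apply, Matrix.add_apply,
      pullConn_mul_apply, pullConn_mul_apply, Matrix.mul_apply, Matrix.mul_apply,
      Finset.sum_comm (f := fun m l => J m i * J l j * Γ m k l)]
    congr 1
    · exact Finset.sum_congr rfl fun l _ => by rw [hA]
    · congr 1
      · exact Finset.sum_congr rfl fun m _ => Finset.sum_congr rfl fun l _ => by
          rw [hΓ l m]; ring
      · exact hJ i j k
  -- With its upper index lowered the difference is antisymmetric, because both connections preserve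
  -- the same metric.
  have hK (i : Fin 4) : Jᵀ * G * (J * A i - (pullConn J Γ i * J + dMat (D i) J)) =
      -(Jᵀ * G * (J * A i - (pullConn J Γ i * J + dMat (D i) J)))ᵀ := by
    have h := hAc i
    rw [dMat_mul, dMat_mul, hΓc, dMat_transpose] at h
    rw [eq_neg_iff_add_eq_zero, ← sub_eq_zero.mpr h.symm]
    simp only [Matrix.transpose_mul, Matrix.transpose_add, Matrix.transpose_sub,
      Matrix.transpose_transpose, hG]
    noncomm_ring
  have h0 (i : Fin 4) : Jᵀ * G * (J * A i - (pullConn J Γ i * J + dMat (D i) J)) = 0 := by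
    ext a b
    refine eq_zero_of_antisymm_of_symm (fun i a b =>
      (Jᵀ * G * (J * A i - (pullConn J Γ i * J + dMat (D i) J))) a b)
      (fun i a b => congrFun (congrFun (hK i) a) b) (fun i a b => ?_) i a b
    simp only [Matrix.mul_apply (M := Jᵀ * G)]
    exact Finset.sum_congr rfl fun k _ => by rw [hX]
  rw [← sub_eq_zero, ← Matrix.one_mul (J * A i - _), ← hP, Matrix.mul_assoc P, h0,
    Matrix.mul_zero]

/-- The curvature of a pulled back connection. -/
lemma curvMat_pullConn {dΓ : Fin 4 → Fin 4 → Matrix (Fin 4) (Fin 4) R}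
    (hJ : ∀ i j n, D i (J n j) = D j (J n i))
    (hd : ∀ i n, dMat (D i) (Γ n) = ∑ m, J m i • dΓ m n) (i j : Fin 4) :
    curvMat D (pullConn J Γ) i j =
      ∑ m, ∑ n, (J m i * J n j) • (dΓ m n - dΓ n m + (Γ m * Γ n - Γ n * Γ m)) := by
  have hB (i j : Fin 4) : dMat (D i) (pullConn J Γ j) =
      ∑ n, D i (J n j) • Γ n + ∑ m, ∑ n, (J m i * J n j) • dΓ m n := by
    have : dMat (D i) (pullConn J Γ j) = ∑ n, (D i (J n j) • Γ n + J n j • dMat (D i) (Γ n)) := by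
      ext k l
      simp only [pullConn, dMat, Matrix.map_apply, Matrix.sum_apply, Matrix.add_apply,
        Matrix.smul_apply, smul_eq_mul, map_sum, Derivation.leibniz]
      exact Finset.sum_congr rfl fun n _ => by ring
    rw [this, Finset.sum_add_distrib]
    congr 1
    simp only [hd, Finset.smul_sum, smul_smul]
    rw [Finset.sum_comm]
    exact Finset.sum_congr rfl fun m _ => Finset.sum_congr rfl fun n _ => by rw [mul_comm]
  have hm (i j : Fin 4) : pullConn J Γ i * pullConn J Γ j =
      ∑ m, ∑ n, (J m i * J n j) • (Γ m * Γ n) := by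
    simp only [pullConn, Matrix.sum_mul, Matrix.mul_sum, Matrix.smul_mul, Matrix.mul_smul,
      Finset.smul_sum, smul_smul]
    rw [Finset.sum_comm]
    exact Finset.sum_congr rfl fun m _ => Finset.sum_congr rfl fun n _ => by rw [mul_comm]
  have sw (F : Fin 4 → Fin 4 → Matrix (Fin 4) (Fin 4) R) :
      ∑ m, ∑ n, (J m j * J n i) • F m n = ∑ m, ∑ n, (J m i * J n j) • F n m := by
    rw [Finset.sum_comm]
    exact Finset.sum_congr rfl fun m _ => Finset.sum_congr rfl fun n _ => by rw [mul_comm]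
  rw [curvMat, hB, hB, hm, hm, sw, sw]
  simp only [hJ j i, smul_add, smul_sub, Finset.sum_add_distrib, Finset.sum_sub_distrib]
  abel

end PulledConnection

/-! ### Naturality of the Riemann tensor under isometries -/

section CoordinateChange

open TopologicalSpace Matrix

/-- The Jacobian matrix of a map of coordinates. -/
def jac (φ : E4 → E4) (y : E4) : Tensor2 ℝ := fun k i => pd i (fun z => φ z k) y

lemma fderiv_single {φ : E4 → E4} {y : E4} (hφ : DifferentiableAt ℝ φ y) (i : Fin 4) :
    fderiv ℝ φ y (EuclideanSpace.single i 1) =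
      ∑ k, jac φ y k i • EuclideanSpace.single k (1 : ℝ) := by
  have hk (k : Fin 4) : jac φ y k i = fderiv ℝ φ y (EuclideanSpace.single i 1) k := by
    have := ((EuclideanSpace.proj (𝕜 := ℝ) k).hasFDerivAt.comp y hφ.hasFDerivAt).fderiv
    rw [jac, pd]
    exact congrArg (fun L => L (EuclideanSpace.single i 1)) this
  ext l
  simp [hk, Pi.single_apply]

lemma pd_comp {φ : E4 → E4} {f : E4 → ℝ} {y : E4} (hφ : DifferentiableAt ℝ φ y)
    (hf : DifferentiableAt ℝ f (φ y)) (i : Fin 4) :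
    pd i (fun z => f (φ z)) y = ∑ k, jac φ y k i * pd k f (φ y) := by
  have hc : pd i (fun z => f (φ z)) y =
      fderiv ℝ f (φ y) (fderiv ℝ φ y (EuclideanSpace.single i 1)) := by
    rw [pd, fderiv_fun_comp y hf hφ]; rfl
  rw [hc, fderiv_single hφ, map_sum]
  simp [pd]

/-- A smooth map between open sets of coordinates, which pulls back the metric `g'` to `g`. -/
structure IsIsometryOn (V V' : Opens E4) (φ : E4 → E4) (g g' : E4 → Tensor2 ℝ) : Prop where
  smooth : ContDiffOn ℝ ∞ φ V
  mapsTo : ∀ y ∈ V, φ y ∈ V'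
  metric : IsMetricOn V g
  metric' : IsMetricOn V' g'
  pull : ∀ y ∈ V, g y = pull2 (jac φ y) (g' (φ y))

namespace IsIsometryOn

variable {V V' : Opens E4} {φ : E4 → E4} {g g' : E4 → Tensor2 ℝ} (h : IsIsometryOn V V' φ g g')
include h

lemma smooth_coord (k : Fin 4) : ContDiffOn ℝ ∞ (fun y => φ y k) V :=
  ContDiff.comp_contDiffOn (g := fun z : E4 => z k) (by fun_prop) h.smooth

lemma smooth_jac : SmoothOn V (jac φ) := fun k i => contDiffOn_pd (h.smooth_coord k) i

lemma differentiableAt (y : V) : DifferentiableAt ℝ φ y :=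
  (h.smooth.contDiffAt (V.2.mem_nhds y.2)).differentiableAt (by simp)

/-- The composition of a smooth function with the map. -/
def comp (f : E4 → ℝ) (hf : ContDiffOn ℝ ∞ f V') : smoothAlg V :=
  ofRealFun (fun y => f (φ y)) (hf.comp h.smooth h.mapsTo)

lemma evalHom_comp (f : E4 → ℝ) (hf : ContDiffOn ℝ ∞ f V') (y : V) :
    evalHom y (h.comp f hf) = (f (φ y) : ℂ) := rfl

lemma pdDer_comp (f : E4 → ℝ) (hf : ContDiffOn ℝ ∞ f V') (i : Fin 4) :
    pdDer V i (h.comp f hf) =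
      ∑ m, matOf (jac φ) h.smooth_jac m i * h.comp (pd m f) (contDiffOn_pd hf m) := by
  refine ext_evalHom fun y => ?_
  have hf' : DifferentiableAt ℝ f (φ y) :=
    (hf.contDiffAt (V'.2.mem_nhds (h.mapsTo y y.2))).differentiableAt (by simp)
  rw [comp, pdDer_ofRealFun, evalHom_ofRealFun, pd_comp (h.differentiableAt y) hf', map_sum]
  push_cast
  exact Finset.sum_congr rfl fun m _ => by rw [map_mul]; rfl

lemma pdDer_jac (i j n : Fin 4) : pdDer V i (matOf (jac φ) h.smooth_jac n j) =
    pdDer V j (matOf (jac φ) h.smooth_jac n i) := by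
  have e (i : Fin 4) : matOf (jac φ) h.smooth_jac n i =
      pdDer V i (ofRealFun (fun y => φ y n) (h.smooth_coord n)) := by
    rw [pdDer_ofRealFun]; rfl
  rw [e, e, pdDer_comm]

/-- The metric `g'` as a matrix of functions on `V`. -/
def metricMat : Tensor2 (smoothAlg V) := fun i j => h.comp (fun y => g' y i j) (h.metric'.smooth i j)

/-- The Christoffel symbols of `g'` as functions on `V`. -/
def connMat (m : Fin 4) : Tensor2 (smoothAlg V) := fun k l =>
  h.comp (christoffel g' k l m) (h.metric'.smooth_christoffel k l m)

lemma matOf_eq : matOf g h.metric.smooth =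
    (matOf (jac φ) h.smooth_jac)ᵀ * h.metricMat * matOf (jac φ) h.smooth_jac := by
  ext1 a b
  refine ext_evalHom fun y => ?_
  rw [← Matrix.map_apply (f := evalHom y), ← Matrix.map_apply (f := evalHom y), Matrix.map_mul,
    Matrix.map_mul, Matrix.transpose_map, map_matOf, map_matOf]
  change toC (g y) a b = ((toC (jac φ y))ᵀ * toC (g' (φ y)) * toC (jac φ y)) a b
  rw [← toC_transpose, ← toC_mul, ← toC_mul, h.pull y y.2, pull2]

lemma exists_left_inv :
    ∃ P, P * ((matOf (jac φ) h.smooth_jac)ᵀ * h.metricMat) = 1 := by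
  refine ⟨matOf (jac φ) h.smooth_jac * matOf _ h.metric.smooth_inv, mul_eq_one_comm.mp ?_⟩
  rw [← Matrix.mul_assoc, ← h.matOf_eq]
  ext1 a b
  refine ext_evalHom fun y => ?_
  rw [← Matrix.map_apply (f := evalHom y), ← Matrix.map_apply (f := evalHom y), Matrix.map_mul,
    map_matOf, map_matOf, ← toC_mul, Matrix.mul_nonsing_inv _ (h.metric.isUnit_det y y.2)]
  simp only [toC, Matrix.map_apply, Matrix.one_apply]
  split_ifs <;> simp

lemma metricMat_symm : h.metricMatᵀ = h.metricMat :=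
  Matrix.ext fun i j => ext_evalHom fun y => by
    change ((g' (φ y) j i : ℝ) : ℂ) = (g' (φ y) i j : ℝ)
    rw [← congrFun (congrFun (h.metric'.symm _ (h.mapsTo y y.2)) i) j, Matrix.transpose_apply]

lemma connMat_symm (i j k : Fin 4) : h.connMat i k j = h.connMat j k i :=
  ext_evalHom fun y => by
    simp only [connMat, evalHom_comp]
    rw [christoffel_symm h.metric'.symm (h.mapsTo y y.2)]

lemma connMat_compat (i : Fin 4) : dMat (pdDer V i) h.metricMat =
    (pullConn (matOf (jac φ) h.smooth_jac) h.connMat i)ᵀ * h.metricMat +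
      h.metricMat * pullConn (matOf (jac φ) h.smooth_jac) h.connMat i := by
  have e (m j k : Fin 4) : h.comp (pd m fun y => g' y j k) (contDiffOn_pd (h.metric'.smooth j k) m) =
      ((h.connMat m)ᵀ * h.metricMat + h.metricMat * h.connMat m) j k := ext_evalHom fun y => by
    have hs := christoffel_symm h.metric'.symm (h.mapsTo y y.2)
    simp only [Matrix.add_apply, Matrix.mul_apply, Matrix.transpose_apply, connMat, metricMat,
      map_add, map_sum, map_mul, evalHom_comp]
    rw [christoffel_compat h.metric'.symm h.metric'.isUnit_det (h.mapsTo y y.2)]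
    push_cast
    simp only [hs _ m]
  have e2 : dMat (pdDer V i) h.metricMat = ∑ m, matOf (jac φ) h.smooth_jac m i •
      ((h.connMat m)ᵀ * h.metricMat + h.metricMat * h.connMat m) := by
    ext1 j k
    rw [dMat, Matrix.map_apply, metricMat, pdDer_comp, Matrix.sum_apply]
    exact Finset.sum_congr rfl fun m _ => by rw [Matrix.smul_apply, smul_eq_mul, ← e]
  rw [e2, pullConn, Matrix.transpose_sum, Matrix.sum_mul, Matrix.mul_sum,
    ← Finset.sum_add_distrib]
  exact Finset.sum_congr rfl fun m _ => by
    rw [smul_add, Matrix.transpose_smul, Matrix.smul_mul, Matrix.mul_smul]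

/-- The transformation law of the Christoffel symbols. -/
lemma gammaMat_eq (i : Fin 4) : matOf (jac φ) h.smooth_jac * h.metric.gammaMat i =
    pullConn (matOf (jac φ) h.smooth_jac) h.connMat i * matOf (jac φ) h.smooth_jac +
      dMat (pdDer V i) (matOf (jac φ) h.smooth_jac) := by
  obtain ⟨P, hP⟩ := h.exists_left_inv
  refine leviCivita_pull h.metricMat_symm h.pdDer_jac h.connMat_symm h.connMat_compat
    h.metric.gammaMat_symm (fun i => ?_) hP i
  rw [← h.matOf_eq]
  exact h.metric.gammaMat_compat i

/-- The derivatives of the Christoffel symbols of `g'` as functions on `V`. -/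
def dConnMat (m n : Fin 4) : Tensor2 (smoothAlg V) := fun k l =>
  h.comp (pd m (christoffel g' k l n)) (contDiffOn_pd (h.metric'.smooth_christoffel k l n) m)

lemma curvMat_connMat (i j : Fin 4) :
    curvMat (pdDer V) (pullConn (matOf (jac φ) h.smooth_jac) h.connMat) i j =
      ∑ m, ∑ n, (matOf (jac φ) h.smooth_jac m i * matOf (jac φ) h.smooth_jac n j) •
        (h.dConnMat m n - h.dConnMat n m +
          (h.connMat m * h.connMat n - h.connMat n * h.connMat m)) := by
  refine curvMat_pullConn h.pdDer_jac (fun i n => ?_) i j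
  ext1 k l
  rw [dMat, Matrix.map_apply, connMat, pdDer_comp, Matrix.sum_apply]
  exact Finset.sum_congr rfl fun m _ => by rw [Matrix.smul_apply, smul_eq_mul, dConnMat]

lemma evalHom_curv (m n k l : Fin 4) (y : V) :
    evalHom y ((h.dConnMat m n - h.dConnMat n m +
      (h.connMat m * h.connMat n - h.connMat n * h.connMat m)) k l) =
      (riemannUp g' k l m n (φ y) : ℂ) := by
  have hs (k i j : Fin 4) := christoffel_symm h.metric'.symm (h.mapsTo y y.2) k i j
  simp only [Matrix.add_apply, Matrix.sub_apply, Matrix.mul_apply, dConnMat, connMat, map_add,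
    map_sub, map_sum, map_mul, evalHom_comp, riemannUp]
  push_cast
  rw [Finset.sum_sub_distrib]
  have e (p q : Fin 4) : ∑ r, (christoffel g' k r p (φ y) : ℂ) * (christoffel g' r l q (φ y) : ℂ) =
      ∑ r, (christoffel g' k p r (φ y) : ℂ) * (christoffel g' r l q (φ y) : ℂ) :=
    Finset.sum_congr rfl fun r _ => by rw [hs k r p]
  rw [e, e]

/-- The curvature tensor is natural. -/
theorem riemann_eq {y : E4} (hy : y ∈ V) : riemann g y = pull4 (jac φ y) (riemann g' (φ y)) := by
  have h1 (i j : Fin 4) : jac φ y * (Matrix.of fun k l => riemannUp g k l i j y) =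
      (∑ m, ∑ n, (jac φ y m i * jac φ y n j) •
        Matrix.of fun k l => riemannUp g' k l m n (φ y)) * jac φ y := by
    -- The transformation law of the Christoffel symbols is the gauge relation with the Jacobian
    -- matrix in the role of `E`.
    have hg := gauge_curvMat (pdDer V) pdDer_comm _ _ _ h.gammaMat_eq i j
    rw [h.curvMat_connMat] at hg
    ext a b
    have := congrArg (evalHom (⟨y, hy⟩ : V)) (congrFun (congrFun hg a) b)
    simp only [Matrix.mul_apply, Matrix.sum_apply, Matrix.smul_apply, smul_eq_mul, map_sum,
      map_mul, h.evalHom_curv, h.metric.evalHom_curvMat, matOf, evalHom_ofRealFun] at this ⊢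
    simp only [Matrix.of_apply]
    exact_mod_cast this
  ext a b i j
  have h2 : riemann g y a b i j = (g y * Matrix.of fun k l => riemannUp g k l i j y) a b := rfl
  have h3 (m n : Fin 4) : (g' (φ y) * Matrix.of fun k l => riemannUp g' k l m n (φ y)) =
      Matrix.of fun k l => riemann g' (φ y) k l m n := rfl
  rw [h2, h.pull y hy, pull2, Matrix.mul_assoc, h1, ← Matrix.mul_assoc, Matrix.mul_assoc _ (g' _),
    Matrix.mul_sum]
  simp only [Matrix.mul_sum (M := g' (φ y)), Matrix.mul_smul, h3]
  change pull2 (jac φ y) _ a b = _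
  rw [pull2_apply, pull4]
  refine Finset.sum_congr rfl fun k _ => Finset.sum_congr rfl fun l _ => ?_
  simp only [Matrix.sum_apply, Matrix.smul_apply, Matrix.of_apply, smul_eq_mul, Finset.mul_sum]

end IsIsometryOn

end CoordinateChange

/-! ### Transition maps between charts -/

section Transition

open TopologicalSpace Matrix

variable {M : Type*} [TopologicalSpace M] [ChartedSpace E4 M] [IsManifold (𝓡 4) ∞ M]
  {e e' : OpenPartialHomeomorph M E4}

/-- The domain of the change of coordinates from `e` to `e'`. -/
def overlap (e e' : OpenPartialHomeomorph M E4) : Opens E4 :=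
  ⟨(e.symm.trans e').source, (e.symm.trans e').open_source⟩

lemma contDiffOn_transition (he : e ∈ atlas E4 M) (he' : e' ∈ atlas E4 M) :
    ContDiffOn ℝ ∞ (e.symm.trans e') (overlap e e') := by
  rw [← contMDiffOn_iff_contDiffOn]
  have h1 := contMDiffOn_symm_of_mem_maximalAtlas (I := 𝓡 4) (n := ∞)
    (IsManifold.subset_maximalAtlas he)
  have h2 := contMDiffOn_of_mem_maximalAtlas (I := 𝓡 4) (n := ∞)
    (IsManifold.subset_maximalAtlas he')
  exact h2.comp (h1.mono fun y hy => hy.1) fun y hy => hy.2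

lemma symm_transition {y : E4} (hy : y ∈ overlap e e') :
    e'.symm ((e.symm.trans e') y) = e.symm y := e'.left_inv hy.2

lemma transition_mem {y : E4} (hy : y ∈ overlap e e') : (e.symm.trans e') y ∈ e'.target :=
  e'.map_source hy.2

/-- The chain rule for `e.symm`, which near `y` is the composition of `e'.symm` with the transition
map. -/
lemma coordVec_transition (he : e ∈ atlas E4 M) (he' : e' ∈ atlas E4 M) {y : E4}
    (hy : y ∈ overlap e e') (i : Fin 4) :
    (coordVec e y i : TangentSpace (𝓡 4) (e'.symm ((e.symm.trans e') y))) =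
      ∑ k, jac (e.symm.trans e') y k i • coordVec e' ((e.symm.trans e') y) k := by
  have : IsManifold (𝓡 4) 1 M := IsManifold.of_le (n := ∞) (by simp)
  have hd : DifferentiableAt ℝ (e.symm.trans e') y :=
    ((contDiffOn_transition he he').contDiffAt ((overlap e e').2.mem_nhds hy)).differentiableAt
      (by simp)
  have hd' : MDifferentiableAt (𝓡 4) (𝓡 4) e'.symm ((e.symm.trans e') y) :=
    mdifferentiableAt_atlas_symm he' (transition_mem hy)
  have heq : e.symm =ᶠ[nhds y] e'.symm ∘ (e.symm.trans e') :=
    Filter.eventually_of_mem ((overlap e e').2.mem_nhds hy) fun z hz => (symm_transition hz).symm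
  have h1 : coordVec e y i = mfderiv (𝓡 4) (𝓡 4) e'.symm ((e.symm.trans e') y)
      (fderiv ℝ (e.symm.trans e') y (EuclideanSpace.single i 1)) := by
    rw [coordVec, heq.mfderiv_eq, mfderiv_comp y hd' hd.mdifferentiableAt, mfderiv_eq_fderiv]
    rfl
  rw [fderiv_single hd] at h1
  refine h1.trans ((map_sum (mfderiv (𝓡 4) (𝓡 4) e'.symm ((e.symm.trans e') y)) _ _).trans
    (Finset.sum_congr rfl fun k _ => ?_))
  exact map_smul (mfderiv (𝓡 4) (𝓡 4) e'.symm ((e.symm.trans e') y)) _ _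

variable (S : OrientedSpacetime M)

namespace OrientedSpacetime

lemma gIn_transition (he : e ∈ atlas E4 M) (he' : e' ∈ atlas E4 M) {y : E4}
    (hy : y ∈ overlap e e') :
    S.gIn e y = pull2 (jac (e.symm.trans e') y) (S.gIn e' ((e.symm.trans e') y)) := by
  have := gram_eq_pull2 (S.metric (e'.symm ((e.symm.trans e') y))) _ _ _
    (coordVec_transition he he' hy)
  refine Eq.trans ?_ this
  -- The tangent spaces on the two sides belong to points that are only propositionally equal;
  -- stating the equality for arbitrary `x = x'` lets it be substituted.
  have key {x x' : M} (hx : x = x') (u : Fin 4 → E4) :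
      (fun i j => S.metric x (u i : TangentSpace (𝓡 4) x) (u j : TangentSpace (𝓡 4) x)) =
      (Matrix.of fun i j =>
        S.metric x' (u i : TangentSpace (𝓡 4) x') (u j : TangentSpace (𝓡 4) x')) := by
    subst hx; rfl
  exact key (symm_transition hy).symm (fun i => coordVec e y i)

lemma volIn_transition (he : e ∈ atlas E4 M) (he' : e' ∈ atlas E4 M) {y : E4}
    (hy : y ∈ overlap e e') :
    S.volIn e y = pull4 (jac (e.symm.trans e') y) (S.volIn e' ((e.symm.trans e') y)) := by
  have hb := coordBasis_eq he' (transition_mem hy)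
  have := vol_eq_epsTensor (coordBasis he' (transition_mem hy))
    (S.vol (e'.symm ((e.symm.trans e') y))) _ _ (by
      rw [hb]; exact coordVec_transition he he' hy)
  rw [S.volIn_eq he' (transition_mem hy), pull4_epsTensor, ← hb, ← this]
  have key {x x' : M} (hx : x = x') (u : Fin 4 → E4) :
      (fun i j k l => S.vol x (![u i, u j, u k, u l] : Fin 4 → TangentSpace (𝓡 4) x)) =
      (fun i j k l => S.vol x' (![u i, u j, u k, u l] : Fin 4 → TangentSpace (𝓡 4) x')) := by
    subst hx; rfl
  exact key (symm_transition hy).symm (fun i => coordVec e y i)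

lemma isMetricOn (he : e ∈ atlas E4 M) : IsMetricOn e.target (S.gIn e) :=
  ⟨S.smooth_gIn he, fun _ hy => (S.isLorentzVol he hy).symm,
    fun _ hy => (S.isLorentzVol he hy).isUnit_det⟩

lemma isIsometryOn (he : e ∈ atlas E4 M) (he' : e' ∈ atlas E4 M) :
    IsIsometryOn (overlap e e') ⟨e'.target, e'.open_target⟩ (e.symm.trans e') (S.gIn e)
      (S.gIn e') where
  smooth := contDiffOn_transition he he'
  mapsTo _ hy := transition_mem hy
  metric :=
    have h := S.isMetricOn he
    ⟨h.smooth.mono fun _ hy => hy.1, fun y hy => h.symm y hy.1, fun y hy => h.isUnit_det y hy.1⟩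
  metric' := S.isMetricOn he'
  pull _ hy := S.gIn_transition he he' hy

variable {S}

lemma weyl_transition (hvac : S.IsVacuum) (he : e ∈ atlas E4 M) (he' : e' ∈ atlas E4 M) {y : E4}
    (hy : y ∈ overlap e e') : weyl (S.gIn e) y =
      pull4 (jac (e.symm.trans e') y) (weyl (S.gIn e') ((e.symm.trans e') y)) := by
  rw [weyl_eq_riemann (hvac e he y hy.1), weyl_eq_riemann (hvac e' he' _ (transition_mem hy)),
    (S.isIsometryOn he he').riemann_eq hy]

/-- Whether the eigenvalue of the Weyl tensor is real does not depend on the chart. -/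
lemma isRealAt_transition (hvac : S.IsVacuum) (hD : S.IsTypeD) (he : e ∈ atlas E4 M)
    (he' : e' ∈ atlas E4 M) {y : E4} (hy : y ∈ overlap e e')
    (hr : IsRealAt (S.gIn e') (S.volIn e') ((e.symm.trans e') y)) :
    IsRealAt (S.gIn e) (S.volIn e) y := by
  obtain ⟨w', U', h'⟩ := hD e' he' _ (transition_mem hy)
  have hl := S.isLorentzVol he hy.1
  have hJ : IsUnit (jac (e.symm.trans e') y).det := by
    have h1 := hl.isUnit_det
    rw [S.gIn_transition he he' hy, det_pull2, IsUnit.mul_iff] at h1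
    exact (isUnit_pow_iff two_ne_zero).mp h1.1
  have h2 := h'.pull hJ
  rw [← S.gIn_transition he he' hy, ← S.volIn_transition he he' hy,
    ← weyl_transition hvac he he' hy] at h2
  intro w U h
  rw [h.eigenvalue_unique hl h2]
  exact hr w' U' h'

end OrientedSpacetime

end Transition

/-! ### From local to global -/

section Global

open TopologicalSpace Filter Topology

variable {M : Type*} [TopologicalSpace M] [ChartedSpace E4 M] [IsManifold (𝓡 4) ∞ M]
  {S : OrientedSpacetime M}
  {T T' : (E4 → Tensor2 ℝ) → (E4 → Tensor4 ℝ) → (E4 → Tensor2 ℝ) → E4 → Fin 4 → ℝ}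

namespace OrientedSpacetime

lemma IsCanonicalBivectorOn.mono {e : OpenPartialHomeomorph M E4} {V : Set E4}
    {U : E4 → Tensor2 ℝ} (h : S.IsCanonicalBivectorOn e V U) {B : Opens E4}
    (hB : (B : Set E4) ⊆ V) : S.IsCanonicalBivectorOn e B U where
  isOpen := B.2
  subset := hB.trans h.subset
  smooth a b := (h.smooth a b).mono hB
  canonical y hy := h.canonical y (hB hy)

lemma Vanishes.exists_framed (hT : S.Vanishes T) (hvac : S.IsVacuum)
    {e : OpenPartialHomeomorph M E4} (he : e ∈ atlas E4 M) {y : E4} (hy : y ∈ e.target) :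
    ∃ (B : Opens E4) (U : E4 → Tensor2 ℝ) (X Y : Fin 4 → ℝ), y ∈ B ∧ Convex ℝ (B : Set E4) ∧
      S.IsCanonicalBivectorOn e B U ∧ IsFramedOn B (S.gIn e) (S.volIn e) U X Y ∧
      ∀ z ∈ B, T (S.gIn e) (S.volIn e) U z = 0 := by
  obtain ⟨V, U, hyV, hU, hV⟩ := hT e he y hy
  obtain ⟨B, X, Y, hyB, hB, hconv, hf⟩ := (hU.isTypeDOn hvac he).exists_framed hU.isOpen hyV
  exact ⟨B, U, X, Y, hyB, hconv, hU.mono hB, hf, fun z hz => hV z (hB hz)⟩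

/-- Implications between vanishing conditions are local, and the bivector field that witnesses the
hypothesis also witnesses the conclusion. No comparison between different choices of `U` is
therefore needed. -/
lemma Vanishes.imp (hT : S.Vanishes T) (hvac : S.IsVacuum)
    (h : ∀ e ∈ atlas E4 M, ∀ (B : Opens E4) (U : E4 → Tensor2 ℝ) (X Y : Fin 4 → ℝ) (y : E4),
      IsFramedOn B (S.gIn e) (S.volIn e) U X Y → Convex ℝ (B : Set E4) → y ∈ B →
      (B : Set E4) ⊆ e.target →
      (∀ z ∈ B, T (S.gIn e) (S.volIn e) U z = 0) → ∀ z ∈ B, T' (S.gIn e) (S.volIn e) U z = 0) :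
    S.Vanishes T' := fun e he y hy => by
  obtain ⟨B, U, X, Y, hyB, hconv, hU, hf, hB⟩ := hT.exists_framed hvac he hy
  exact ⟨B, U, hyB, hU, h e he B U X Y y hf hconv hyB hU.subset hB⟩

variable (S) in
/-- The set of the points near which the eigenvalue of the Weyl tensor is real. -/
def realSet : Set M :=
  {x | ∃ e ∈ atlas E4 M, x ∈ e.source ∧ ∀ᶠ z in 𝓝 (e x), IsRealAt (S.gIn e) (S.volIn e) z}

lemma isOpen_realSet : IsOpen S.realSet := isOpen_iff_mem_nhds.mpr fun x ⟨e, he, hx, h⟩ => by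
  filter_upwards [(e.continuousAt hx).eventually h.eventually_nhds, e.open_source.mem_nhds hx]
    with z hz hz'
  exact ⟨e, he, hz', hz⟩

/-- A point of `realSet` comes with some chart; by the covariance of the eigenvalue, every chart
around the point will do. -/
lemma eventually_isRealAt (hvac : S.IsVacuum) (hD : S.IsTypeD) {x : M} (hx : x ∈ S.realSet)
    {e : OpenPartialHomeomorph M E4} (he : e ∈ atlas E4 M) (hxe : x ∈ e.source) :
    ∀ᶠ z in 𝓝 (e x), IsRealAt (S.gIn e) (S.volIn e) z := by
  obtain ⟨e', he', hxe', h⟩ := hx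
  have hm : e x ∈ overlap e e' := ⟨e.map_source hxe, by
    change e.symm (e x) ∈ e'.source
    rwa [e.left_inv hxe]⟩
  have hc : ContinuousAt (e.symm.trans e') (e x) := (e.symm.trans e').continuousAt hm
  have hx' : (e.symm.trans e') (e x) = e' x := by
    change e' (e.symm (e x)) = e' x
    rw [e.left_inv hxe]
  rw [← hx'] at h
  filter_upwards [hc.eventually h, (overlap e e').2.mem_nhds hm] with z hz hz'
  exact isRealAt_transition hvac hD he he' hz' hz

/-- For closedness: a limit point has a framed convex neighbourhood, which contains a point of the
set; from there the reality of the eigenvalue propagates over the whole neighbourhood. -/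
lemma realSet_eq_univ [PreconnectedSpace M] (hvac : S.IsVacuum) (hD : S.IsTypeD)
    (hT : S.Vanishes T) (hne : S.realSet.Nonempty)
    (h : ∀ e ∈ atlas E4 M, ∀ (B : Opens E4) (U : E4 → Tensor2 ℝ) (X Y : Fin 4 → ℝ) (y : E4),
      IsFramedOn B (S.gIn e) (S.volIn e) U X Y → Convex ℝ (B : Set E4) → y ∈ B →
      (∀ z ∈ B, T (S.gIn e) (S.volIn e) U z = 0) →
      (∀ᶠ z in 𝓝 y, IsRealAt (S.gIn e) (S.volIn e) z) →
      ∀ z ∈ B, IsRealAt (S.gIn e) (S.volIn e) z) : S.realSet = Set.univ := by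
  refine IsClopen.eq_univ ⟨isClosed_of_closure_subset fun x hx => ?_, isOpen_realSet⟩ hne
  have he := chart_mem_atlas E4 x
  have hxe := mem_chart_source E4 x
  obtain ⟨B, U, X, Y, hyB, hconv, hU, hf, hB⟩ :=
    hT.exists_framed hvac he ((chartAt E4 x).map_source hxe)
  obtain ⟨x', ⟨hx'e, hx'B⟩, hx'⟩ := mem_closure_iff_nhds.mp hx _
    (Filter.inter_mem ((chartAt E4 x).open_source.mem_nhds hxe)
      (((chartAt E4 x).continuousAt hxe).preimage_mem_nhds (B.2.mem_nhds hyB)))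
  have := h _ he B U X Y _ hf hconv hx'B hB (eventually_isRealAt hvac hD hx' he hx'e)
  exact ⟨_, he, hxe, Filter.eventually_of_mem (B.2.mem_nhds hyB) this⟩

/-- If `T` vanishes, then either `T'` vanishes as well, or the eigenvalue is real near some
point. -/
lemma realSet_nonempty (hvac : S.IsVacuum) (hT : S.Vanishes T) (hT' : ¬ S.Vanishes T')
    (h : ∀ e ∈ atlas E4 M, ∀ (B : Opens E4) (U : E4 → Tensor2 ℝ) (X Y : Fin 4 → ℝ) (y : E4),
      IsFramedOn B (S.gIn e) (S.volIn e) U X Y → y ∈ B →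
      (∀ z ∈ B, T (S.gIn e) (S.volIn e) U z = 0) → T' (S.gIn e) (S.volIn e) U y ≠ 0 →
      ∀ᶠ z in 𝓝 y, IsRealAt (S.gIn e) (S.volIn e) z) : S.realSet.Nonempty := by
  by_contra hne
  refine hT' (hT.imp hvac fun e he B U X Y y hf _ _ hsub hB z hz => ?_)
  by_contra hz'
  refine hne ⟨e.symm z, e, he, e.map_target (hsub hz), ?_⟩
  rw [e.right_inv (hsub hz)]
  exact h e he B U X Y z hf hz hB hz'

end OrientedSpacetime

end Global

end TypeDVacuum

end

theorem mainTheorem5 {M : Type*} [TopologicalSpace M] [ConnectedSpace M]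
    [ChartedSpace TypeDVacuum.E4 M] [IsManifold (𝓡 4) ∞ M]
    (S : TypeDVacuum.OrientedSpacetime M) (hvac : S.IsVacuum) (hD : S.IsTypeD) :
    (S.Vanishes TypeDVacuum.vPhi → S.Vanishes TypeDVacuum.vPsi) ∧
    (S.Vanishes TypeDVacuum.hPhi → S.Vanishes TypeDVacuum.hPsi) ∧
    (S.Vanishes TypeDVacuum.vPsi →
      S.Vanishes TypeDVacuum.vPhi ∨ S.Vanishes TypeDVacuum.hPsi) ∧
    (S.Vanishes TypeDVacuum.hPsi →
      S.Vanishes TypeDVacuum.hPhi ∨ S.Vanishes TypeDVacuum.vPsi) := by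
  open TypeDVacuum OrientedSpacetime in
  refine ⟨fun h => h.imp hvac fun _ _ _ _ _ _ _ hf _ _ _ hB => hf.vPsi_eq_zero_of_vPhi hB,
    fun h => h.imp hvac fun _ _ _ _ _ _ _ hf _ _ _ hB => hf.hPsi_eq_zero_of_hPhi hB,
    fun h => or_iff_not_imp_left.mpr fun hne => ?_,
    fun h => or_iff_not_imp_left.mpr fun hne => ?_⟩
  -- If $v(\Phi)$ does not vanish identically, the eigenvalue is real near some point, and hence
  -- everywhere by connectedness.
  · have hr := realSet_eq_univ hvac hD h
      (realSet_nonempty hvac h hne fun _ _ _ _ _ _ _ hf hy hB => hf.isRealAt_of_vPhi_ne_zero hB hy)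
      fun _ _ _ _ _ _ _ hf hc hy hB hr z hz => (hf.real_of_vPsi hc hB hy hr z hz).1
    -- The local result is applied once more around every point, now for its second conclusion
    -- $h(\Psi)=0$.
    refine h.imp hvac fun e he B U X Y y hf hc hy hsub hB z hz => ?_
    have := eventually_isRealAt hvac hD (hr.symm ▸ Set.mem_univ (e.symm y)) he
      (e.map_target (hsub hy))
    rw [e.right_inv (hsub hy)] at this
    exact (hf.real_of_vPsi hc hB hy this z hz).2
  · have hr := realSet_eq_univ hvac hD h
      (realSet_nonempty hvac h hne fun _ _ _ _ _ _ _ hf hy hB => hf.isRealAt_of_hPhi_ne_zero hB hy)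
      fun _ _ _ _ _ _ _ hf hc hy hB hr z hz => (hf.real_of_hPsi hc hB hy hr z hz).1
    refine h.imp hvac fun e he B U X Y y hf hc hy hsub hB z hz => ?_
    have := eventually_isRealAt hvac hD (hr.symm ▸ Set.mem_univ (e.symm y)) he
      (e.map_target (hsub hy))
    rw [e.right_inv (hsub hy)] at this
    exact (hf.real_of_hPsi hc hB hy this z hz).2
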